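/- Proposition 9.14. All graphs are simple. Definitions. Let $G$ be a graph. An *end* of $G$ is an equivalence class of rays of $G$, where two rays are equivalent if for every finite set $S$ of vertices they have tails in the same component of $G-S$; $\Omega(G)$ is the set of ends. Let $|G|$ be the set $V(G)\sqcup\Omega(G)\sqcup\big((0,1)\times E(G)\big)$ with the following basic open neighbourhoods: $\epsilon$-balls ($\epsilon\le 1$) about vertices, where every edge has length $1$; small open intervals of an edge about its inner points; and, for an end $\omega$ and a finite $S\subseteq V(G)$, the set $\hat C(S,\omega)$ of all vertices of the component $C(S,\omega)$ of $G-S$ containing a ray of $\omega$, all inner points of edges contained in or incident with $C(S,\omega)$, and all ends represented by a ray in $C(S,\omega)$. For $\Psi\subseteq\Omega(G)$ let $|G|_\Psi=|G|\setminus(\Omega(G)\setminus\Psi)$, with vertex set $V(G)\cup\Psi$. Let $\tilde G_\Psi$ be the quotient of $|G|_\Psi$ that identifies two of these vertices if and only if they lie on the same side whenever two disjoint open sets partition the vertex set $V(G)\cup\Psi$. A *$\Psi$-circuit* is a set of edges whose closure in $\tilde G_\Psi$ is homeomorphic to the unit circle. A cut of $G$ is *$\Psi$-bounded* if its closure in $|G|_\Psi$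 contains no end, and a *$\Psi^{\complement}$-bond* is a minimal nonempty $\Psi$-bounded cut. The pair $(G,\Psi)$ *induces* a (possibly infinite) matroid $M$ if $E(M)=E(G)$, the circuits of $M$ are the $\Psi$-circuits and the cocircuits of $M$ are the $\Psi^{\complement}$-bonds. A rooted spanning tree $T$ of $H$ is *normal* if the endvertices of every edge of $H$ are comparable in the tree order of $T$. Statement. For every countable graph $G$ there are a graph $H$ having a locally finite normal spanning tree, a set $C\subseteq E(H)$, a bijection $E(G)\to E(H)\setminus C$ (by which these two sets are identified) and an injective map $h:\Omega(G)\to\Omega(H)$ such that the following holds for every $\Psi_G\subseteq\Omega(G)$. Put $\Psi_H=h(\Psi_G)\subseteq\Omega(H)$; if $(H,\Psi_H)$ induces a matroid $M$, then $(G,\Psi_G)$ induces $M/C$. If moreover $G$ is connected, then $H$, $C$, the bijection and $h$ can be chosen so that in addition $G=H/C$ and the bijection is the corresponding identification of edges: there is a surjection $\pi:V(H)\to V(G)$ whose fibres are the vertex sets of the components of the graph $(V(H),C)$, and every edge of $G$ has as endvertices the images under $\pi$ of the endvertices of the corresponding edge of $H$. -/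

import Mathlib

universe u

namespace EndMatroid

variable {V : Type u}

/-- A ray of `G`: a one-way infinite path. -/
structure Ray (G : SimpleGraph V) where
  toFun : ℕ → V
  injective : Function.Injective toFun
  adj : ∀ n, G.Adj (toFun n) (toFun (n + 1))

/-- `x` and `y` are vertices outside `S` in the same component of `G - S`. -/
def JoinedOff (G : SimpleGraph V) (S : Finset V) (x y : V) : Prop :=
  ∃ p : G.Walk x y, ∀ z ∈ p.support, z ∉ S

theorem JoinedOff.symm {G : SimpleGraph V} {S : Finset V} {x y : V}
    (h : JoinedOff G S x y) : JoinedOff G S y x := by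
  obtain ⟨p, hp⟩ := h
  exact ⟨p.reverse, fun z hz => hp z (by simpa using hz)⟩

theorem JoinedOff.trans {G : SimpleGraph V} {S : Finset V} {x y z : V}
    (h : JoinedOff G S x y) (h' : JoinedOff G S y z) : JoinedOff G S x z := by
  obtain ⟨p, hp⟩ := h
  obtain ⟨q, hq⟩ := h'
  refine ⟨p.append q, fun w hw => ?_⟩
  rw [SimpleGraph.Walk.mem_support_append_iff] at hw
  exact hw.elim (hp w) (hq w)

theorem JoinedOff.mono {G : SimpleGraph V} {S S' : Finset V} (hS : S ⊆ S') {x y : V}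
    (h : JoinedOff G S' x y) : JoinedOff G S x y := by
  obtain ⟨p, hp⟩ := h
  exact ⟨p, fun z hz hzS => hp z hz (hS hzS)⟩

/-- Two rays are equivalent if no finite set `S` of vertices separates them, that is, for every
finite `S` they have tails in the same component of `G - S`. -/
def Ray.Equivalent {G : SimpleGraph V} (R R' : Ray G) : Prop :=
  ∀ S : Finset V, ∃ N : ℕ, ∀ m ≥ N, ∀ n ≥ N, JoinedOff G S (R.toFun m) (R'.toFun n)

theorem Ray.equivalent_refl {G : SimpleGraph V} (R : Ray G) : R.Equivalent R := by
  intro S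
  have hfin : (R.toFun ⁻¹' (S : Set V)).Finite :=
    S.finite_toSet.preimage R.injective.injOn
  obtain ⟨N, hN⟩ := hfin.bddAbove
  have hout : ∀ n ≥ N + 1, R.toFun n ∉ S := fun n hn hS => by
    have h1 : n ≤ N := hN (show n ∈ R.toFun ⁻¹' (S : Set V) from hS)
    omega
  have key : ∀ m ≥ N + 1, ∀ k, JoinedOff G S (R.toFun m) (R.toFun (m + k)) := by
    intro m hm k
    induction k with
    | zero => exact ⟨.nil, by simpa using hout m hm⟩
    | succ k ih =>
      refine ih.trans ⟨(R.adj (m + k)).toWalk, ?_⟩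
      intro z hz
      simp only [SimpleGraph.Walk.support_cons, SimpleGraph.Walk.support_nil,
        List.mem_cons, List.not_mem_nil, or_false] at hz
      rcases hz with rfl | rfl
      · exact hout _ (by omega)
      · exact hout _ (by omega)
  refine ⟨N + 1, fun m hm n hn => ?_⟩
  rcases le_total m n with h | h
  · obtain ⟨k, rfl⟩ := Nat.exists_eq_add_of_le h
    exact key m hm k
  · obtain ⟨k, rfl⟩ := Nat.exists_eq_add_of_le h
    exact (key n hn k).symm

/-- Equivalence of rays. -/
def raySetoid (G : SimpleGraph V) : Setoid (Ray G) where
  r := Ray.Equivalent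
  iseqv := by
    refine ⟨Ray.equivalent_refl, fun {R R'} h S => ?_, fun {R R' R''} h h' S => ?_⟩
    · obtain ⟨N, hN⟩ := h S
      exact ⟨N, fun m hm n hn => (hN n hn m hm).symm⟩
    · obtain ⟨N, hN⟩ := h S
      obtain ⟨N', hN'⟩ := h' S
      exact ⟨max N N', fun m hm n hn =>
        (hN m (le_trans (le_max_left _ _) hm) (max N N') (le_max_left _ _)).trans
          (hN' (max N N') (le_max_right _ _) n (le_trans (le_max_right _ _) hn))⟩

/-- The ends of `G`: the equivalence classes of rays. -/
def GraphEnd (G : SimpleGraph V) : Type u := Quotient (raySetoid G)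

/-- The end to which a ray belongs. -/
def Ray.toEnd {G : SimpleGraph V} (R : Ray G) : GraphEnd G := Quotient.mk (raySetoid G) R

/-- `C(S, ω)`: the vertex set of the component of `G - S` that contains a ray from `ω`. -/
def endComponent (G : SimpleGraph V) (S : Finset V) (ω : GraphEnd G) : Set V :=
  {v | ∃ R : Ray G, R.toEnd = ω ∧ ∀ n, JoinedOff G S v (R.toFun n)}

/-- The points of `|G|`: vertices, ends, and inner points of edges. -/
inductive Point (G : SimpleGraph V) : Type u
  | vertex (v : V) : Point G
  | atEnd (ω : GraphEnd G) : Point G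
  | inner (e : G.edgeSet) (t : Set.Ioo (0 : ℝ) 1) : Point G

/-- The endvertex of `e` at parameter `0`, for an arbitrary fixed orientation of each edge. -/
noncomputable def edgeStart {G : SimpleGraph V} (e : G.edgeSet) : V := (Quot.out e.1).1

/-- The endvertex of `e` at parameter `1`. -/
noncomputable def edgeFinish {G : SimpleGraph V} (e : G.edgeSet) : V := (Quot.out e.1).2

/-- The `ε`-ball about a vertex, for `ε ≤ 1`, where all edges have length `1`. -/
def vertexBall {G : SimpleGraph V} (v : V) (ε : ℝ) : Set (Point G) :=
  {x | match x with
    | .vertex w => w = v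
    | .atEnd _ => False
    | .inner e t =>
        (edgeStart e = v ∧ (t : ℝ) < ε) ∨ (edgeFinish e = v ∧ 1 - (t : ℝ) < ε)}

/-- The `ε`-ball about an inner point of an edge, within that edge. -/
def innerBall {G : SimpleGraph V} (e : G.edgeSet) (t : Set.Ioo (0 : ℝ) 1) (ε : ℝ) :
    Set (Point G) :=
  Point.inner e '' {s | |(s : ℝ) - (t : ℝ)| < ε}

/-- The basic neighbourhood `Ĉ(S, ω)` of an end: all vertices of `C(S, ω)`, all inner points of
edges contained in or incident with `C(S, ω)`, and all ends represented by a ray in `C(S, ω)`. -/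
def endNhd {G : SimpleGraph V} (S : Finset V) (ω : GraphEnd G) : Set (Point G) :=
  {x | match x with
    | .vertex v => v ∈ endComponent G S ω
    | .atEnd ω' => ∃ R : Ray G, R.toEnd = ω' ∧ ∀ n, R.toFun n ∈ endComponent G S ω
    | .inner e _ => edgeStart e ∈ endComponent G S ω ∨ edgeFinish e ∈ endComponent G S ω}

theorem vertexBall_mono {G : SimpleGraph V} (v : V) {ε δ : ℝ} (h : ε ≤ δ) :
    (vertexBall v ε : Set (Point G)) ⊆ vertexBall v δ := by
  rintro (w | ω | ⟨e, t⟩) hx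
  · exact hx
  · exact hx
  · exact hx.imp (fun h' => ⟨h'.1, h'.2.trans_le h⟩) (fun h' => ⟨h'.1, h'.2.trans_le h⟩)

theorem innerBall_mono {G : SimpleGraph V} (e : G.edgeSet) (t : Set.Ioo (0 : ℝ) 1) {ε δ : ℝ}
    (h : ε ≤ δ) : innerBall e t ε ⊆ innerBall e t δ :=
  Set.image_mono fun _ hs => lt_of_lt_of_le hs h

theorem endComponent_anti {G : SimpleGraph V} {S S' : Finset V} (hS : S ⊆ S')
    (ω : GraphEnd G) : endComponent G S' ω ⊆ endComponent G S ω :=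
  fun _ ⟨R, hR, h⟩ => ⟨R, hR, fun n => (h n).mono hS⟩

theorem endNhd_anti {G : SimpleGraph V} {S S' : Finset V} (hS : S ⊆ S')
    (ω : GraphEnd G) : endNhd S' ω ⊆ endNhd S ω := by
  have h := endComponent_anti hS ω
  rintro (w | ω' | ⟨e, t⟩) hx
  · exact h hx
  · obtain ⟨R, hR, hx⟩ := hx
    exact ⟨R, hR, fun n => h (hx n)⟩
  · exact hx.imp (fun h' => h h') (fun h' => h h')

/-- The topology of `|G|`: a set is open if it contains a basic neighbourhood of each of its
points. -/
instance pointTopology (G : SimpleGraph V) : TopologicalSpace (Point G) where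
  IsOpen U :=
    (∀ v, Point.vertex v ∈ U → ∃ ε : ℝ, 0 < ε ∧ ε ≤ 1 ∧ vertexBall v ε ⊆ U) ∧
    (∀ e t, Point.inner e t ∈ U → ∃ ε : ℝ, 0 < ε ∧ innerBall e t ε ⊆ U) ∧
    (∀ ω, Point.atEnd ω ∈ U → ∃ S : Finset V, endNhd S ω ⊆ U)
  isOpen_univ := ⟨fun _ _ => ⟨1, one_pos, le_rfl, Set.subset_univ _⟩,
    fun _ _ _ => ⟨1, one_pos, Set.subset_univ _⟩, fun _ _ => ⟨∅, Set.subset_univ _⟩⟩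
  isOpen_inter := by
    classical
    rintro A B ⟨a1, a2, a3⟩ ⟨b1, b2, b3⟩
    refine ⟨fun v hv => ?_, fun e t h => ?_, fun ω h => ?_⟩
    · obtain ⟨ε, h0, h1, h2⟩ := a1 v hv.1
      obtain ⟨δ, k0, k1, k2⟩ := b1 v hv.2
      exact ⟨min ε δ, lt_min h0 k0, (min_le_left _ _).trans h1,
        Set.subset_inter ((vertexBall_mono v (min_le_left _ _)).trans h2)
          ((vertexBall_mono v (min_le_right _ _)).trans k2)⟩
    · obtain ⟨ε, h0, h2⟩ := a2 e t h.1
      obtain ⟨δ, k0, k2⟩ := b2 e t h.2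
      exact ⟨min ε δ, lt_min h0 k0,
        Set.subset_inter ((innerBall_mono e t (min_le_left _ _)).trans h2)
          ((innerBall_mono e t (min_le_right _ _)).trans k2)⟩
    · obtain ⟨S, hS⟩ := a3 ω h.1
      obtain ⟨S', hS'⟩ := b3 ω h.2
      exact ⟨S ∪ S', Set.subset_inter ((endNhd_anti Finset.subset_union_left ω).trans hS)
        ((endNhd_anti Finset.subset_union_right ω).trans hS')⟩
  isOpen_sUnion := by
    intro 𝒰 h
    refine ⟨fun v hv => ?_, fun e t hv => ?_, fun ω hv => ?_⟩
    · obtain ⟨U, hU, hvU⟩ := hv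
      obtain ⟨ε, h0, h1, h2⟩ := (h U hU).1 v hvU
      exact ⟨ε, h0, h1, h2.trans (Set.subset_sUnion_of_mem hU)⟩
    · obtain ⟨U, hU, hvU⟩ := hv
      obtain ⟨ε, h0, h2⟩ := (h U hU).2.1 e t hvU
      exact ⟨ε, h0, h2.trans (Set.subset_sUnion_of_mem hU)⟩
    · obtain ⟨U, hU, hvU⟩ := hv
      obtain ⟨S, h2⟩ := (h U hU).2.2 ω hvU
      exact ⟨S, h2.trans (Set.subset_sUnion_of_mem hU)⟩

/-- `|G|_Ψ`: the subspace of `|G|` obtained by removing the ends not in `Ψ`. -/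
abbrev PsiSpace (G : SimpleGraph V) (Ψ : Set (GraphEnd G)) : Type u :=
  {x : Point G // ∀ ω, x = Point.atEnd ω → ω ∈ Ψ}

/-- The vertex set `V(G) ∪ Ψ` of `|G|_Ψ`, regarded as an almost graph-like space. -/
def vertexSet (G : SimpleGraph V) (Ψ : Set (GraphEnd G)) : Set (PsiSpace G Ψ) :=
  {x | ∀ e t, x.1 ≠ Point.inner e t}

/-- The inner points in `|G|_Ψ` of the edges in `F`. -/
def edgePoints (G : SimpleGraph V) (Ψ : Set (GraphEnd G)) (F : Set G.edgeSet) :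
    Set (PsiSpace G Ψ) :=
  {x | ∃ e ∈ F, ∃ t, x.1 = Point.inner e t}

/-- Vertices of `|G|_Ψ` are identified if they lie on the same side whenever two disjoint open
sets partition the vertex set of `|G|_Ψ`; no other points are identified. -/
def quotientSetoid (G : SimpleGraph V) (Ψ : Set (GraphEnd G)) : Setoid (PsiSpace G Ψ) where
  r x y := x = y ∨ (x ∈ vertexSet G Ψ ∧ y ∈ vertexSet G Ψ ∧
    ∀ U U' : Set (PsiSpace G Ψ), IsOpen U → IsOpen U' → Disjoint U U' →
      vertexSet G Ψ ⊆ U ∪ U' → (x ∈ U ↔ y ∈ U))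
  iseqv := by
    refine ⟨fun x => Or.inl rfl, ?_, ?_⟩
    · rintro x y (rfl | ⟨hx, hy, h⟩)
      · exact Or.inl rfl
      · exact Or.inr ⟨hy, hx, fun U U' a b c d => (h U U' a b c d).symm⟩
    · rintro x y z (rfl | ⟨hx, hy, h⟩) (rfl | ⟨hy', hz, h'⟩)
      · exact Or.inl rfl
      · exact Or.inr ⟨hy', hz, h'⟩
      · exact Or.inr ⟨hx, hy, h⟩
      · exact Or.inr ⟨hx, hz, fun U U' a b c d => (h U U' a b c d).trans (h' U U' a b c d)⟩

/-- The graph-like quotient of `|G|_Ψ`, with the quotient topology. -/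
abbrev GraphLikeQuotient (G : SimpleGraph V) (Ψ : Set (GraphEnd G)) : Type u :=
  Quotient (quotientSetoid G Ψ)

/-- A `Ψ`-circuit: an edge set whose closure in the graph-like quotient of `|G|_Ψ` is
homeomorphic to the unit circle. -/
def IsPsiCircuit (G : SimpleGraph V) (Ψ : Set (GraphEnd G)) (o : Set G.edgeSet) : Prop :=
  Nonempty (closure (Quotient.mk (quotientSetoid G Ψ) '' edgePoints G Ψ o) ≃ₜ Circle)

/-- A cut: the set of all edges between a set of vertices and its complement. -/
def IsCut (G : SimpleGraph V) (b : Set G.edgeSet) : Prop :=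
  ∃ A : Set V, b = {e : G.edgeSet | ∃ x ∈ A, ∃ y ∉ A, (e : Sym2 V) = s(x, y)}

/-- `b` is `Ψ`-bounded: its closure in `|G|_Ψ` contains no ends. -/
def IsPsiBounded (G : SimpleGraph V) (Ψ : Set (GraphEnd G)) (b : Set G.edgeSet) : Prop :=
  ∀ x ∈ closure (edgePoints G Ψ b), ∀ ω, x.1 ≠ Point.atEnd ω

/-- A bond of the graph-like quotient of `|G|_Ψ`: a minimal nonempty `Ψ`-bounded cut. -/
def IsPsiBond (G : SimpleGraph V) (Ψ : Set (GraphEnd G)) (b : Set G.edgeSet) : Prop :=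
  Minimal (fun b' => b'.Nonempty ∧ IsCut G b' ∧ IsPsiBounded G Ψ b') b

/-- `(G, Ψ)` induces the matroid `M`: the ground set of `M` is `E(G)`, its circuits are the
`Ψ`-circuits, and its cocircuits are the minimal nonempty `Ψ`-bounded cuts. -/
def InducesMatroid (G : SimpleGraph V) (Ψ : Set (GraphEnd G)) (M : Matroid G.edgeSet) : Prop :=
  M.E = Set.univ ∧ (∀ o, M.IsCircuit o ↔ IsPsiCircuit G Ψ o) ∧
    (∀ b, M.IsCocircuit b ↔ IsPsiBond G Ψ b)

/-- The tree order of a tree `T` with root `r`: `x` lies on the path from `r` to `y` in `T`. -/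
def TreeLE (T : SimpleGraph V) (r x y : V) : Prop :=
  ∀ p : T.Walk r y, p.IsPath → x ∈ p.support

/-- `T` with root `r` is a normal spanning tree of `H`: adjacent vertices of `H` are comparable
in the tree order of `T`. -/
def IsNormalSpanningTree (H T : SimpleGraph V) (r : V) : Prop :=
  T ≤ H ∧ T.IsTree ∧ ∀ x y, H.Adj x y → TreeLE T r x y ∨ TreeLE T r y x

/-- `G = H / C` via the vertex map `π` and the edge map `g`: the vertices of `G` are the
components of the graph `(V(H), C)`, and the edges of `G` are the edges `g e` of `H` outside `C`,
with endvertices given by `π`. -/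
def IsContraction {W : Type u} (G : SimpleGraph V) (H : SimpleGraph W) (C : Set H.edgeSet)
    (π : W → V) (g : G.edgeSet → H.edgeSet) : Prop :=
  Function.Surjective π ∧
  (∀ x y, π x = π y ↔
    (SimpleGraph.fromEdgeSet ((fun e : H.edgeSet => (e : Sym2 W)) '' C)).Reachable x y) ∧
  Function.Injective g ∧ Set.range g = Cᶜ ∧
  ∀ e : G.edgeSet, Sym2.map π (g e : Sym2 W) = (e : Sym2 V)

end EndMatroid

/-!
The expanded graph `H` is obtained from a normal spanning forest of `G` (`exists_normalForest`).
Every vertex `v` is replaced by a ray `(v, 0), (v, 1), …`. An edge of `G` between `u` and a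
descendant `w` becomes an edge from `(w, 0)` to the vertex `(u, n)`, where `n` is the index of the
child of `u` below `w`; so every child is attached to a vertex of its own, and the forest becomes
a locally finite normal forest. An extra ray, to which the roots are attached in the same way,
makes it a tree. The set `C` consists of the edges of the rays and of the edges at the roots.

In a graph with a normal forest, an end corresponds to a down-closed chain without a
greatest element, namely the set of vertices in whose up-closures it lives (`exists_end_of_chain`,
`end_ext`), and these up-closures yield a neighbourhood basis of the end (`isOpen_iff_forest`). The
chain of an end of `G` generates a chain in the expanded tree, which gives the injection of the
ends (`endMap`). The ends of the new rays themselves are not in its image.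

Cocircuits: those of `M / C` are the cocircuits of `M` that avoid `C`. A cut of the expanded graph
that avoids `C` does not divide any ray, so it is a cut of `G`, and both are bounded with respect
to corresponding sets of ends (`isPsiBond_expEdge_iff`).

Circuits: a circuit of `M / C` is `o' \ C` for a circuit `o'` of `M`, whose closure is a circle. The
circuit `o'` avoids the edges at the roots because each of them is a bond. Off these edges the
contraction of the rays induces a continuous map of graph-like quotients
(`continuousOn_quotProj`), so the circle is mapped to a closed curve that traverses every
edge of `o = o' \ C` exactly once (`exists_isLoop_of_isPsiCircuit`). The edge set of such a curve
meets no bounded cut exactly once (`IsLoop.inter_ne_singleton`), hence contains a circuit if it is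
nonempty. By minimality of `o`, the curve has no proper closed subcurve with edges, and because
the vertices of the quotient form a totally disconnected set, all its fibres are then connected up
to the choice of the base point. Measuring the time spent on edges turns it into a homeomorphism
with the circle (`IsLoop.nonempty_homeomorph`). Conversely, a `Ψ`-circuit contains a circuit of `M / C`
for the same reason, and both have circles as closures, so they agree
(`isCircuit_of_isPsiCircuit`).
-/

namespace EndMatroid

/-! ### Normal spanning forests -/

/-- A normal spanning forest of `G`: a well-founded parent function whose parent edges are edges
of `G`, such that adjacent vertices of `G` are comparable in the induced order. A vertex without a
parent is a root. -/
structure NormalForest {V : Type u} (G : SimpleGraph V) where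
  /-- The parent of a vertex; `none` for a root. -/
  par : V → Option V
  wf : WellFounded fun p c => par c = some p
  adj : ∀ {c p}, par c = some p → G.Adj p c
  comp : ∀ {x y}, G.Adj x y → Relation.ReflTransGen (fun p c => par c = some p) x y ∨
    Relation.ReflTransGen (fun p c => par c = some p) y x

section Existence

variable {V : Type u} {G : SimpleGraph V}

theorem JoinedOff.right_notMem {S : Finset V} {x y : V} (h : JoinedOff G S x y) : y ∉ S := by
  obtain ⟨p, hp⟩ := h
  exact hp y p.end_mem_support

theorem JoinedOff.left_notMem {S : Finset V} {x y : V} (h : JoinedOff G S x y) : x ∉ S :=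
  h.symm.right_notMem

theorem JoinedOff.refl {S : Finset V} {x : V} (h : x ∉ S) : JoinedOff G S x x :=
  ⟨.nil, by simpa using h⟩

theorem JoinedOff.of_adj {S : Finset V} {x y : V} (h : G.Adj x y) (hx : x ∉ S) (hy : y ∉ S) :
    JoinedOff G S x y := by
  refine ⟨h.toWalk, fun z hz => ?_⟩
  simp only [SimpleGraph.Walk.support_cons, SimpleGraph.Walk.support_nil,
        List.mem_cons, List.not_mem_nil, or_false] at hz
  rcases hz with rfl | rfl <;> assumption

theorem JoinedOff.of_mem_support {S : Finset V} {x y z : V} {p : G.Walk x y}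
    (hp : ∀ z ∈ p.support, z ∉ S) (hz : z ∈ p.support) : JoinedOff G S x z := by
  classical
  exact ⟨p.takeUntil z hz, fun w hw => hp w (p.support_takeUntil_subset_support hz hw)⟩

/-- The vertex before the first visit to `x` on a walk from `v` is still joined to `v` when `x` is
removed. -/
theorem JoinedOff.exists_adj_insert [DecidableEq V] {S : Finset V} {v x : V}
    (h : JoinedOff G S v x) (hne : v ≠ x) : ∃ y, G.Adj x y ∧ JoinedOff G (insert x S) v y := by
  obtain ⟨p, hp⟩ := h
  induction p with
  | nil => exact absurd rfl hne
  | @cons a b c hab q ih =>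
    by_cases hbc : b = c
    · subst hbc
      exact ⟨a, hab.symm, JoinedOff.refl (by
        simp only [Finset.mem_insert, not_or]; exact ⟨hne, hp a (by simp)⟩)⟩
    · obtain ⟨y, hy, hby⟩ := ih hbc (fun z hz => hp z (by simp [hz]))
      refine ⟨y, hy, (JoinedOff.of_adj hab ?_ hby.left_notMem).trans hby⟩
      simp only [Finset.mem_insert, not_or]
      exact ⟨hne, hp a (by simp)⟩

/-- The possible lengths of walks from `x` to `m` inside `D`. -/
def walkLengths (G : SimpleGraph V) (D : Set V) (x m : V) : Set ℕ :=
  {l | ∃ p : G.Walk x m, p.length = l ∧ ∀ z ∈ p.support, z ∈ D}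

variable (G) (idx : V → ℕ)

/-- The vertex `x` is a neighbour in `D` of `p`, as close as possible within `D` to the vertex
of `D` of least index. -/
def IsPick (D : Set V) (p : Option V) (x : V) : Prop :=
  x ∈ D ∧ (∀ q, p = some q → G.Adj q x) ∧ ∀ m ∈ D, (∀ m' ∈ D, idx m ≤ idx m') →
    ∀ y ∈ D, (∀ q, p = some q → G.Adj q y) →
      sInf (walkLengths G D x m) ≤ sInf (walkLengths G D y m)

theorem exists_isPick (hidx : Function.Injective idx) {D : Set V} {p : Option V}
    (h : ∃ y ∈ D, ∀ q, p = some q → G.Adj q y) : ∃ x, IsPick G idx D p x := by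
  obtain ⟨y, hy, hpy⟩ := h
  obtain ⟨m, hm, hmin⟩ := exists_minimal_of_wellFoundedLT (· ∈ idx '' D) ⟨_, y, hy, rfl⟩
  obtain ⟨m, hmD, rfl⟩ := hm
  let P : Set V := {x | x ∈ D ∧ ∀ q, p = some q → G.Adj q x}
  have hP : P.Nonempty := ⟨y, hy, hpy⟩
  let f : V → ℕ := fun x => sInf (walkLengths G D x m)
  have hx := Function.argminOn_mem f P hP
  refine ⟨Function.argminOn f P hP, hx.1, hx.2, fun m' hm' hm'' z hz hpz => ?_⟩
  obtain rfl : m' = m := hidx (le_antisymm (hm'' _ hmD)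
    ((le_total (idx m) (idx m')).elim id fun h => hmin ⟨m', hm', rfl⟩ h))
  exact Function.argminOn_le f P (a := z) ⟨hz, hpz⟩

/-- A vertex as in `IsPick`, if there is one, and the junk value `v` otherwise. -/
noncomputable def pick (v : V) (D : Set V) (p : Option V) : V :=
  open Classical in if h : ∃ x, IsPick G idx D p x then h.choose else v

theorem isPick_pick {v : V} {D : Set V} {p : Option V} (h : ∃ x, IsPick G idx D p x) :
    IsPick G idx D p (pick G idx v D p) := by
  rw [pick, dif_pos h]; exact h.choose_spec

theorem pick_congr {v w : V} {D : Set V} {p : Option V} (h : ∃ x, IsPick G idx D p x) :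
    pick G idx v D p = pick G idx w D p := by
  rw [pick, dif_pos h, pick, dif_pos h]

/-- The vertex set of the component of `G - S` containing `v`. -/
def compOff (S : Finset V) (v : V) : Set V := {y | JoinedOff G S v y}

/-- The state of the depth-first search for `v` after `n` steps: the set of vertices chosen so
far, and the last of them. In each step the next vertex is picked from the component of `v`
among the remaining vertices. -/
noncomputable def searchState (v : V) : ℕ → Finset V × Option V
  | 0 => (∅, none)
  | n + 1 => open Classical in
    let x := pick G idx v (compOff G (searchState v n).1 v) (searchState v n).2
    (insert x (searchState v n).1, some x)

/-- The vertex chosen in step `n` of the search for `v`. -/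
noncomputable def searchNext (v : V) (n : ℕ) : V :=
  pick G idx v (compOff G (searchState G idx v n).1 v) (searchState G idx v n).2

theorem searchState_succ [DecidableEq V] (v : V) (n : ℕ) : searchState G idx v (n + 1) =
    (insert (searchNext G idx v n) (searchState G idx v n).1, some (searchNext G idx v n)) := by
  rw [searchState, searchNext]; congr!

variable {G} {idx}

theorem searchState_mono (v : V) : Monotone fun n => (searchState G idx v n).1 := by
  classical
  refine monotone_nat_of_le_succ fun n => ?_
  simp only [searchState_succ]
  exact Finset.subset_insert _ _

theorem isPick_searchNext (hidx : Function.Injective idx) {v : V} {n : ℕ}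
    (hv : v ∉ (searchState G idx v n).1) :
    IsPick G idx (compOff G (searchState G idx v n).1 v) (searchState G idx v n).2
      (searchNext G idx v n) := by
  classical
  refine isPick_pick G idx (exists_isPick G idx hidx ?_)
  induction n with
  | zero => exact ⟨v, JoinedOff.refl hv, fun q hq => by simp [searchState] at hq⟩
  | succ n ih =>
    rw [searchState_succ] at hv ⊢
    simp only [Finset.mem_insert, not_or] at hv
    have hp := isPick_pick G idx (v := v) (exists_isPick G idx hidx (ih hv.2))
    obtain ⟨y, hy, hvy⟩ := JoinedOff.exists_adj_insert hp.1 hv.1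
    refine ⟨y, hvy, fun q hq => ?_⟩
    obtain rfl : _ = q := Option.some_injective _ hq
    exact hy

theorem compOff_congr {S : Finset V} {v w : V} (h : JoinedOff G S v w) :
    compOff G S v = compOff G S w :=
  Set.ext fun _ => ⟨fun h' => h.symm.trans h', fun h' => h.trans h'⟩

theorem searchNext_congr (hidx : Function.Injective idx) {v w : V} {n : ℕ}
    (h : JoinedOff G (searchState G idx v n).1 v w)
    (hst : searchState G idx v n = searchState G idx w n) :
    searchNext G idx v n = searchNext G idx w n := by
  have hp := isPick_searchNext hidx h.left_notMem
  rw [searchNext, searchNext, ← hst, ← compOff_congr h]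
  exact pick_congr G idx ⟨_, hp⟩

/-- As long as `w` lies in the component of `v`, both have the same search. -/
theorem searchState_congr (hidx : Function.Injective idx) {v w : V} {n : ℕ}
    (h : JoinedOff G (searchState G idx v n).1 v w) :
    searchState G idx v n = searchState G idx w n := by
  classical
  induction n with
  | zero => rfl
  | succ n ih =>
    have h' := h.mono (searchState_mono v (Nat.le_succ n))
    have := ih h'
    rw [searchState_succ, searchState_succ, searchNext_congr hidx h' this, this]

theorem exists_least_index {D : Set V} (h : D.Nonempty) :
    ∃ m ∈ D, ∀ m' ∈ D, idx m ≤ idx m' := by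
  have := Function.argminOn_mem idx D h
  exact ⟨_, this, fun m' hm' => Function.argminOn_le idx D hm'⟩

/-- One step of the search approaches the vertex of least index in the remaining component. -/
theorem sInf_walkLengths_lt (hidx : Function.Injective idx) {v m : V} {n : ℕ}
    (hv : v ∉ (searchState G idx v (n + 1)).1)
    (hm : m ∈ compOff G (searchState G idx v (n + 1)).1 v)
    (hmin : ∀ m' ∈ compOff G (searchState G idx v n).1 v, idx m ≤ idx m') :
    sInf (walkLengths G (compOff G (searchState G idx v (n + 1)).1 v)
        (searchNext G idx v (n + 1)) m) <
      sInf (walkLengths G (compOff G (searchState G idx v n).1 v) (searchNext G idx v n) m) := by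
  classical
  set D := compOff G (searchState G idx v n).1 v with hD
  set D' := compOff G (searchState G idx v (n + 1)).1 v with hD'
  set x := searchNext G idx v n with hx
  have hmono : (searchState G idx v n).1 ⊆ (searchState G idx v (n + 1)).1 :=
    searchState_mono v (Nat.le_succ n)
  have hDD : D' ⊆ D := fun y hy => JoinedOff.mono hmono hy
  have hvn : v ∉ (searchState G idx v n).1 := fun h => hv (hmono h)
  have hxD : x ∈ D := (isPick_searchNext hidx hvn).1
  have hne : (walkLengths G D x m).Nonempty := by
    obtain ⟨p, hp⟩ := (JoinedOff.symm hxD).trans (hDD hm)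
    exact ⟨_, p, rfl, fun z hz => JoinedOff.trans hxD (JoinedOff.of_mem_support hp hz)⟩
  obtain ⟨p, hp, hpD⟩ := Nat.sInf_mem hne
  have hpick := isPick_searchNext hidx hv
  have hxm : m ≠ x := by
    rintro rfl
    refine JoinedOff.right_notMem hm ?_
    rw [searchState_succ]; exact Finset.mem_insert_self _ _
  obtain ⟨y, hxy, q, rfl⟩ := p.exists_eq_cons_of_ne hxm.symm
  -- a shortest walk does not return to its first vertex
  have hxq : x ∉ q.support := by
    intro hxq
    have h1 : (q.dropUntil x hxq).length ∈ walkLengths G D x m :=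
      ⟨_, rfl, fun z hz => hpD z (by
        rw [SimpleGraph.Walk.support_cons]
        exact List.mem_cons_of_mem _ (q.support_dropUntil_subset_support hxq hz))⟩
    have h2 := Nat.sInf_le h1
    have h3 := q.length_dropUntil_le_length hxq
    rw [← hp, SimpleGraph.Walk.length_cons] at h2
    omega
  have hq : ∀ z ∈ q.support, z ∉ (searchState G idx v (n + 1)).1 := by
    intro z hz
    rw [searchState_succ]
    simp only [Finset.mem_insert, not_or]
    exact ⟨fun h => hxq (by rw [hx, ← h]; exact hz),
      JoinedOff.right_notMem (hpD z (by simp [hz]))⟩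
  have hqD : ∀ z ∈ q.support, z ∈ D' := fun z hz =>
    JoinedOff.trans hm (JoinedOff.trans (JoinedOff.symm ⟨q, hq⟩) (JoinedOff.of_mem_support hq hz))
  have h1 := hpick.2.2 m hm (fun m' hm' => hmin m' (hDD hm')) y (hqD y q.start_mem_support)
    (fun r hr => by
      rw [searchState_succ] at hr
      obtain rfl : _ = r := Option.some_injective _ hr
      exact hxy)
  refine lt_of_le_of_lt h1 (lt_of_le_of_lt (Nat.sInf_le ⟨q, rfl, hqD⟩) ?_)
  rw [← hp, SimpleGraph.Walk.length_cons]
  omega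

/-- The search for `v` finds `v`: it keeps approaching the vertex of least index in the current
component, so this index cannot stay bounded by the index of `v` forever. -/
theorem exists_mem_searchState (hidx : Function.Injective idx) (v : V) :
    ∃ n, v ∈ (searchState G idx v n).1 := by
  by_contra! hv
  have hself : ∀ n, v ∈ compOff G (searchState G idx v n).1 v := fun n => JoinedOff.refl (hv n)
  have hanti : ∀ {k n}, k ≤ n → compOff G (searchState G idx v n).1 v ⊆
      compOff G (searchState G idx v k).1 v :=
    fun hkn y hy => JoinedOff.mono (searchState_mono v hkn) hy
  choose m hm hmin using fun n => exists_least_index (idx := idx) ⟨v, hself n⟩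
  have hmono : Monotone fun n => idx (m n) :=
    monotone_nat_of_le_succ fun n => hmin n _ (hanti (Nat.le_succ n) (hm (n + 1)))
  -- the least index is bounded by the index of `v`, so it is eventually constant
  obtain ⟨N, hN⟩ : ∃ N, ∀ n ≥ N, m n = m N := by
    have hb : BddAbove (Set.range fun n => idx (m n)) :=
      ⟨idx v, by rintro _ ⟨n, rfl⟩; exact hmin n v (hself n)⟩
    obtain ⟨N, hN⟩ := Nat.sSup_mem (Set.range_nonempty _) hb
    refine ⟨N, fun n hn => hidx (le_antisymm ?_ (hmono hn))⟩
    have h1 : idx (m n) ≤ sSup (Set.range fun n => idx (m n)) := le_csSup hb ⟨n, rfl⟩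
    exact h1.trans hN.symm.le
  let f : ℕ → ℕ := fun k => sInf (walkLengths G (compOff G (searchState G idx v (N + k)).1 v)
    (searchNext G idx v (N + k)) (m N))
  have hf : ∀ k, f (k + 1) < f k := fun k =>
    sInf_walkLengths_lt hidx (hv _) (by
      rw [← hN (N + k + 1) (by omega)]; exact hm _)
      (by rw [← hN (N + k) (by omega)]; exact hmin _)
  obtain ⟨k, hk⟩ := WellFounded.not_rel_apply_succ (r := ((· < ·) : ℕ → ℕ → Prop)) f
  exact hk (hf k)

theorem exists_searchNext_eq (hidx : Function.Injective idx) (v : V) :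
    ∃ n, v ∉ (searchState G idx v n).1 ∧ searchNext G idx v n = v := by
  classical
  have h := exists_mem_searchState (G := G) hidx v
  have h0 : Nat.find h ≠ 0 := fun h0 => by
    have := Nat.find_spec h
    rw [h0] at this
    simp [searchState] at this
  obtain ⟨n, hn⟩ := Nat.exists_eq_succ_of_ne_zero h0
  have hv := Nat.find_min h (m := n) (by omega)
  have hv' := Nat.find_spec h
  rw [hn, Nat.succ_eq_add_one, searchState_succ] at hv'
  exact ⟨n, hv, ((Finset.mem_insert.1 hv').resolve_right hv).symm⟩

theorem eq_of_searchNext_eq {v : V} {m n : ℕ}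
    (hm : v ∉ (searchState G idx v m).1) (hm' : searchNext G idx v m = v)
    (hn : v ∉ (searchState G idx v n).1) (hn' : searchNext G idx v n = v) : m = n := by
  classical
  have key : ∀ {m n}, searchNext G idx v m = v → v ∉ (searchState G idx v n).1 → n ≤ m := by
    intro m n hm hn
    by_contra! h
    refine hn (searchState_mono v (Nat.succ_le_of_lt h) ?_)
    simp only [Nat.succ_eq_add_one, searchState_succ, hm, Finset.mem_insert_self]
  exact le_antisymm (key hn' hm) (key hm' hn)

/-- Every countable graph has a normal spanning forest, whose tree order is that of a depth-first
search heading for the vertices in the order of their indices. -/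
theorem exists_normalForest [Countable V] (G : SimpleGraph V) : Nonempty (NormalForest G) := by
  classical
  obtain ⟨idx, hidx⟩ := exists_injective_nat V
  choose k hk hk' using exists_searchNext_eq (G := G) hidx
  have hk_eq : ∀ {v n}, v ∉ (searchState G idx v n).1 → searchNext G idx v n = v → k v = n :=
    fun h h' => eq_of_searchNext_eq (hk _) (hk' _) h h'
  -- the vertex chosen in step `n` of the search for `v` is reached by the same search
  have hnext : ∀ {v n}, v ∉ (searchState G idx v n).1 →
      searchState G idx (searchNext G idx v n) n = searchState G idx v n ∧
      k (searchNext G idx v n) = n := by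
    intro v n hv
    have hp : JoinedOff G _ _ _ := (isPick_searchNext hidx hv).1
    have h1 := searchState_congr hidx hp
    refine ⟨h1.symm, hk_eq ?_ ?_⟩
    · rw [← h1]; exact hp.right_notMem
    · exact (searchNext_congr hidx hp h1).symm
  let par : V → Option V := fun v => (searchState G idx v (k v)).2
  have hpar : ∀ {c p}, par c = some p → ∃ n, k c = n + 1 ∧ searchNext G idx c n = p ∧
      c ∉ (searchState G idx c n).1 := by
    intro c p h
    have h' : (searchState G idx c (k c)).2 = some p := h
    have hc := hk c
    rcases hkc : k c with _ | n
    · rw [hkc] at h'; simp [searchState] at h'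
    · rw [hkc, searchState_succ] at h'
      exact ⟨n, rfl, Option.some_injective _ h', fun hc' => hc (searchState_mono c (by omega) hc')⟩
  -- every vertex chosen during the search for `w` is an ancestor of `w`
  have hle : ∀ w, ∀ j ≤ k w, Relation.ReflTransGen (fun p c => par c = some p)
      (searchNext G idx w j) w := by
    intro w j hj
    induction hj using Nat.decreasingInduction with
    | self => rw [hk']
    | of_succ j hj ih =>
      refine Relation.ReflTransGen.head ?_ ih
      obtain ⟨h1, h2⟩ := hnext (v := w) (n := j + 1)
        fun h => hk w (searchState_mono w hj h)
      change (searchState G idx _ (k _)).2 = _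
      rw [h2, h1, searchState_succ]
  -- the searches for adjacent vertices agree until one of the two is chosen
  have hcomp : ∀ {u w}, G.Adj u w → k u ≤ k w →
      Relation.ReflTransGen (fun p c => par c = some p) u w := by
    intro u w huw hkuw
    have key : ∀ n ≤ k u, searchState G idx u n = searchState G idx w n ∧
        JoinedOff G (searchState G idx u n).1 u w := by
      intro n hn
      have hu : u ∉ (searchState G idx u n).1 := fun h => hk u (searchState_mono u hn h)
      have hw : w ∉ (searchState G idx w n).1 :=
        fun h => hk w (searchState_mono w (hn.trans hkuw) h)
      suffices hs : searchState G idx u n = searchState G idx w n from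
        ⟨hs, JoinedOff.of_adj huw hu (hs ▸ hw)⟩
      induction n with
      | zero => rfl
      | succ n ih =>
        have hu' := fun h => hu (searchState_mono u (Nat.le_succ n) h)
        have hw' := fun h => hw (searchState_mono w (Nat.le_succ n) h)
        have hs := ih (by omega) hu' hw'
        rw [searchState_succ, searchState_succ,
          searchNext_congr hidx (JoinedOff.of_adj huw hu' (hs ▸ hw')) hs, hs]
    obtain ⟨h1, h2⟩ := key (k u) le_rfl
    have h3 := hle w (k u) hkuw
    rwa [← searchNext_congr hidx h2 h1, hk'] at h3
  refine ⟨⟨par, ?_, ?_, ?_⟩⟩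
  · refine Subrelation.wf (r := InvImage (· < ·) k) (fun {p c} h => ?_)
      (InvImage.wf k wellFounded_lt)
    obtain ⟨n, h1, rfl, h2⟩ := hpar h
    change k _ < k _
    rw [(hnext h2).2, h1]; exact Nat.lt_succ_self n
  · intro c p h
    obtain ⟨n, h1, h2, h3⟩ := hpar h
    have hp := (isPick_searchNext hidx (hk c)).2.1 p h
    rwa [hk'] at hp
  · intro x y h
    exact (le_total (k x) (k y)).imp (hcomp h) (hcomp h.symm)

end Existence

/-! ### Ends and the tree order of a normal forest -/

namespace NormalForest

variable {V : Type u} {G : SimpleGraph V} (F : NormalForest G)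

/-- The tree order: `x` is an ancestor of `y`, or equal to it. -/
def le (x y : V) : Prop := Relation.ReflTransGen (fun p c => F.par c = some p) x y

/-- The up-closure of a vertex: the vertex and all its descendants. -/
def up (v : V) : Set V := {x | F.le v x}

variable {F}

theorem le_refl (x : V) : F.le x x := Relation.ReflTransGen.refl

theorem le_trans {x y z : V} (h : F.le x y) (h' : F.le y z) : F.le x z :=
  Relation.ReflTransGen.trans h h'

theorem le_of_par {p c : V} (h : F.par c = some p) : F.le p c := Relation.ReflTransGen.single h

theorem le_iff {x y : V} : F.le x y ↔ x = y ∨ ∃ p, F.par y = some p ∧ F.le x p := by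
  rw [le, Relation.ReflTransGen.cases_tail_iff, eq_comm]
  simp only [le, and_comm]

theorem le_total_of_le {x y z : V} (hx : F.le x z) (hy : F.le y z) : F.le x y ∨ F.le y x := by
  induction hx with
  | refl => exact Or.inr hy
  | @tail p z hp hz ih =>
    rcases le_iff.1 hy with rfl | ⟨q, hq, hyq⟩
    · exact Or.inl (Relation.ReflTransGen.tail hp hz)
    · obtain rfl : p = q := Option.some_injective _ (hz.symm.trans hq)
      exact ih hyq

theorem par_induction {P : V → Prop} (h : ∀ c, (∀ p, F.par c = some p → P p) → P c) (v : V) : P v :=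
  F.wf.induction v h

theorem le_antisymm {x y : V} (h : F.le x y) (h' : F.le y x) : x = y := by
  rcases Relation.reflTransGen_iff_eq_or_transGen.1 h with rfl | h1
  · rfl
  rcases Relation.reflTransGen_iff_eq_or_transGen.1 h' with rfl | h2
  · rfl
  exact absurd (h1.trans h2) (F.wf.transGen.irrefl.irrefl x)

theorem finite_le (v : V) : {u | F.le u v}.Finite := by
  refine par_induction (F := F) (P := fun v => {u | F.le u v}.Finite) (fun c ih => ?_) v
  rcases hc : F.par c with _ | p
  · refine (Set.finite_singleton c).subset fun u hu => ?_
    rcases le_iff.1 hu with rfl | ⟨q, hq, -⟩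
    · rfl
    · rw [hc] at hq; exact absurd hq (by simp)
  · refine ((ih p hc).insert c).subset fun u hu => ?_
    rcases le_iff.1 hu with rfl | ⟨q, hq, h⟩
    · exact Or.inl rfl
    · rw [hc] at hq
      obtain rfl := Option.some_injective _ hq
      exact Or.inr h

theorem mem_up_self (v : V) : v ∈ F.up v := le_refl v

theorem up_anti {u v : V} (h : F.le u v) : F.up v ⊆ F.up u := fun _ hx => le_trans h hx

/-- Edges of `G` leave the up-closure of `v` only towards ancestors of `v`. -/
theorem le_of_adj_of_notMem_up {v x y : V} (hx : x ∈ F.up v) (hy : y ∉ F.up v)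
    (h : G.Adj x y) : F.le y v := by
  rcases F.comp h with h | h
  · exact absurd (le_trans hx h) hy
  · exact (le_total_of_le h hx).resolve_right hy

variable (F) in
/-- The set of proper ancestors of a vertex. -/
noncomputable def anc (v : V) : Finset V :=
  ((finite_le (F := F) v).subset (t := {u | F.le u v ∧ u ≠ v}) fun _ h => h.1).toFinset

theorem mem_anc {u v : V} : u ∈ F.anc v ↔ F.le u v ∧ u ≠ v := by simp [anc]

theorem mem_up_of_joinedOff {v x y : V} (hx : x ∈ F.up v) (h : JoinedOff G (F.anc v) x y) :
    y ∈ F.up v := by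
  obtain ⟨p, hp⟩ := h
  induction p with
  | nil => exact hx
  | @cons a b c hab q ih =>
    refine ih ?_ fun z hz => hp z (by simp [hz])
    by_contra hb
    refine hp b (by simp) (mem_anc.2 ⟨le_of_adj_of_notMem_up hx hb hab, ?_⟩)
    rintro rfl
    exact hb (mem_up_self _)

theorem joinedOff_of_mem_up {v x : V} {S : Finset V} (hS : Disjoint (F.up v) (S : Set V))
    (hx : x ∈ F.up v) : JoinedOff G S v x := by
  have hn : ∀ {y}, y ∈ F.up v → y ∉ S := fun hy hyS => Set.disjoint_left.1 hS hy hyS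
  induction (show Relation.ReflTransGen (fun p c => F.par c = some p) v x from hx) with
  | refl => exact JoinedOff.refl (hn (mem_up_self v))
  | @tail p c hp hc ih => exact (ih hp).trans (JoinedOff.of_adj (F.adj hc) (hn hp)
      (hn (le_trans (show F.le v p from hp) (le_of_par hc))))

/-- Up-closures are constant for every property that is invariant along tree edges. -/
theorem iff_of_mem_up {A : Set V} {v x : V}
    (h : ∀ c p, F.par c = some p → p ∈ F.up v → (p ∈ A ↔ c ∈ A)) (hx : x ∈ F.up v) :
    v ∈ A ↔ x ∈ A := by
  induction (show Relation.ReflTransGen (fun p c => F.par c = some p) v x from hx) with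
  | refl => rfl
  | @tail p c hp hc ih => exact (ih hp).trans (h c p hc hp)

variable (F) in
/-- The end `ω` lives in the up-closure of `v`: some ray of `ω` has a tail there. -/
def EndIn (v : V) (ω : GraphEnd G) : Prop :=
  ∃ R : Ray G, R.toEnd = ω ∧ ∃ N, ∀ n ≥ N, R.toFun n ∈ F.up v

theorem endIn_toEnd {v : V} {R : Ray G} :
    F.EndIn v R.toEnd ↔ ∃ N, ∀ n ≥ N, R.toFun n ∈ F.up v := by
  refine ⟨fun ⟨R', hR', N', hN'⟩ => ?_, fun h => ⟨R, rfl, h⟩⟩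
  have heq : R'.Equivalent R := Quotient.exact hR'
  obtain ⟨N, hN⟩ := heq (F.anc v)
  exact ⟨N, fun n hn => mem_up_of_joinedOff (hN' (max N N') (le_max_right _ _))
    (hN _ (le_max_left _ _) n hn)⟩

theorem EndIn.mono {u v : V} {ω : GraphEnd G} (h : F.le u v) (hv : F.EndIn v ω) : F.EndIn u ω := by
  obtain ⟨R, hR, N, hN⟩ := hv
  exact ⟨R, hR, N, fun n hn => up_anti h (hN n hn)⟩

theorem EndIn.exists_mem {u v : V} {ω : GraphEnd G} (hu : F.EndIn u ω) (hv : F.EndIn v ω) :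
    ∃ x, x ∈ F.up u ∧ x ∈ F.up v := by
  obtain ⟨R, rfl, N, hN⟩ := hu
  obtain ⟨N', hN'⟩ := endIn_toEnd.1 hv
  exact ⟨_, hN _ (le_max_left N N'), hN' _ (le_max_right N N')⟩

theorem EndIn.total {u v : V} {ω : GraphEnd G} (hu : F.EndIn u ω) (hv : F.EndIn v ω) :
    F.le u v ∨ F.le v u := by
  obtain ⟨x, h1, h2⟩ := hu.exists_mem hv
  exact le_total_of_le h1 h2

theorem _root_.EndMatroid.Ray.eventually_notMem (R : Ray G) {S : Set V} (hS : S.Finite) :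
    ∃ N, ∀ n ≥ N, R.toFun n ∉ S := by
  obtain ⟨N, hN⟩ := (hS.preimage R.injective.injOn).bddAbove
  exact ⟨N + 1, fun n hn h => by have : n ≤ N := hN h; omega⟩

theorem exists_endIn_disjoint (S : Finset V) (ω : GraphEnd G) :
    ∃ v, F.EndIn v ω ∧ Disjoint (F.up v) (S : Set V) := by
  obtain ⟨R, rfl⟩ := Quotient.exists_rep ω
  let S' : Set V := ⋃ s ∈ S, {u | F.le u s}
  have hS' : S'.Finite := S.finite_toSet.biUnion fun s _ => finite_le s
  have hdown : ∀ {x y}, F.le x y → y ∈ S' → x ∈ S' := by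
    intro x y hxy hy
    simp only [S', Set.mem_iUnion, Set.mem_ofPred_eq, exists_prop] at hy ⊢
    obtain ⟨s, hs, hys⟩ := hy
    exact ⟨s, hs, le_trans hxy hys⟩
  obtain ⟨N, hN⟩ := R.eventually_notMem hS'
  -- a minimal ancestor of the vertex `R N` outside the down-closure of `S`
  have hmin : ∀ x, x ∉ S' → ∃ v, F.le v x ∧ v ∉ S' ∧ ∀ u, F.le u v → u ∉ S' → u = v := by
    refine par_induction (F := F) fun c ih hc => ?_
    by_cases h : ∃ p, F.par c = some p ∧ p ∉ S'
    · obtain ⟨p, hp, hpS⟩ := h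
      obtain ⟨v, h1, h2⟩ := ih p hp hpS
      exact ⟨v, le_trans h1 (le_of_par hp), h2⟩
    · refine ⟨c, le_refl c, hc, fun u hu huS => ?_⟩
      rcases le_iff.1 hu with rfl | ⟨p, hp, hup⟩
      · rfl
      · exact absurd ⟨p, hp, fun hpS => huS (hdown hup hpS)⟩ h
  obtain ⟨v, hv, hvS, hvmin⟩ := hmin _ (hN N le_rfl)
  refine ⟨v, endIn_toEnd.2 ⟨N, fun n hn => ?_⟩, Set.disjoint_left.2 fun x hx hxS => ?_⟩
  · induction n, hn using Nat.le_induction with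
    | base => exact hv
    | succ n hn ih =>
      rcases F.comp (R.adj n) with h | h
      · exact le_trans ih h
      · rcases le_total_of_le ih h with h' | h'
        · exact h'
        · rw [hvmin _ h' (hN _ (by omega))]; exact mem_up_self v
  · refine hvS (hdown hx ?_)
    simp only [S', Set.mem_iUnion, Set.mem_ofPred_eq, exists_prop]
    exact ⟨x, hxS, le_refl x⟩

/-- An end lives above arbitrarily high vertices, avoiding any finite set. -/
theorem EndIn.exists_lt {v : V} {ω : GraphEnd G} (hv : F.EndIn v ω) (S : Finset V) :
    ∃ w, F.EndIn w ω ∧ Disjoint (F.up w) (S : Set V) ∧ F.le v w ∧ w ≠ v := by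
  classical
  obtain ⟨w, hw, hd⟩ := exists_endIn_disjoint (F := F) (insert v S) ω
  have hvw : v ∉ F.up w := fun h => Set.disjoint_left.1 hd h (by simp)
  refine ⟨w, hw, hd.mono_right (by simp), (hv.total hw).resolve_right hvw, ?_⟩
  rintro rfl
  exact hvw (mem_up_self _)

/-- The subray of `R` starting at index `N`. -/
def _root_.EndMatroid.Ray.tail (R : Ray G) (N : ℕ) : Ray G where
  toFun n := R.toFun (N + n)
  injective _ _ h := Nat.add_left_cancel (R.injective h)
  adj n := R.adj (N + n)

theorem _root_.EndMatroid.Ray.toEnd_tail (R : Ray G) (N : ℕ) : (R.tail N).toEnd = R.toEnd := by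
  refine Quotient.sound fun S => ?_
  obtain ⟨M, hM⟩ := R.equivalent_refl S
  exact ⟨M, fun m hm n hn => hM _ (by omega) n hn⟩

theorem up_subset_endComponent {v : V} {ω : GraphEnd G} {S : Finset V} (hv : F.EndIn v ω)
    (hS : Disjoint (F.up v) (S : Set V)) : F.up v ⊆ endComponent G S ω := by
  obtain ⟨R, rfl, N, hN⟩ := hv
  exact fun x hx => ⟨R.tail N, R.toEnd_tail N, fun n =>
    (joinedOff_of_mem_up hS hx).symm.trans (joinedOff_of_mem_up hS (hN _ (by omega)))⟩

theorem endComponent_anc_subset {v : V} {ω : GraphEnd G} (hv : F.EndIn v ω) :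
    endComponent G (F.anc v) ω ⊆ F.up v := by
  rintro x ⟨R, rfl, hR⟩
  obtain ⟨N, hN⟩ := endIn_toEnd.1 hv
  exact mem_up_of_joinedOff (hN N le_rfl) (hR N).symm

theorem end_ext {ω ω' : GraphEnd G} (h : ∀ v, F.EndIn v ω → F.EndIn v ω') : ω = ω' := by
  obtain ⟨R, rfl⟩ := Quotient.exists_rep ω
  obtain ⟨R', rfl⟩ := Quotient.exists_rep ω'
  refine Quotient.sound fun S => ?_
  obtain ⟨v, hv, hS⟩ := exists_endIn_disjoint (F := F) S R.toEnd
  obtain ⟨N, hN⟩ := endIn_toEnd.1 hv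
  obtain ⟨N', hN'⟩ := endIn_toEnd.1 (h v hv)
  exact ⟨max N N', fun m hm n hn =>
    (joinedOff_of_mem_up hS (hN m ((le_max_left _ _).trans hm))).symm.trans
      (joinedOff_of_mem_up hS (hN' n ((le_max_right _ _).trans hn)))⟩

/-- A down-closed chain without a greatest element is the set of vertices in whose up-closure
some end lives: the chain is the vertex set of a tree ray. -/
theorem exists_end_of_chain {D : Set V} (hne : D.Nonempty)
    (hdown : ∀ x y, F.le x y → y ∈ D → x ∈ D) (hchain : ∀ x ∈ D, ∀ y ∈ D, F.le x y ∨ F.le y x)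
    (hmax : ∀ x ∈ D, ∃ y ∈ D, F.le x y ∧ y ≠ x) : ∃ ω, ∀ v, F.EndIn v ω ↔ v ∈ D := by
  have hsucc : ∀ x : D, ∃ y : D, F.par y.1 = some x.1 := by
    rintro ⟨x, hx⟩
    obtain ⟨y, hy, hxy, hne⟩ := hmax x hx
    rcases Relation.ReflTransGen.cases_head hxy with rfl | ⟨c, hc, hcy⟩
    · exact absurd rfl hne
    · exact ⟨⟨c, hdown c y hcy hy⟩, hc⟩
  choose f hf using hsucc
  obtain ⟨x0, hx0⟩ := hne
  let s : ℕ → D := fun n => f^[n] ⟨x0, hx0⟩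
  have hs : ∀ n, F.par (s (n + 1)).1 = some (s n).1 := fun n => by
    simp only [s, Function.iterate_succ_apply']; exact hf _
  have hmono : ∀ m n, m ≤ n → F.le (s m).1 (s n).1 := by
    intro m n h
    induction n, h using Nat.le_induction with
    | base => exact le_refl _
    | succ n hn ih => exact le_trans ih (le_of_par (hs n))
  have hlt : ∀ n, ¬ F.le (s (n + 1)).1 (s n).1 := by
    intro n h
    have h1 := F.adj (hs n)
    rw [le_antisymm h (le_of_par (hs n))] at h1
    exact h1.ne rfl
  have hinj : ∀ m n, (s m).1 = (s n).1 → n ≤ m := by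
    intro m n h
    by_contra! hmn
    refine hlt m (le_trans (hmono (m + 1) n hmn) ?_)
    rw [← h]; exact le_refl _
  let R : Ray G := ⟨fun n => (s n).1,
    fun m n h => Nat.le_antisymm (hinj n m h.symm) (hinj m n h), fun n => F.adj (hs n)⟩
  refine ⟨R.toEnd, fun v => ⟨fun hv => ?_, fun hv => ?_⟩⟩
  · obtain ⟨N, hN⟩ := endIn_toEnd.1 hv
    exact hdown v _ (hN N le_rfl) (s N).2
  · obtain ⟨N, hN⟩ := R.eventually_notMem (finite_le (F := F) v)
    exact endIn_toEnd.2 ⟨N, fun n hn => (hchain v hv _ (s n).2).resolve_right (hN n hn)⟩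

end NormalForest

/-! ### The topology of `|G|_Ψ` and of its quotient -/

section Topology

variable {V : Type u} {G : SimpleGraph V}

theorem edge_eq (e : G.edgeSet) : (e : Sym2 V) = s(edgeStart e, edgeFinish e) :=
  (Quot.out_eq e.1).symm

theorem mem_edge_iff {e : G.edgeSet} {x : V} :
    x ∈ (e : Sym2 V) ↔ x = edgeStart e ∨ x = edgeFinish e := by
  rw [edge_eq e, Sym2.mem_iff]

theorem adj_edge (e : G.edgeSet) : G.Adj (edgeStart e) (edgeFinish e) := by
  have := e.2
  rwa [edge_eq e] at this

theorem isOpen_vertexBall (v : V) (ε : ℝ) (hε : 0 < ε) :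
    IsOpen (vertexBall v ε : Set (Point G)) := by
  refine ⟨?_, ?_, fun ω h => h.elim⟩
  · rintro w (rfl : w = v)
    exact ⟨min ε 1, lt_min hε one_pos, min_le_right _ _, vertexBall_mono _ (min_le_left _ _)⟩
  · rintro e t (⟨h, ht⟩ | ⟨h, ht⟩)
    · refine ⟨ε - t, by linarith, ?_⟩
      rintro _ ⟨s, hs, rfl⟩
      replace hs : |(s : ℝ) - t| < ε - t := hs
      exact Or.inl ⟨h, by have := (abs_lt.1 hs).2; linarith⟩
    · refine ⟨ε - (1 - t), by linarith, ?_⟩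
      rintro _ ⟨s, hs, rfl⟩
      replace hs : |(s : ℝ) - t| < ε - (1 - t) := hs
      exact Or.inr ⟨h, by have := (abs_lt.1 hs).1; linarith⟩

theorem isOpen_innerBall (e : G.edgeSet) (t : Set.Ioo (0 : ℝ) 1) (ε : ℝ) :
    IsOpen (innerBall e t ε) := by
  refine ⟨?_, ?_, ?_⟩
  · rintro v ⟨s, -, h⟩; cases h
  · rintro _ s ⟨_, hs, h⟩
    cases h
    refine ⟨ε - |(s : ℝ) - t|, sub_pos.2 hs, ?_⟩
    rintro _ ⟨s', hs', rfl⟩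
    refine ⟨s', ?_, rfl⟩
    have h1 : |(s' : ℝ) - s| < ε - |(s : ℝ) - t| := hs'
    have := abs_sub_le (s' : ℝ) s t
    show |(s' : ℝ) - t| < ε
    linarith
  · rintro v ⟨s, -, h⟩; cases h

/-- The basic neighbourhood of ends given by the up-closure of `v`. -/
def upNhd (F : NormalForest G) (v : V) : Set (Point G) :=
  {x | match x with
    | .vertex w => w ∈ F.up v
    | .atEnd ω => F.EndIn v ω
    | .inner e _ => edgeStart e ∈ F.up v ∨ edgeFinish e ∈ F.up v}

theorem isOpen_upNhd (F : NormalForest G) (v : V) : IsOpen (upNhd F v) := by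
  refine ⟨?_, ?_, ?_⟩
  · refine fun w hw => ⟨1, one_pos, le_rfl, ?_⟩
    rintro (x | ω | ⟨e, t⟩) hx
    · obtain rfl : x = w := hx
      exact hw
    · exact hx.elim
    · rcases hx with ⟨rfl, -⟩ | ⟨rfl, -⟩
      · exact Or.inl hw
      · exact Or.inr hw
  · refine fun e t h => ⟨1, one_pos, ?_⟩
    rintro _ ⟨s, -, rfl⟩
    exact h
  · intro ω hω
    have h := NormalForest.endComponent_anc_subset (show F.EndIn v ω from hω)
    refine ⟨F.anc v, ?_⟩
    rintro (x | ω' | ⟨e, t⟩) hx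
    · exact h hx
    · obtain ⟨R, rfl, hR⟩ := hx
      exact NormalForest.endIn_toEnd.2 ⟨0, fun n _ => h (hR n)⟩
    · exact hx.imp (fun h' => h h') (fun h' => h h')

theorem upNhd_subset_endNhd {F : NormalForest G} {v : V} {ω : GraphEnd G} {S : Finset V}
    (hv : F.EndIn v ω) (hS : Disjoint (F.up v) (S : Set V)) : upNhd F v ⊆ endNhd S ω := by
  have h := NormalForest.up_subset_endComponent hv hS
  rintro (x | ω' | ⟨e, t⟩) hx
  · exact h hx
  · obtain ⟨R, rfl, N, hN⟩ := show F.EndIn v ω' from hx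
    exact ⟨R.tail N, R.toEnd_tail N, fun n => h (hN _ (by omega))⟩
  · exact hx.imp (fun h' => h h') (fun h' => h h')

variable {Ψ : Set (GraphEnd G)}

variable (Ψ) in
/-- The point of `|G|_Ψ` given by a vertex. -/
def vertexPt (v : V) : PsiSpace G Ψ := ⟨.vertex v, by simp⟩

variable (Ψ) in
/-- The point of `|G|_Ψ` at position `t` of the edge `e`. -/
def edgePt (e : G.edgeSet) (t : Set.Ioo (0 : ℝ) 1) : PsiSpace G Ψ := ⟨.inner e t, by simp⟩

/-- The point of `|G|_Ψ` given by an end in `Ψ`. -/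
def endPt {ω : GraphEnd G} (h : ω ∈ Ψ) : PsiSpace G Ψ :=
  ⟨.atEnd ω, fun ω' h' => by cases h'; exact h⟩

theorem psiSpace_cases (x : PsiSpace G Ψ) : (∃ v, x = vertexPt Ψ v) ∨
    (∃ ω, ∃ h : ω ∈ Ψ, x = endPt h) ∨ ∃ e t, x = edgePt Ψ e t := by
  rcases x with ⟨v | ω | ⟨e, t⟩, h⟩
  · exact Or.inl ⟨v, rfl⟩
  · exact Or.inr (Or.inl ⟨ω, h ω rfl, rfl⟩)
  · exact Or.inr (Or.inr ⟨e, t, rfl⟩)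

theorem vertexPt_mem_vertexSet (v : V) : vertexPt Ψ v ∈ vertexSet G Ψ :=
  fun e t h => by cases h

theorem endPt_mem_vertexSet {ω : GraphEnd G} (h : ω ∈ Ψ) : endPt h ∈ vertexSet G Ψ :=
  fun e t h => by cases h

theorem edgePt_notMem_vertexSet (e : G.edgeSet) (t : Set.Ioo (0 : ℝ) 1) :
    edgePt Ψ e t ∉ vertexSet G Ψ := fun h => h e t rfl

theorem edgePt_mem_edgePoints {e : G.edgeSet} {t : Set.Ioo (0 : ℝ) 1} {o : Set G.edgeSet} :
    edgePt Ψ e t ∈ edgePoints G Ψ o ↔ e ∈ o :=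
  ⟨fun ⟨_, h, _, h'⟩ => by cases h'; exact h, fun h => ⟨e, h, t, rfl⟩⟩

theorem mem_edgePoints {x : PsiSpace G Ψ} {o : Set G.edgeSet} :
    x ∈ edgePoints G Ψ o ↔ ∃ e ∈ o, ∃ t, x = edgePt Ψ e t :=
  ⟨fun ⟨e, h, t, h'⟩ => ⟨e, h, t, Subtype.ext h'⟩, fun ⟨e, h, t, h'⟩ => ⟨e, h, t, by rw [h']; rfl⟩⟩

theorem edgePt_injective {e e' : G.edgeSet} {t t' : Set.Ioo (0 : ℝ) 1}
    (h : edgePt Ψ e t = edgePt Ψ e' t') : e = e' ∧ t = t' := by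
  have := congrArg Subtype.val h
  simp only [edgePt, Point.inner.injEq] at this
  exact this

/-- Openness in `|G|_Ψ` in terms of a normal forest: up-closures of vertices serve as basic
neighbourhoods of the ends. -/
theorem isOpen_iff_forest (F : NormalForest G) {U : Set (PsiSpace G Ψ)} : IsOpen U ↔
    (∀ v, vertexPt Ψ v ∈ U → ∃ ε : ℝ, 0 < ε ∧ ∀ e (t : Set.Ioo (0 : ℝ) 1),
      (edgeStart e = v ∧ (t : ℝ) < ε) ∨ (edgeFinish e = v ∧ 1 - (t : ℝ) < ε) →
        edgePt Ψ e t ∈ U) ∧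
    (∀ e t, edgePt Ψ e t ∈ U → ∃ ε : ℝ, 0 < ε ∧ ∀ s : Set.Ioo (0 : ℝ) 1,
      |(s : ℝ) - t| < ε → edgePt Ψ e s ∈ U) ∧
    ∀ ω (h : ω ∈ Ψ), endPt h ∈ U → ∃ v, F.EndIn v ω ∧ (∀ x ∈ F.up v, vertexPt Ψ x ∈ U) ∧
      (∀ ω' (h' : ω' ∈ Ψ), F.EndIn v ω' → endPt h' ∈ U) ∧
      ∀ e t, edgeStart e ∈ F.up v ∨ edgeFinish e ∈ F.up v → edgePt Ψ e t ∈ U := by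
  constructor
  · rintro ⟨U, ⟨h1, h2, h3⟩, rfl⟩
    refine ⟨fun v hv => ?_, fun e t ht => ?_, fun ω hω h => ?_⟩
    · obtain ⟨ε, hε, -, h⟩ := h1 v hv
      exact ⟨ε, hε, fun e t ht => h ht⟩
    · obtain ⟨ε, hε, h⟩ := h2 e t ht
      exact ⟨ε, hε, fun s hs => h ⟨s, hs, rfl⟩⟩
    · obtain ⟨S, hS⟩ := h3 ω h
      obtain ⟨v, hv, hd⟩ := F.exists_endIn_disjoint S ω
      have := (upNhd_subset_endNhd hv hd).trans hS
      exact ⟨v, hv, fun x hx => this hx, fun ω' _ hω' => this (a := .atEnd ω') hω',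
        fun e t het => this (a := .inner e t) het⟩
  · rintro ⟨h1, h2, h3⟩
    rw [isOpen_iff_forall_mem_open]
    intro x hx
    rcases psiSpace_cases x with ⟨v, rfl⟩ | ⟨ω, hω, rfl⟩ | ⟨e, t, rfl⟩
    · obtain ⟨ε, hε, h⟩ := h1 v hx
      refine ⟨Subtype.val ⁻¹' vertexBall v ε, ?_,
        (isOpen_vertexBall v ε hε).preimage continuous_subtype_val, rfl⟩
      intro y hy
      rcases psiSpace_cases y with ⟨w, rfl⟩ | ⟨ω, hω, rfl⟩ | ⟨e, t, rfl⟩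
      · obtain rfl : w = v := hy
        exact hx
      · exact hy.elim
      · exact h e t hy
    · obtain ⟨v, hv, ha, hb, hc⟩ := h3 ω hω hx
      refine ⟨Subtype.val ⁻¹' upNhd F v, ?_,
        (isOpen_upNhd F v).preimage continuous_subtype_val, hv⟩
      intro y hy
      rcases psiSpace_cases y with ⟨w, rfl⟩ | ⟨ω, hω, rfl⟩ | ⟨e, t, rfl⟩
      · exact ha w hy
      · exact hb _ hω hy
      · exact hc e t hy
    · obtain ⟨ε, hε, h⟩ := h2 e t hx
      refine ⟨Subtype.val ⁻¹' innerBall e t ε, ?_,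
        (isOpen_innerBall e t ε).preimage continuous_subtype_val,
        t, by simpa using hε, rfl⟩
      rintro ⟨_, _⟩ ⟨s, hs, rfl⟩
      exact h s hs

/-- The set of points of `|G|_Ψ` described by its vertices, its ends and its inner points. -/
def pointSet (A : V → Prop) (B : GraphEnd G → Prop) (D : G.edgeSet → Set.Ioo (0 : ℝ) 1 → Prop) :
    Set (PsiSpace G Ψ) :=
  {x | match x.1 with
    | .vertex v => A v
    | .atEnd ω => B ω
    | .inner e t => D e t}

theorem isPsiBounded_iff (F : NormalForest G) {b : Set G.edgeSet} : IsPsiBounded G Ψ b ↔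
    ∀ ω ∈ Ψ, ∃ v, F.EndIn v ω ∧ ∀ e ∈ b, ∀ x ∈ (e : Sym2 V), x ∉ F.up v := by
  constructor
  · intro h ω hω
    have h' : endPt hω ∉ closure (edgePoints G Ψ b) := fun hc => h _ hc ω rfl
    have hopen := (isOpen_iff_forest F).1 (isClosed_closure (s := edgePoints G Ψ b)).isOpen_compl
    obtain ⟨v, hv, -, -, hc⟩ := hopen.2.2 ω hω h'
    refine ⟨v, hv, fun e he x hx hxv => ?_⟩
    refine hc e ⟨1 / 2, by norm_num, by norm_num⟩ ?_
      (subset_closure (edgePt_mem_edgePoints.2 he))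
    rcases mem_edge_iff.1 hx with rfl | rfl
    · exact Or.inl hxv
    · exact Or.inr hxv
  · rintro h x hx ω hxω
    have hω := x.2 ω hxω
    obtain rfl : x = endPt hω := Subtype.ext hxω
    obtain ⟨v, hv, hb⟩ := h ω hω
    obtain ⟨y, hy, hyb⟩ := mem_closure_iff.1 hx (Subtype.val ⁻¹' upNhd F v)
      ((isOpen_upNhd F v).preimage continuous_subtype_val) hv
    obtain ⟨e, he, t, rfl⟩ := mem_edgePoints.1 hyb
    rcases (show edgeStart e ∈ F.up v ∨ edgeFinish e ∈ F.up v from hy) with hy | hy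
    · exact hb e he _ (mem_edge_iff.2 (Or.inl rfl)) hy
    · exact hb e he _ (mem_edge_iff.2 (Or.inr rfl)) hy

/-- An inner point at position `t` of an edge is counted to a side containing the endvertices
with parameters `0` and `1` if `a`, respectively `b`, holds: it goes with its nearest
endvertex, the midpoint only if both endvertices agree. -/
def HalfEdge (a b : Prop) (t : ℝ) : Prop := (a ∧ t < 1 / 2) ∨ (b ∧ 1 / 2 < t) ∨ (a ∧ b)

theorem HalfEdge.exists_ball {a b : Prop} {t : ℝ} (h : HalfEdge a b t) :
    ∃ ε : ℝ, 0 < ε ∧ ∀ s : ℝ, |s - t| < ε → HalfEdge a b s := by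
  rcases h with ⟨ha, ht⟩ | ⟨hb, ht⟩ | h
  · exact ⟨1 / 2 - t, by linarith, fun s hs =>
      Or.inl ⟨ha, by have := (abs_lt.1 hs).2; linarith⟩⟩
  · exact ⟨t - 1 / 2, by linarith, fun s hs =>
      Or.inr (Or.inl ⟨hb, by have := (abs_lt.1 hs).1; linarith⟩)⟩
  · exact ⟨1, one_pos, fun s _ => Or.inr (Or.inr h)⟩

theorem HalfEdge.not_both {a b a' b' : Prop} {t : ℝ} (h : HalfEdge a b t) (h' : HalfEdge a' b' t)
    (ha : ¬ (a ∧ a')) (hb : ¬ (b ∧ b')) : False := by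
  rcases h with ⟨h1, h2⟩ | ⟨h1, h2⟩ | ⟨h1, h2⟩ <;>
  rcases h' with ⟨h3, h4⟩ | ⟨h3, h4⟩ | ⟨h3, h4⟩ <;>
  first | exact ha ⟨h1, h3⟩ | exact hb ⟨h1, h3⟩ | exact hb ⟨h2, h3⟩ | exact hb ⟨h1, h4⟩ |
    exact hb ⟨h2, h4⟩ | linarith

/-- The points of `|G|_Ψ` on the side `A` of a cut. -/
def cutSide (F : NormalForest G) (Ψ : Set (GraphEnd G)) (A : Set V) : Set (PsiSpace G Ψ) :=
  pointSet (· ∈ A)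
    (fun ω => ∃ v, F.EndIn v ω ∧ ∀ x ∈ F.up v, x ∈ A ∧ ∀ y, G.Adj x y → y ∈ A)
    fun e t => HalfEdge (edgeStart e ∈ A) (edgeFinish e ∈ A) t

theorem isOpen_cutSide (F : NormalForest G) (A : Set V) : IsOpen (cutSide F Ψ A) := by
  refine (isOpen_iff_forest F).2 ⟨fun v hv => ⟨1 / 2, by norm_num, ?_⟩, fun e t h => ?_, ?_⟩
  · rintro e t (⟨rfl, ht⟩ | ⟨rfl, ht⟩)
    · exact Or.inl ⟨hv, ht⟩
    · exact Or.inr (Or.inl ⟨hv, by linarith⟩)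
  · obtain ⟨ε, hε, h⟩ := HalfEdge.exists_ball h
    exact ⟨ε, hε, fun s hs => h s hs⟩
  · rintro ω hω ⟨v, hv, hA⟩
    refine ⟨v, hv, fun x hx => (hA x hx).1, fun ω' _ hω' => ⟨v, hω', hA⟩, ?_⟩
    rintro e t (h | h)
    · exact Or.inr (Or.inr ⟨(hA _ h).1, (hA _ h).2 _ (adj_edge e)⟩)
    · exact Or.inr (Or.inr ⟨(hA _ h).2 _ (adj_edge e).symm, (hA _ h).1⟩)

theorem disjoint_cutSide (F : NormalForest G) (A : Set V) :
    Disjoint (cutSide F Ψ A) (cutSide F Ψ Aᶜ) := by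
  refine Set.disjoint_left.2 fun x hx hx' => ?_
  rcases psiSpace_cases x with ⟨v, rfl⟩ | ⟨ω, hω, rfl⟩ | ⟨e, t, rfl⟩
  · exact hx' hx
  · obtain ⟨v, hv, hA⟩ := hx
    obtain ⟨w, hw, hA'⟩ := hx'
    obtain ⟨x, hx, hx'⟩ := hv.exists_mem hw
    exact (hA' x hx').1 (hA x hx).1
  · exact HalfEdge.not_both hx hx' (fun h => h.2 h.1) (fun h => h.2 h.1)

theorem mem_cut_iff {A : Set V} {e : G.edgeSet} :
    (∃ x ∈ A, ∃ y ∉ A, (e : Sym2 V) = s(x, y)) ↔ ¬ (edgeStart e ∈ A ↔ edgeFinish e ∈ A) := by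
  constructor
  · rintro ⟨x, hx, y, hy, h⟩
    rw [edge_eq e, Sym2.eq_iff] at h
    rcases h with ⟨rfl, rfl⟩ | ⟨rfl, rfl⟩ <;> tauto
  · intro h
    by_cases h1 : edgeStart e ∈ A
    · exact ⟨_, h1, _, fun h2 => h ⟨fun _ => h2, fun _ => h1⟩, edge_eq e⟩
    · by_cases h2 : edgeFinish e ∈ A
      · exact ⟨_, h2, _, h1, by rw [edge_eq e, Sym2.eq_swap]⟩
      · exact absurd ⟨fun h => absurd h h1, fun h => absurd h h2⟩ h

/-- A bounded cut partitions `|G|_Ψ` into its two sides and the midpoints of its edges. -/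
theorem cutSide_cover (F : NormalForest G) {A : Set V} {b : Set G.edgeSet}
    (hb : b = {e : G.edgeSet | ∃ x ∈ A, ∃ y ∉ A, (e : Sym2 V) = s(x, y)})
    (hbd : IsPsiBounded G Ψ b) (x : PsiSpace G Ψ) :
    x ∈ cutSide F Ψ A ∪ cutSide F Ψ Aᶜ ∨
      ∃ e ∈ b, x = edgePt Ψ e ⟨1 / 2, by norm_num, by norm_num⟩ := by
  rcases psiSpace_cases x with ⟨v, rfl⟩ | ⟨ω, hω, rfl⟩ | ⟨e, t, rfl⟩
  · exact Or.inl (em (v ∈ A))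
  · left
    obtain ⟨v, hv, hvb⟩ := (isPsiBounded_iff F).1 hbd ω hω
    have hadj : ∀ x ∈ F.up v, ∀ y, G.Adj x y → (x ∈ A ↔ y ∈ A) := by
      intro x hx y hxy
      by_contra hne
      refine hvb ⟨s(x, y), hxy⟩ ?_ x (by simp) hx
      rw [hb]
      by_cases h1 : x ∈ A
      · exact ⟨x, h1, y, by tauto, rfl⟩
      · exact ⟨y, by tauto, x, h1, Sym2.eq_swap⟩
    have hup : ∀ x ∈ F.up v, (v ∈ A ↔ x ∈ A) := fun x hx =>
      NormalForest.iff_of_mem_up (fun c p hc hp => hadj p hp c (F.adj hc)) hx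
    by_cases h : v ∈ A
    · exact Or.inl ⟨v, hv, fun x hx => ⟨(hup x hx).1 h, fun y hy =>
        (hadj x hx y hy).1 ((hup x hx).1 h)⟩⟩
    · exact Or.inr ⟨v, hv, fun x hx => ⟨fun h' => h ((hup x hx).2 h'), fun y hy h' =>
        h ((hup x hx).2 ((hadj x hx y hy).2 h'))⟩⟩
  · by_cases he : edgeStart e ∈ A ↔ edgeFinish e ∈ A
    · left
      by_cases h : edgeStart e ∈ A
      · exact Or.inl (Or.inr (Or.inr ⟨h, he.1 h⟩))
      · exact Or.inr (Or.inr (Or.inr ⟨h, fun h' => h (he.2 h')⟩))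
    · rcases lt_trichotomy (t : ℝ) (1 / 2) with ht | ht | ht
      · left
        by_cases h : edgeStart e ∈ A
        · exact Or.inl (Or.inl ⟨h, ht⟩)
        · exact Or.inr (Or.inl ⟨h, ht⟩)
      · right
        refine ⟨e, ?_, by congr; exact Subtype.ext ht⟩
        rw [hb]
        exact mem_cut_iff.2 he
      · left
        by_cases h : edgeFinish e ∈ A
        · exact Or.inl (Or.inr (Or.inl ⟨h, ht⟩))
        · exact Or.inr (Or.inr (Or.inl ⟨h, ht⟩))

/-! ### The graph-like quotient -/

variable (G Ψ) in
/-- The quotient map onto the graph-like quotient. -/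
def cls (x : PsiSpace G Ψ) : GraphLikeQuotient G Ψ := Quotient.mk (quotientSetoid G Ψ) x

theorem continuous_cls : Continuous (cls G Ψ) := continuous_quotient_mk'

theorem cls_surjective : Function.Surjective (cls G Ψ) := Quotient.exists_rep

theorem cls_eq_iff {x y : PsiSpace G Ψ} : cls G Ψ x = cls G Ψ y ↔ (quotientSetoid G Ψ).r x y :=
  Quotient.eq

theorem cls_eq_cls_edgePt {x : PsiSpace G Ψ} {e : G.edgeSet} {t : Set.Ioo (0 : ℝ) 1} :
    cls G Ψ x = cls G Ψ (edgePt Ψ e t) ↔ x = edgePt Ψ e t := by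
  refine ⟨fun h => ?_, fun h => by rw [h]⟩
  exact (cls_eq_iff.1 h).resolve_right fun h' => edgePt_notMem_vertexSet e t h'.2.1

/-- `U` is a union of classes of the graph-like quotient. -/
def IsSaturated (U : Set (PsiSpace G Ψ)) : Prop :=
  ∀ x y, cls G Ψ x = cls G Ψ y → x ∈ U → y ∈ U

theorem IsSaturated.cls_mem_image {U : Set (PsiSpace G Ψ)} (h : IsSaturated U)
    {x : PsiSpace G Ψ} : cls G Ψ x ∈ cls G Ψ '' U ↔ x ∈ U :=
  ⟨fun ⟨y, hy, hyx⟩ => h y x hyx hy, fun hx => ⟨x, hx, rfl⟩⟩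

theorem IsSaturated.isOpen_image {U : Set (PsiSpace G Ψ)} (h : IsSaturated U) (hU : IsOpen U) :
    IsOpen (cls G Ψ '' U) := by
  have : cls G Ψ ⁻¹' (cls G Ψ '' U) = U := Set.ext fun x => h.cls_mem_image
  exact (isQuotientMap_quotient_mk' (s := quotientSetoid G Ψ)).isOpen_preimage.1 (this.symm ▸ hU)

theorem isSaturated_preimage (O : Set (GraphLikeQuotient G Ψ)) :
    IsSaturated (cls G Ψ ⁻¹' O) :=
  fun x y h hx => by rw [Set.mem_preimage, ← h]; exact hx

/-- Two disjoint open sets covering the vertex set of `|G|_Ψ` are both unions of classes. -/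
theorem isSaturated_of_partition {U U' : Set (PsiSpace G Ψ)} (hU : IsOpen U) (hU' : IsOpen U')
    (hd : Disjoint U U') (hc : vertexSet G Ψ ⊆ U ∪ U') : IsSaturated U := by
  intro x y h hx
  rcases cls_eq_iff.1 h with rfl | ⟨-, -, h⟩
  · exact hx
  · exact (h U U' hU hU' hd hc).1 hx

theorem isSaturated_edgePoints (o : Set G.edgeSet) : IsSaturated (edgePoints G Ψ o) := by
  rintro x y h hx
  obtain ⟨e, he, t, rfl⟩ := mem_edgePoints.1 hx
  rw [cls_eq_cls_edgePt.1 h.symm]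
  exact hx

variable (G Ψ) in
/-- The inner points in the quotient of the edges in `o`. -/
def edgeCls (o : Set G.edgeSet) : Set (GraphLikeQuotient G Ψ) := cls G Ψ '' edgePoints G Ψ o

variable (G Ψ) in
/-- The vertices of the quotient. -/
def vertexCls : Set (GraphLikeQuotient G Ψ) := cls G Ψ '' vertexSet G Ψ

theorem mem_edgeCls {o : Set G.edgeSet} {p : GraphLikeQuotient G Ψ} :
    p ∈ edgeCls G Ψ o ↔ ∃ e ∈ o, ∃ t, p = cls G Ψ (edgePt Ψ e t) := by
  constructor
  · rintro ⟨x, hx, rfl⟩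
    obtain ⟨e, he, t, rfl⟩ := mem_edgePoints.1 hx
    exact ⟨e, he, t, rfl⟩
  · rintro ⟨e, he, t, rfl⟩
    exact ⟨_, edgePt_mem_edgePoints.2 he, rfl⟩

theorem cls_edgePt_mem_edgeCls {o : Set G.edgeSet} {e : G.edgeSet} {t : Set.Ioo (0 : ℝ) 1} :
    cls G Ψ (edgePt Ψ e t) ∈ edgeCls G Ψ o ↔ e ∈ o := by
  rw [edgeCls, (isSaturated_edgePoints o).cls_mem_image, edgePt_mem_edgePoints]

theorem disjoint_edgeCls_vertexCls (o : Set G.edgeSet) :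
    Disjoint (edgeCls G Ψ o) (vertexCls G Ψ) := by
  refine Set.disjoint_left.2 ?_
  rintro p hp ⟨x, hx, rfl⟩
  obtain ⟨e, -, t, h⟩ := mem_edgeCls.1 hp
  rw [cls_eq_cls_edgePt.1 h] at hx
  exact edgePt_notMem_vertexSet e t hx

theorem mem_vertexCls_or (p : GraphLikeQuotient G Ψ) :
    p ∈ vertexCls G Ψ ∨ ∃ e t, p = cls G Ψ (edgePt Ψ e t) := by
  obtain ⟨x, rfl⟩ := cls_surjective p
  rcases psiSpace_cases x with ⟨v, rfl⟩ | ⟨ω, hω, rfl⟩ | ⟨e, t, rfl⟩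
  · exact Or.inl ⟨_, vertexPt_mem_vertexSet v, rfl⟩
  · exact Or.inl ⟨_, endPt_mem_vertexSet hω, rfl⟩
  · exact Or.inr ⟨e, t, rfl⟩

theorem isOpen_edgePoints (o : Set G.edgeSet) : IsOpen (edgePoints G Ψ o) := by
  have : edgePoints G Ψ o = ⋃ e ∈ o, ⋃ t, Subtype.val ⁻¹' innerBall e t 1 := by
    ext x
    rw [mem_edgePoints]
    simp only [Set.mem_iUnion, Set.mem_preimage, exists_prop]
    refine exists_congr fun e => and_congr_right fun _ => ⟨?_, ?_⟩
    · rintro ⟨t, rfl⟩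
      exact ⟨t, t, by simp, rfl⟩
    · rintro ⟨t, s, -, hs⟩
      exact ⟨s, Subtype.ext hs.symm⟩
  rw [this]
  exact isOpen_biUnion fun e _ => isOpen_iUnion fun t =>
    (isOpen_innerBall e t 1).preimage continuous_subtype_val

theorem isOpen_edgeCls (o : Set G.edgeSet) : IsOpen (edgeCls G Ψ o) :=
  (isSaturated_edgePoints o).isOpen_image (isOpen_edgePoints o)

theorem continuous_edgePt (e : G.edgeSet) : Continuous (edgePt Ψ e) := by
  refine Continuous.subtype_mk ⟨fun U hU => ?_⟩ _
  refine Metric.isOpen_iff.2 fun t ht => ?_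
  obtain ⟨ε, hε, h⟩ := hU.2.1 e t ht
  exact ⟨ε, hε, fun s hs =>
    h ⟨s, by rwa [Metric.mem_ball, Subtype.dist_eq, Real.dist_eq] at hs, rfl⟩⟩

theorem isPreconnected_edgeCls (e : G.edgeSet) : IsPreconnected (edgeCls G Ψ {e}) := by
  have : edgeCls G Ψ {e} = Set.range fun t => cls G Ψ (edgePt Ψ e t) := by
    ext p
    rw [mem_edgeCls]
    simp [eq_comm]
  rw [this]
  have : PreconnectedSpace (Set.Ioo (0 : ℝ) 1) :=
    isPreconnected_iff_preconnectedSpace.1 isPreconnected_Ioo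
  exact isPreconnected_range (continuous_cls.comp (continuous_edgePt e))

/-- Distinct vertices of the quotient are separated by a partition into open sets. -/
theorem exists_partition_of_ne {p p' : GraphLikeQuotient G Ψ} (hp : p ∈ vertexCls G Ψ)
    (hp' : p' ∈ vertexCls G Ψ) (hne : p ≠ p') : ∃ O O' : Set (GraphLikeQuotient G Ψ),
      IsOpen O ∧ IsOpen O' ∧ Disjoint O O' ∧ vertexCls G Ψ ⊆ O ∪ O' ∧ p ∈ O ∧ p' ∈ O' := by
  obtain ⟨x, hx, rfl⟩ := hp
  obtain ⟨y, hy, rfl⟩ := hp'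
  have h : ¬ ∀ U U' : Set (PsiSpace G Ψ), IsOpen U → IsOpen U' → Disjoint U U' →
      vertexSet G Ψ ⊆ U ∪ U' → (x ∈ U ↔ y ∈ U) :=
    fun h => hne (cls_eq_iff.2 (Or.inr ⟨hx, hy, h⟩))
  push Not at h
  obtain ⟨U, U', hU, hU', hd, hc, h⟩ := h
  have key : ∀ U U' : Set (PsiSpace G Ψ), IsOpen U → IsOpen U' → Disjoint U U' →
      vertexSet G Ψ ⊆ U ∪ U' → x ∈ U → y ∈ U' → ∃ O O' : Set (GraphLikeQuotient G Ψ),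
      IsOpen O ∧ IsOpen O' ∧ Disjoint O O' ∧ vertexCls G Ψ ⊆ O ∪ O' ∧
        cls G Ψ x ∈ O ∧ cls G Ψ y ∈ O' := by
    intro U U' hU hU' hd hc hx hy
    have hs := isSaturated_of_partition hU hU' hd hc
    have hs' := isSaturated_of_partition hU' hU hd.symm (by rwa [Set.union_comm])
    refine ⟨_, _, hs.isOpen_image hU, hs'.isOpen_image hU', ?_, ?_, ⟨x, hx, rfl⟩, ⟨y, hy, rfl⟩⟩
    · refine Set.disjoint_left.2 ?_
      rintro _ ⟨z, hz, rfl⟩ hz'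
      exact Set.disjoint_left.1 hd hz (hs'.cls_mem_image.1 hz')
    · rw [← Set.image_union]
      exact Set.image_mono hc
  rcases h with ⟨h1, h2⟩ | ⟨h1, h2⟩
  · exact key U U' hU hU' hd hc h1 ((hc hy).resolve_left h2)
  · exact key U' U hU' hU hd.symm (by rwa [Set.union_comm]) ((hc hx).resolve_left h1) h2

open Classical in
/-- The map of `|G|_Ψ` to the circle that wraps the edge `e` around it and sends everything else
to the base point. -/
noncomputable def edgeWrap (e : G.edgeSet) (x : PsiSpace G Ψ) : UnitAddCircle :=
  match x.1 with
  | .inner e' t => if e' = e then ((t : ℝ) : UnitAddCircle) else 0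
  | _ => 0

theorem edgeWrap_edgePt_self (e : G.edgeSet) (t : Set.Ioo (0 : ℝ) 1) :
    edgeWrap e (edgePt Ψ e t) = ((t : ℝ) : UnitAddCircle) := if_pos rfl

theorem edgeWrap_edgePt_of_ne {e e' : G.edgeSet} (h : e' ≠ e) (t : Set.Ioo (0 : ℝ) 1) :
    edgeWrap e (edgePt Ψ e' t) = 0 := if_neg h

theorem edgeWrap_of_mem_vertexSet (e : G.edgeSet) {x : PsiSpace G Ψ} (hx : x ∈ vertexSet G Ψ) :
    edgeWrap e x = 0 := by
  rcases psiSpace_cases x with ⟨v, rfl⟩ | ⟨ω, hω, rfl⟩ | ⟨e', t, rfl⟩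
  · rfl
  · rfl
  · exact absurd hx (edgePt_notMem_vertexSet e' t)

theorem coe_Ioo_eq_iff {s t : Set.Ioo (0 : ℝ) 1} :
    ((s : ℝ) : UnitAddCircle) = ((t : ℝ) : UnitAddCircle) ↔ s = t := by
  refine ⟨fun h => ?_, fun h => by rw [h]⟩
  have : Fact ((0 : ℝ) < 1) := ⟨one_pos⟩
  exact Subtype.ext ((AddCircle.coe_eq_coe_iff_of_mem_Ico (p := (1 : ℝ)) (a := 0)
    ⟨s.2.1.le, by simpa using s.2.2⟩ ⟨t.2.1.le, by simpa using t.2.2⟩).1 h)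

theorem coe_Ioo_ne_zero (s : Set.Ioo (0 : ℝ) 1) : ((s : ℝ) : UnitAddCircle) ≠ 0 := by
  intro h
  have : Fact ((0 : ℝ) < 1) := ⟨one_pos⟩
  have := (AddCircle.coe_eq_coe_iff_of_mem_Ico (p := (1 : ℝ)) (a := 0) (x := s) (y := 0)
    ⟨s.2.1.le, by simpa using s.2.2⟩ ⟨le_rfl, by norm_num⟩).1 (by simpa using h)
  exact s.2.1.ne' this

theorem continuous_edgeWrap (F : NormalForest G) (e : G.edgeSet) :
    Continuous (edgeWrap e : PsiSpace G Ψ → UnitAddCircle) := by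
  refine ⟨fun O hO => (isOpen_iff_forest F).2 ⟨fun v hv => ?_, fun e' t ht => ?_, ?_⟩⟩
  · have hv : (0 : UnitAddCircle) ∈ O := hv
    have hO' : IsOpen ((fun s : ℝ => (s : UnitAddCircle)) ⁻¹' O) :=
      hO.preimage (AddCircle.continuous_mk' 1)
    obtain ⟨ε, hε, h⟩ := Metric.isOpen_iff.1 hO' 0 (by simpa using hv)
    refine ⟨ε, hε, fun e' t ht => ?_⟩
    by_cases he : e' = e
    · subst he
      rw [Set.mem_preimage, edgeWrap_edgePt_self]
      rcases ht with ⟨-, ht⟩ | ⟨-, ht⟩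
      · exact h (by rw [Metric.mem_ball, Real.dist_eq, sub_zero, abs_of_pos t.2.1]; exact ht)
      · have h1 : (t : ℝ) - 1 ∈ Metric.ball (0 : ℝ) ε := by
          rw [Metric.mem_ball, Real.dist_eq, sub_zero, abs_of_neg (by linarith [t.2.2])]
          linarith
        have h2 := h h1
        have h3 : (((t : ℝ) - 1 : ℝ) : UnitAddCircle) = ((t : ℝ) : UnitAddCircle) := by
          rw [AddCircle.coe_sub, AddCircle.coe_period, sub_zero]
        rwa [Set.mem_preimage, h3] at h2
    · rw [Set.mem_preimage, edgeWrap_edgePt_of_ne he]; exact hv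
  · by_cases he : e' = e
    · subst he
      have hO' : IsOpen ((fun s : ℝ => (s : UnitAddCircle)) ⁻¹' O) :=
        hO.preimage (AddCircle.continuous_mk' 1)
      rw [Set.mem_preimage, edgeWrap_edgePt_self] at ht
      obtain ⟨ε, hε, h⟩ := Metric.isOpen_iff.1 hO' t ht
      refine ⟨ε, hε, fun s hs => ?_⟩
      rw [Set.mem_preimage, edgeWrap_edgePt_self]
      exact h (by rwa [Metric.mem_ball, Real.dist_eq])
    · refine ⟨1, one_pos, fun s _ => ?_⟩
      rw [Set.mem_preimage, edgeWrap_edgePt_of_ne he] at ht ⊢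
      exact ht
  · intro ω hω h0
    have h0 : (0 : UnitAddCircle) ∈ O := h0
    classical
    obtain ⟨v, hv, hd⟩ := F.exists_endIn_disjoint {edgeStart e, edgeFinish e} ω
    refine ⟨v, hv, fun x _ => h0, fun ω' _ _ => h0, fun e' t ht => ?_⟩
    have : e' ≠ e := by
      rintro rfl
      rcases ht with ht | ht
      · exact Set.disjoint_left.1 hd ht (by simp)
      · exact Set.disjoint_left.1 hd ht (by simp)
    rw [Set.mem_preimage, edgeWrap_edgePt_of_ne this]; exact h0

theorem exists_edgeWrap (F : NormalForest G) (e : G.edgeSet) :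
    ∃ f : GraphLikeQuotient G Ψ → UnitAddCircle, Continuous f ∧
      ∀ x, f (cls G Ψ x) = edgeWrap e x := by
  refine ⟨Quotient.lift (edgeWrap e) ?_, (continuous_edgeWrap F e).quotient_lift _, fun x => rfl⟩
  rintro x y (rfl | ⟨hx, hy, -⟩)
  · rfl
  · rw [edgeWrap_of_mem_vertexSet e hx, edgeWrap_of_mem_vertexSet e hy]

theorem t2Space_quotient (F : NormalForest G) : T2Space (GraphLikeQuotient G Ψ) := by
  have key : ∀ e t (q : GraphLikeQuotient G Ψ), cls G Ψ (edgePt Ψ e t) ≠ q →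
      ∃ O O' : Set (GraphLikeQuotient G Ψ), IsOpen O ∧ IsOpen O' ∧
        cls G Ψ (edgePt Ψ e t) ∈ O ∧ q ∈ O' ∧ Disjoint O O' := by
    intro e t q hne
    obtain ⟨f, hf, hfe⟩ := exists_edgeWrap (Ψ := Ψ) F e
    refine separated_by_continuous hf fun h => ?_
    obtain ⟨y, rfl⟩ := cls_surjective q
    rw [hfe, hfe, edgeWrap_edgePt_self] at h
    rcases psiSpace_cases y with ⟨v, rfl⟩ | ⟨ω, hω, rfl⟩ | ⟨e', t', rfl⟩
    · exact coe_Ioo_ne_zero t h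
    · exact coe_Ioo_ne_zero t h
    · by_cases he : e' = e
      · subst he
        rw [edgeWrap_edgePt_self, coe_Ioo_eq_iff] at h
        exact hne (by rw [h])
      · rw [edgeWrap_edgePt_of_ne he] at h
        exact coe_Ioo_ne_zero t h
  refine ⟨fun p q hne => ?_⟩
  rcases mem_vertexCls_or p with hp | ⟨e, t, rfl⟩
  · rcases mem_vertexCls_or q with hq | ⟨e, t, rfl⟩
    · obtain ⟨O, O', h1, h2, h3, -, h4, h5⟩ := exists_partition_of_ne hp hq hne
      exact ⟨O, O', h1, h2, h4, h5, h3⟩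
    · obtain ⟨O, O', h1, h2, h3, h4, h5⟩ := key e t p hne.symm
      exact ⟨O', O, h2, h1, h4, h3, h5.symm⟩
  · exact key e t q hne

/-- The vertices of the quotient form a totally disconnected set. -/
theorem eq_of_isPreconnected {K : Set (GraphLikeQuotient G Ψ)} (hK : IsPreconnected K)
    (hv : K ⊆ vertexCls G Ψ) {p q : GraphLikeQuotient G Ψ} (hp : p ∈ K) (hq : q ∈ K) : p = q := by
  by_contra hne
  obtain ⟨O, O', h1, h2, h3, h4, h5, h6⟩ := exists_partition_of_ne (hv hp) (hv hq) hne
  obtain ⟨r, -, hr, hr'⟩ := hK O O' h1 h2 (hv.trans h4) ⟨p, hp, h5⟩ ⟨q, hq, h6⟩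
  exact Set.disjoint_left.1 h3 hr hr'

/-- In the quotient, a bounded cut is separated by open sets up to the midpoints of its edges,
and these open sets contain different halves of each edge of the cut. -/
theorem exists_separation_of_cut (F : NormalForest G) {b : Set G.edgeSet} (hb : IsCut G b)
    (hbd : IsPsiBounded G Ψ b) : ∃ O O' : Set (GraphLikeQuotient G Ψ),
      IsOpen O ∧ IsOpen O' ∧ Disjoint O O' ∧
      (∀ p, p ∈ O ∪ O' ∨ ∃ e ∈ b, p = cls G Ψ (edgePt Ψ e ⟨1 / 2, by norm_num, by norm_num⟩)) ∧
      ∀ e ∈ b, (∃ t : Set.Ioo (0 : ℝ) 1, (t : ℝ) ≠ 1 / 2 ∧ cls G Ψ (edgePt Ψ e t) ∈ O) ∧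
        ∃ t : Set.Ioo (0 : ℝ) 1, (t : ℝ) ≠ 1 / 2 ∧ cls G Ψ (edgePt Ψ e t) ∈ O' := by
  obtain ⟨A, hA⟩ := hb
  have hcov := cutSide_cover F hA hbd
  have hvs : vertexSet G Ψ ⊆ cutSide F Ψ A ∪ cutSide F Ψ Aᶜ := by
    intro x hx
    refine (hcov x).resolve_right ?_
    rintro ⟨e, -, rfl⟩
    exact edgePt_notMem_vertexSet _ _ hx
  have h1 := isOpen_cutSide (Ψ := Ψ) F A
  have h2 := isOpen_cutSide (Ψ := Ψ) F Aᶜ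
  have hd := disjoint_cutSide (Ψ := Ψ) F A
  have hs := isSaturated_of_partition h1 h2 hd hvs
  have hs' := isSaturated_of_partition h2 h1 hd.symm (by rwa [Set.union_comm])
  refine ⟨_, _, hs.isOpen_image h1, hs'.isOpen_image h2, ?_, fun p => ?_, fun e he => ?_⟩
  · refine Set.disjoint_left.2 ?_
    rintro _ ⟨z, hz, rfl⟩ hz'
    exact Set.disjoint_left.1 hd hz (hs'.cls_mem_image.1 hz')
  · obtain ⟨x, rfl⟩ := cls_surjective p
    refine (hcov x).imp (fun h => ?_) ?_
    · rw [← Set.image_union]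
      exact ⟨x, h, rfl⟩
    · rintro ⟨e, he, rfl⟩
      exact ⟨e, he, rfl⟩
  · rw [hA] at he
    have he' := mem_cut_iff.1 he
    have hq : ((1 : ℝ) / 4) < 1 / 2 := by norm_num
    have hq' : (1 / 2 : ℝ) < 3 / 4 := by norm_num
    by_cases h : edgeStart e ∈ A
    · have h' : edgeFinish e ∉ A := fun h' => he' ⟨fun _ => h', fun _ => h⟩
      exact ⟨⟨⟨1 / 4, by norm_num, by norm_num⟩, by norm_num, _, Or.inl ⟨h, hq⟩, rfl⟩,
        ⟨⟨3 / 4, by norm_num, by norm_num⟩, by norm_num, _, Or.inr (Or.inl ⟨h', hq'⟩), rfl⟩⟩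
    · have h' : edgeFinish e ∈ A := by tauto
      exact ⟨⟨⟨3 / 4, by norm_num, by norm_num⟩, by norm_num, _, Or.inr (Or.inl ⟨h', hq'⟩), rfl⟩,
        ⟨⟨1 / 4, by norm_num, by norm_num⟩, by norm_num, _, Or.inl ⟨h, hq⟩, rfl⟩⟩

/-- The endvertices of an edge of `o` lie in the closure of `o` in the quotient. -/
theorem edgeStart_mem_closure (F : NormalForest G) {o : Set G.edgeSet} {e : G.edgeSet}
    (he : e ∈ o) : cls G Ψ (vertexPt Ψ (edgeStart e)) ∈ closure (edgeCls G Ψ o) := by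
  refine image_closure_subset_closure_image continuous_cls
    ⟨_, mem_closure_iff.2 fun O hO h => ?_, rfl⟩
  obtain ⟨ε, hε, h⟩ := ((isOpen_iff_forest F).1 hO).1 _ h
  have hmin : 0 < min (ε / 2) (1 / 2) := lt_min (by linarith) (by norm_num)
  have h1 : min (ε / 2) (1 / 2) < 1 := (min_le_right _ _).trans_lt (by norm_num)
  exact ⟨edgePt Ψ e ⟨min (ε / 2) (1 / 2), hmin, h1⟩,
    h e _ (Or.inl ⟨rfl, (min_le_left _ _).trans_lt (by linarith)⟩), edgePt_mem_edgePoints.2 he⟩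

theorem closure_edgeCls_subset (o : Set G.edgeSet) :
    closure (edgeCls G Ψ o) ⊆ edgeCls G Ψ o ∪ vertexCls G Ψ := by
  intro p hp
  rcases mem_vertexCls_or p with h | ⟨e, t, rfl⟩
  · exact Or.inr h
  · obtain ⟨q, hq, hq'⟩ := mem_closure_iff.1 hp _ (isOpen_edgeCls {e})
      (cls_edgePt_mem_edgeCls.2 rfl)
    obtain ⟨e', rfl, t', rfl⟩ := mem_edgeCls.1 hq
    exact Or.inl (cls_edgePt_mem_edgeCls.2 (cls_edgePt_mem_edgeCls.1 hq'))

end Topology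

/-! ### Maps of the circle -/

section Circle

/-- Two continuous surjections from a compact space to Hausdorff spaces with the same fibres have
homeomorphic images. -/
theorem nonempty_homeomorph_of_same_fibers {X Y Z : Type*} [TopologicalSpace X]
    [TopologicalSpace Y] [TopologicalSpace Z] [CompactSpace X] [T2Space Y] [T2Space Z]
    {p : X → Y} {q : X → Z} (hp : Continuous p) (hq : Continuous q) (hp' : Function.Surjective p)
    (hq' : Function.Surjective q) (h : ∀ a b, p a = p b ↔ q a = q b) : Nonempty (Y ≃ₜ Z) := by
  have h1 := Topology.IsQuotientMap.homeomorph (f := (⟨p, hp⟩ : C(X, Y)))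
    (hp.isClosedMap.isQuotientMap hp hp')
  have h2 := Topology.IsQuotientMap.homeomorph (f := (⟨q, hq⟩ : C(X, Z)))
    (hq.isClosedMap.isQuotientMap hq hq')
  change Quotient (Setoid.ker p) ≃ₜ Y at h1
  change Quotient (Setoid.ker q) ≃ₜ Z at h2
  have h3 : Setoid.ker p = Setoid.ker q := Setoid.ext h
  rw [h3] at h1
  exact ⟨h1.symm.trans h2⟩

theorem coe_unitAddCircle_eq_iff {x y : ℝ} (hx : x ∈ Set.Icc (0 : ℝ) 1)
    (hy : y ∈ Set.Icc (0 : ℝ) 1) : (x : UnitAddCircle) = (y : UnitAddCircle) ↔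
      x = y ∨ (x = 0 ∧ y = 1) ∨ (x = 1 ∧ y = 0) := by
  have : Fact ((0 : ℝ) < 1) := ⟨one_pos⟩
  have h1 : ((1 : ℝ) : UnitAddCircle) = ((0 : ℝ) : UnitAddCircle) := by
    rw [AddCircle.coe_period]; rfl
  have key : ∀ {a b : ℝ}, a ∈ Set.Icc (0 : ℝ) 1 → b ∈ Set.Icc (0 : ℝ) 1 → a < 1 → b < 1 →
      ((a : UnitAddCircle) = (b : UnitAddCircle) ↔ a = b) := fun ha hb ha' hb' =>
    AddCircle.coe_eq_coe_iff_of_mem_Ico (p := (1 : ℝ)) (a := 0)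
      ⟨ha.1, by simpa using ha'⟩ ⟨hb.1, by simpa using hb'⟩
  have h0 : (0 : ℝ) ∈ Set.Icc (0 : ℝ) 1 := ⟨le_rfl, zero_le_one⟩
  rcases hx.2.lt_or_eq with hx1 | rfl
  · rcases hy.2.lt_or_eq with hy1 | rfl
    · rw [key hx hy hx1 hy1]
      constructor
      · exact Or.inl
      · rintro (h | ⟨-, h⟩ | ⟨h, -⟩)
        · exact h
        · linarith
        · linarith
    · rw [h1, key hx h0 hx1 one_pos]
      constructor
      · exact fun h => Or.inr (Or.inl ⟨h, rfl⟩)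
      · rintro (h | ⟨h, -⟩ | ⟨-, h⟩)
        · linarith
        · exact h
        · linarith
  · rcases hy.2.lt_or_eq with hy1 | rfl
    · rw [h1, key h0 hy one_pos hy1]
      constructor
      · exact fun h => Or.inr (Or.inr ⟨rfl, h.symm⟩)
      · rintro (h | ⟨h, -⟩ | ⟨-, h⟩)
        · linarith
        · linarith
        · exact h.symm
    · simp

theorem exists_coe_unitAddCircle_eq (z : UnitAddCircle) :
    ∃ x ∈ Set.Ico (0 : ℝ) 1, (x : UnitAddCircle) = z := by
  have : Fact ((0 : ℝ) < 1) := ⟨one_pos⟩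
  have h := (AddCircle.equivIco (1 : ℝ) 0 z).2
  exact ⟨_, ⟨h.1, h.2.trans_eq (zero_add 1)⟩, (AddCircle.equivIco (1 : ℝ) 0).symm_apply_apply z⟩

/-- No continuous real function on the circle is injective: it agrees at some pair of antipodal
points. -/
theorem not_injective_of_continuous {f : Circle → ℝ} (hf : Continuous f) :
    ¬ Function.Injective f := by
  intro hinj
  let g : Circle → ℝ := fun z => f z - f (-z)
  have hg : Continuous g := hf.sub (hf.comp continuous_neg)
  have hgneg : g (-1) = - g 1 := by simp [g]
  have h0 : ∃ z, g z = 0 := by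
    have hpre : IsPreconnected (Set.univ : Set Circle) := isPreconnected_univ
    rcases le_total (g 1) 0 with h | h
    · obtain ⟨z, -, hz⟩ := hpre.intermediate_value (Set.mem_univ 1) (Set.mem_univ (-1))
        hg.continuousOn ⟨h, by rw [hgneg]; linarith⟩
      exact ⟨z, hz⟩
    · obtain ⟨z, -, hz⟩ := hpre.intermediate_value (Set.mem_univ (-1)) (Set.mem_univ 1)
        hg.continuousOn ⟨by rw [hgneg]; linarith, h⟩
      exact ⟨z, hz⟩
  obtain ⟨z, hz⟩ := h0
  exact Circle.neg_ne_self z (hinj (sub_eq_zero.1 hz)).symm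

/-- A continuous injective self-map of the circle is surjective. -/
theorem surjective_of_continuous_injective {f : Circle → Circle} (hf : Continuous f)
    (hinj : Function.Injective f) : Function.Surjective f := by
  by_contra h
  simp only [Function.Surjective, not_forall, not_exists] at h
  obtain ⟨z, hz⟩ := h
  -- rotate the missed point to `-1`, off which the argument is continuous
  refine not_injective_of_continuous
    (f := fun x => Complex.arg ((f x / z * (-1) : Circle) : ℂ)) ?_ ?_
  · refine continuous_iff_continuousAt.2 fun x => ?_
    refine ContinuousAt.comp (g := Complex.arg) (Complex.continuousAt_arg ?_)
      (continuous_subtype_val.comp ((hf.div_const z).mul continuous_const)).continuousAt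
    rw [Complex.mem_slitPlane_iff_arg]
    refine ⟨fun h => hz x ?_, Circle.coe_ne_zero _⟩
    have h1 : (f x / z * (-1) : Circle) = -1 := by
      refine Circle.injective_arg ?_
      simp only [h]
      simp
    have h2 : f x / z = 1 := by simpa using h1
    exact div_eq_one.1 h2
  · intro x y h
    have := Circle.injective_arg h
    exact hinj (by simpa using this)

end Circle

/-! ### Loops in the graph-like quotient -/

section Loop

variable {V : Type u} {G : SimpleGraph V} {Ψ : Set (GraphEnd G)}

/-- The map `γ` on the interval `[s, t]` is a closed curve in the quotient, based at a vertex,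
that traverses every edge in `o` exactly once and no other edges. -/
structure IsLoop (γ : ℝ → GraphLikeQuotient G Ψ) (s t : ℝ) (o : Set G.edgeSet) : Prop where
  lt : s < t
  cont : ContinuousOn γ (Set.Icc s t)
  closed : γ s = γ t
  base : γ s ∈ vertexCls G Ψ
  mem : ∀ u ∈ Set.Icc s t, γ u ∈ edgeCls G Ψ o ∪ vertexCls G Ψ
  surj : edgeCls G Ψ o ⊆ γ '' Set.Icc s t
  inj : ∀ u ∈ Set.Icc s t, ∀ v ∈ Set.Icc s t, γ u ∉ vertexCls G Ψ → γ u = γ v → u = v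

theorem edgePt_notMem_vertexCls {e : G.edgeSet} {t : Set.Ioo (0 : ℝ) 1} :
    cls G Ψ (edgePt Ψ e t) ∉ vertexCls G Ψ :=
  fun h => Set.disjoint_left.1 (disjoint_edgeCls_vertexCls {e}) (cls_edgePt_mem_edgeCls.2 rfl) h

theorem notMem_vertexCls_of_mem_edgeCls {o : Set G.edgeSet} {p : GraphLikeQuotient G Ψ}
    (h : p ∈ edgeCls G Ψ o) : p ∉ vertexCls G Ψ :=
  fun h' => Set.disjoint_left.1 (disjoint_edgeCls_vertexCls o) h h'

/-- A closed curve crosses no bounded cut exactly once. -/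
theorem IsLoop.inter_ne_singleton (F : NormalForest G) {γ : ℝ → GraphLikeQuotient G Ψ} {s t : ℝ}
    {o : Set G.edgeSet} (h : IsLoop γ s t o) {b : Set G.edgeSet} (hb : IsCut G b)
    (hbd : IsPsiBounded G Ψ b) (e : G.edgeSet) : o ∩ b ≠ {e} := by
  intro he
  have heo : e ∈ o := (he.symm ▸ Set.mem_singleton e : e ∈ o ∩ b).1
  have heb : e ∈ b := (he.symm ▸ Set.mem_singleton e : e ∈ o ∩ b).2
  obtain ⟨O, O', hO, hO', hd, hcov, hhalf⟩ := exists_separation_of_cut F hb hbd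
  -- away from the midpoint of `e`, the curve is connected, as its two parts meet at the base
  obtain ⟨u0, hu0, hγ⟩ := h.surj (cls_edgePt_mem_edgeCls.2 heo :
    cls G Ψ (edgePt Ψ e ⟨1 / 2, by norm_num, by norm_num⟩) ∈ _)
  have hv0 : γ u0 ∉ vertexCls G Ψ := by rw [hγ]; exact edgePt_notMem_vertexCls
  have hs : s < u0 := lt_of_le_of_ne hu0.1 (by rintro rfl; exact hv0 h.base)
  have ht : u0 < t := lt_of_le_of_ne hu0.2 (by rintro rfl; exact hv0 (h.closed ▸ h.base))
  let K := γ '' Set.Ico s u0 ∪ γ '' Set.Ioc u0 t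
  have hK : IsPreconnected K := by
    refine IsPreconnected.union (γ s) ⟨s, ⟨le_rfl, hs⟩, rfl⟩ ⟨t, ⟨ht, le_rfl⟩, h.closed.symm⟩ ?_ ?_
    · exact isPreconnected_Ico.image _ (h.cont.mono fun x hx => ⟨hx.1, hx.2.le.trans ht.le⟩)
    · exact isPreconnected_Ioc.image _ (h.cont.mono fun x hx => ⟨hs.le.trans hx.1.le, hx.2⟩)
  have hmemK : ∀ u ∈ Set.Icc s t, u ≠ u0 → γ u ∈ K := by
    intro u hu hne
    rcases lt_or_gt_of_ne hne with h' | h'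
    · exact Or.inl ⟨u, ⟨hu.1, h'⟩, rfl⟩
    · exact Or.inr ⟨u, ⟨h', hu.2⟩, rfl⟩
  have hKmem : ∀ p ∈ K, ∃ u ∈ Set.Icc s t, u ≠ u0 ∧ γ u = p := by
    rintro p (⟨u, hu, rfl⟩ | ⟨u, hu, rfl⟩)
    · exact ⟨u, ⟨hu.1, hu.2.le.trans ht.le⟩, hu.2.ne, rfl⟩
    · exact ⟨u, ⟨hs.le.trans hu.1.le, hu.2⟩, hu.1.ne', rfl⟩
  have hKO : K ⊆ O ∪ O' := by
    intro p hp
    refine (hcov p).resolve_right ?_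
    rintro ⟨e', he', rfl⟩
    obtain ⟨u, hu, hne, hup⟩ := hKmem _ hp
    have hu' := h.mem u hu
    rw [hup] at hu'
    have he'o := cls_edgePt_mem_edgeCls.1 (hu'.resolve_right edgePt_notMem_vertexCls)
    obtain rfl : e' = e := (he ▸ (⟨he'o, he'⟩ : e' ∈ o ∩ b) : e' ∈ ({e} : Set _))
    exact hne (h.inj u0 hu0 u hu hv0 (hγ.trans hup.symm)).symm
  have hmeet : ∀ τ : Set.Ioo (0 : ℝ) 1, (τ : ℝ) ≠ 1 / 2 → cls G Ψ (edgePt Ψ e τ) ∈ K := by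
    intro τ hτ
    obtain ⟨u, hu, hup⟩ := h.surj (cls_edgePt_mem_edgeCls.2 heo :
      cls G Ψ (edgePt Ψ e τ) ∈ _)
    rw [← hup]
    refine hmemK u hu ?_
    rintro rfl
    rw [hγ] at hup
    have := (edgePt_injective (cls_eq_cls_edgePt.1 hup)).2
    rw [← this] at hτ
    exact hτ rfl
  obtain ⟨⟨τ, hτ, hτO⟩, τ', hτ', hτO'⟩ := hhalf e heb
  obtain ⟨p, -, hp, hp'⟩ := hK O O' hO hO' hKO ⟨_, hmeet τ hτ, hτO⟩ ⟨_, hmeet τ' hτ', hτO'⟩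
  exact Set.disjoint_left.1 hd hp hp'

/-- A closed curve inside a loop is a loop again: it traverses every edge completely or not
at all. -/
theorem IsLoop.subloop (F : NormalForest G) {γ : ℝ → GraphLikeQuotient G Ψ} {a b s t : ℝ}
    {o : Set G.edgeSet} (h : IsLoop γ a b o) (has : a ≤ s) (hst : s < t) (htb : t ≤ b)
    (hγ : γ s = γ t) (hv : γ s ∈ vertexCls G Ψ) :
    IsLoop γ s t {e ∈ o | ∃ u ∈ Set.Icc s t, γ u ∈ edgeCls G Ψ {e}} := by
  have := t2Space_quotient (Ψ := Ψ) F
  have hsub : Set.Icc s t ⊆ Set.Icc a b := Set.Icc_subset_Icc has htb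
  refine ⟨hst, h.cont.mono hsub, hγ, hv, fun u hu => ?_, ?_,
    fun u hu v hv => h.inj u (hsub hu) v (hsub hv)⟩
  · refine (h.mem u (hsub hu)).imp_left fun h' => ?_
    obtain ⟨e, he, τ, hτ⟩ := mem_edgeCls.1 h'
    exact mem_edgeCls.2 ⟨e, ⟨he, u, hu, mem_edgeCls.2 ⟨e, rfl, τ, hτ⟩⟩, τ, hτ⟩
  · intro p hp
    obtain ⟨e, ⟨heo, u, hu, hue⟩, τ, rfl⟩ := mem_edgeCls.1 hp
    by_contra hp'
    -- otherwise the parts of `e` traversed inside and outside `[s, t]` disconnect it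
    have hc1 : IsClosed (γ '' Set.Icc s t) :=
      (isCompact_Icc.image_of_continuousOn (h.cont.mono hsub)).isClosed
    have hc2 : IsClosed (γ '' (Set.Icc a s ∪ Set.Icc t b)) := by
      refine ((isCompact_Icc.union isCompact_Icc).image_of_continuousOn (h.cont.mono ?_)).isClosed
      exact Set.union_subset (Set.Icc_subset_Icc le_rfl (hst.le.trans htb))
        (Set.Icc_subset_Icc (has.trans hst.le) le_rfl)
    have hee : edgeCls G Ψ {e} ⊆ γ '' Set.Icc s t ∪ γ '' (Set.Icc a s ∪ Set.Icc t b) := by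
      intro q hq
      obtain ⟨e', rfl, τ', rfl⟩ := mem_edgeCls.1 hq
      obtain ⟨v, hv, hvq⟩ := h.surj (cls_edgePt_mem_edgeCls.2 heo :
        cls G Ψ (edgePt Ψ e' τ') ∈ _)
      rw [← Set.image_union, ← hvq]
      refine ⟨v, ?_, rfl⟩
      rcases le_total v s with h1 | h1
      · exact Or.inr (Or.inl ⟨hv.1, h1⟩)
      · rcases le_total v t with h2 | h2
        · exact Or.inl ⟨h1, h2⟩
        · exact Or.inr (Or.inr ⟨h2, hv.2⟩)
    have hpe : cls G Ψ (edgePt Ψ e τ) ∈ edgeCls G Ψ {e} := cls_edgePt_mem_edgeCls.2 rfl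
    obtain ⟨q, hqe, ⟨v, hv1, rfl⟩, w, hw, hvw⟩ := isPreconnected_closed_iff.1
      (isPreconnected_edgeCls e) _ _ hc1 hc2 hee ⟨_, hue, u, hu, rfl⟩
      ⟨_, hpe, (hee hpe).resolve_left hp'⟩
    have hvv := notMem_vertexCls_of_mem_edgeCls hqe
    have hw' : w ∈ Set.Icc a b := by
      rcases hw with hw | hw
      · exact ⟨hw.1, hw.2.trans (hst.le.trans htb)⟩
      · exact ⟨has.trans (hst.le.trans hw.1), hw.2⟩
    obtain rfl := h.inj v (hsub hv1) w hw' hvv hvw.symm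
    rcases hw with hw | hw
    · obtain rfl := le_antisymm hv1.1 hw.2
      exact hvv hv
    · obtain rfl := le_antisymm hv1.2 hw.1
      exact hvv (hγ ▸ hv)

/-- If no part of a loop between two visits to the same vertex is a proper subloop, then the
loop becomes a circle by contracting the intervals between such visits. The homeomorphism comes
from the measure of the time spent on edges so far. -/
theorem IsLoop.nonempty_homeomorph (F : NormalForest G) {γ : ℝ → GraphLikeQuotient G Ψ}
    {o : Set G.edgeSet} (h : IsLoop γ 0 1 o) (hne : o.Nonempty)
    (hsub : ∀ s t, 0 ≤ s → s < t → t ≤ 1 → γ s = γ t → γ s ∈ vertexCls G Ψ →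
      (∀ u ∈ Set.Icc s t, γ u ∉ edgeCls G Ψ o) ∨
        ∀ u ∈ Set.Icc (0 : ℝ) 1, γ u ∈ edgeCls G Ψ o → u ∈ Set.Icc s t) :
    Nonempty (closure (edgeCls G Ψ o) ≃ₜ Circle) := by
  have := t2Space_quotient (Ψ := Ψ) F
  let U : Set ℝ := Set.Ioo 0 1 ∩ γ ⁻¹' edgeCls G Ψ o
  have hUI : U ⊆ Set.Icc 0 1 := fun u hu => ⟨hu.1.1.le, hu.1.2.le⟩
  have hUopen : IsOpen U := (h.cont.mono Set.Ioo_subset_Icc_self).isOpen_inter_preimage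
    isOpen_Ioo (isOpen_edgeCls o)
  have hmemU : ∀ u ∈ Set.Icc (0 : ℝ) 1, γ u ∉ vertexCls G Ψ → u ∈ U := by
    intro u hu hv
    refine ⟨⟨lt_of_le_of_ne hu.1 ?_, lt_of_le_of_ne hu.2 ?_⟩, (h.mem u hu).resolve_right hv⟩
    · rintro rfl; exact hv h.base
    · rintro rfl; exact hv (h.closed ▸ h.base)
  have hUv : ∀ u ∈ U, γ u ∉ vertexCls G Ψ := fun u hu => notMem_vertexCls_of_mem_edgeCls hu.2
  have hUne : U.Nonempty := by
    obtain ⟨e, he⟩ := hne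
    obtain ⟨u, hu, hue⟩ := h.surj (cls_edgePt_mem_edgeCls.2 he :
      cls G Ψ (edgePt Ψ e ⟨1 / 2, by norm_num, by norm_num⟩) ∈ _)
    exact ⟨u, hmemU u hu (by rw [hue]; exact edgePt_notMem_vertexCls)⟩
  have hfin : MeasureTheory.volume U ≠ ⊤ :=
    ((MeasureTheory.measure_mono hUI).trans_lt (by simp)).ne
  have hfin' : ∀ x, MeasureTheory.volume (U ∩ Set.Iic x) ≠ ⊤ := fun x =>
    ((MeasureTheory.measure_mono Set.inter_subset_left).trans_lt hfin.lt_top).ne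
  set c := MeasureTheory.volume.real U with hc
  have hcpos : 0 < c := ENNReal.toReal_pos (hUopen.measure_pos _ hUne).ne' hfin
  let f : ℝ → ℝ := fun x => MeasureTheory.volume.real (U ∩ Set.Iic x) / c
  have hsplit : ∀ {x y}, x ≤ y → MeasureTheory.volume.real (U ∩ Set.Iic y) =
      MeasureTheory.volume.real (U ∩ Set.Iic x) + MeasureTheory.volume.real (U ∩ Set.Ioc x y) := by
    intro x y hxy
    rw [← MeasureTheory.measureReal_union ?_ (hUopen.measurableSet.inter measurableSet_Ioc)
      (hfin' x)
      ((MeasureTheory.measure_mono Set.inter_subset_left).trans_lt hfin.lt_top).ne,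
      ← Set.inter_union_distrib_left, Set.Iic_union_Ioc_eq_Iic hxy]
    exact (Set.Iic_disjoint_Ioc le_rfl).mono Set.inter_subset_right Set.inter_subset_right
  have hfmono : Monotone f := fun x y hxy =>
    div_le_div_of_nonneg_right (by rw [hsplit hxy]; linarith [
      MeasureTheory.measureReal_nonneg (μ := MeasureTheory.volume) (s := U ∩ Set.Ioc x y)]) hcpos.le
  have hfcont : Continuous f := by
    refine Continuous.div_const ?_ c
    refine LipschitzWith.continuous (K := 1) (LipschitzWith.of_le_add fun x y => ?_)
    rcases le_total x y with hxy | hxy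
    · have := hsplit hxy
      have := MeasureTheory.measureReal_nonneg (μ := MeasureTheory.volume) (s := U ∩ Set.Ioc x y)
      have := dist_nonneg (x := x) (y := y)
      linarith
    · rw [hsplit hxy, Real.dist_eq, abs_of_nonneg (by linarith)]
      have h1 : MeasureTheory.volume.real (U ∩ Set.Ioc y x) ≤
          MeasureTheory.volume.real (Set.Ioc y x) :=
        MeasureTheory.measureReal_mono Set.inter_subset_right (by simp)
      rw [Real.volume_real_Ioc_of_le hxy] at h1
      linarith
  have hf0 : f 0 = 0 := by
    have : U ∩ Set.Iic 0 = ∅ := by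
      ext u; simp only [Set.mem_inter_iff, Set.mem_Iic, Set.mem_empty_iff_false, iff_false]
      exact fun hu => absurd hu.1.1.1 hu.2.not_gt
    simp [f, this]
  have hf1 : f 1 = 1 := by
    have : U ∩ Set.Iic 1 = U := Set.inter_eq_left.2 fun u hu => hu.1.2.le
    simp only [f, this]
    exact div_self hcpos.ne'
  have hfI : ∀ u ∈ Set.Icc (0 : ℝ) 1, f u ∈ Set.Icc (0 : ℝ) 1 := fun u hu =>
    ⟨hf0 ▸ hfmono hu.1, hf1 ▸ hfmono hu.2⟩
  -- `f` is constant exactly on the intervals without edge points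
  have hfeq : ∀ {s t}, s < t → f s = f t → ∀ u ∈ Set.Ioo s t, u ∉ U := by
    intro s t hst hf u hu huU
    have h1 : MeasureTheory.volume.real (U ∩ Set.Ioc s t) = 0 := by
      have h2 := (div_left_inj' hcpos.ne').1 hf
      rw [hsplit hst.le] at h2
      linarith
    have h3 : 0 < MeasureTheory.volume (U ∩ Set.Ioo s t) :=
      (hUopen.inter isOpen_Ioo).measure_pos _ ⟨u, huU, hu⟩
    have h4 : MeasureTheory.volume (U ∩ Set.Ioc s t) ≠ ⊤ :=
      ((MeasureTheory.measure_mono Set.inter_subset_left).trans_lt hfin.lt_top).ne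
    have h5 : MeasureTheory.volume (U ∩ Set.Ioc s t) = 0 :=
      ((ENNReal.toReal_eq_zero_iff _).1 h1).resolve_right h4
    refine h3.ne' (le_antisymm ?_ (zero_le))
    rw [← h5]
    exact MeasureTheory.measure_mono (Set.inter_subset_inter_right _ Set.Ioo_subset_Ioc_self)
  have hγ_of_f : ∀ {s t}, 0 ≤ s → s ≤ t → t ≤ 1 → f s = f t → γ s = γ t := by
    intro s t hs hst ht hf
    rcases hst.eq_or_lt with rfl | hst'
    · rfl
    have hsubI : Set.Icc s t ⊆ Set.Icc 0 1 := Set.Icc_subset_Icc hs ht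
    refine eq_of_isPreconnected (isPreconnected_Icc.image _ (h.cont.mono hsubI)) ?_
      ⟨s, ⟨le_rfl, hst⟩, rfl⟩ ⟨t, ⟨hst, le_rfl⟩, rfl⟩
    rintro _ ⟨u, hu, rfl⟩
    by_contra hv
    have huU := hmemU u (hsubI hu) hv
    rw [← closure_Ioo hst'.ne] at hu
    obtain ⟨w, hwU, hw⟩ := mem_closure_iff.1 hu U hUopen huU
    exact hfeq hst' hf w hw hwU
  have hf_of_γ : ∀ {s t}, 0 ≤ s → s < t → t ≤ 1 → γ s = γ t → f s = f t ∨ (f s = 0 ∧ f t = 1) := by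
    intro s t hs hst ht hγ
    have hsI : s ∈ Set.Icc (0 : ℝ) 1 := ⟨hs, hst.le.trans ht⟩
    have htI : t ∈ Set.Icc (0 : ℝ) 1 := ⟨hs.trans hst.le, ht⟩
    have hv : γ s ∈ vertexCls G Ψ := by
      by_contra hv
      exact hst.ne (h.inj s hsI t htI hv hγ)
    rcases hsub s t hs hst ht hγ hv with h1 | h1
    · left
      have h2 : U ∩ Set.Ioc s t = ∅ := by
        ext u; simp only [Set.mem_inter_iff, Set.mem_empty_iff_false, iff_false]
        exact fun hu => h1 u ⟨hu.2.1.le, hu.2.2⟩ hu.1.2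
      simp only [f]
      rw [hsplit hst.le, h2]
      simp
    · right
      have h2 : U ∩ Set.Iic s = ∅ := by
        ext u; simp only [Set.mem_inter_iff, Set.mem_Iic, Set.mem_empty_iff_false, iff_false]
        rintro ⟨hu, hus⟩
        obtain rfl := le_antisymm hus (h1 u (hUI hu) hu.2).1
        exact hUv _ hu hv
      have h3 : U ∩ Set.Iic t = U := Set.inter_eq_left.2 fun u hu => (h1 u (hUI hu) hu.2).2
      simp only [f, h2, h3]
      exact ⟨by simp, div_self hcpos.ne'⟩
  have hker : ∀ s ∈ Set.Icc (0 : ℝ) 1, ∀ t ∈ Set.Icc (0 : ℝ) 1,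
      (γ s = γ t ↔ (f s : UnitAddCircle) = (f t : UnitAddCircle)) := by
    have key : ∀ s ∈ Set.Icc (0 : ℝ) 1, ∀ t ∈ Set.Icc (0 : ℝ) 1, s ≤ t →
        (γ s = γ t ↔ (f s : UnitAddCircle) = (f t : UnitAddCircle)) := by
      intro s hs t ht hst
      rw [coe_unitAddCircle_eq_iff (hfI s hs) (hfI t ht)]
      constructor
      · intro hγ
        rcases hst.eq_or_lt with rfl | hst'
        · exact Or.inl rfl
        · exact (hf_of_γ hs.1 hst' ht.2 hγ).imp_right Or.inl
      · rintro (h1 | ⟨h1, h2⟩ | ⟨h1, h2⟩)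
        · exact hγ_of_f hs.1 hst ht.2 h1
        · rw [← hγ_of_f le_rfl hs.1 hs.2 (hf0.trans h1.symm), h.closed]
          exact (hγ_of_f ht.1 ht.2 le_rfl (h2.trans hf1.symm)).symm
        · have := hfmono hst
          linarith
    intro s hs t ht
    rcases le_total s t with hst | hst
    · exact key s hs t ht hst
    · rw [eq_comm, key t ht s hs hst, eq_comm]
  -- the edge points are dense in the image
  have hdense : ∀ u ∈ Set.Icc (0 : ℝ) 1, f u < 1 → γ u ∈ closure (edgeCls G Ψ o) := by
    intro u hu hfu
    have hS : IsCompact (Set.Icc (0 : ℝ) 1 ∩ f ⁻¹' {f u}) :=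
      isCompact_Icc.inter_right (isClosed_singleton.preimage hfcont)
    obtain ⟨m, ⟨hm, hfm⟩, hmax⟩ := hS.exists_isGreatest ⟨u, hu, rfl⟩
    have hfm : f m = f u := hfm
    have hm1 : m < 1 := lt_of_le_of_ne hm.2 (by rintro rfl; linarith)
    have hγm : γ u = γ m := hγ_of_f hu.1 (hmax ⟨hu, rfl⟩) hm.2 hfm.symm
    have hmU : m ∈ closure U := by
      refine Metric.mem_closure_iff.2 fun ε hε => ?_
      set t := min (m + ε / 2) 1 with ht
      have hmt : m < t := lt_min (by linarith) hm1
      have hft : f m ≠ f t := by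
        intro hft
        have : t ≤ m := hmax ⟨⟨hm.1.trans hmt.le, min_le_right _ _⟩, hft.symm.trans hfm⟩
        linarith
      by_contra! hcon
      refine hft ?_
      have h2 : U ∩ Set.Ioc m t = ∅ := by
        ext w; simp only [Set.mem_inter_iff, Set.mem_empty_iff_false, iff_false]
        rintro ⟨hwU, hw⟩
        have h3 := hcon w hwU
        rw [dist_comm, Real.dist_eq, abs_of_pos (by linarith [hw.1])] at h3
        have h4 : w ≤ m + ε / 2 := hw.2.trans (min_le_left _ _)
        linarith
      simp only [f]
      rw [hsplit hmt.le, h2]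
      simp
    rw [hγm]
    exact closure_mono (Set.image_subset_iff.2 fun w hw => hw.2)
      (((h.cont m hm).mono hUI).mem_closure_image hmU)
  have hclosure : closure (edgeCls G Ψ o) = γ '' Set.Icc 0 1 := by
    refine Set.Subset.antisymm
      (closure_minimal h.surj (isCompact_Icc.image_of_continuousOn h.cont).isClosed) ?_
    rintro _ ⟨u, hu, rfl⟩
    rcases (hfI u hu).2.lt_or_eq with h1 | h1
    · exact hdense u hu h1
    · rw [hγ_of_f hu.1 hu.2 le_rfl (h1.trans hf1.symm), ← h.closed]
      exact hdense 0 ⟨le_rfl, zero_le_one⟩ (by rw [hf0]; exact one_pos)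
  rw [hclosure]
  have : Fact ((0 : ℝ) < 1) := ⟨one_pos⟩
  obtain ⟨φ⟩ : Nonempty ((γ '' Set.Icc 0 1 : Set (GraphLikeQuotient G Ψ)) ≃ₜ UnitAddCircle) := by
    refine nonempty_homeomorph_of_same_fibers (X := Set.Icc (0 : ℝ) 1)
      (p := fun u => ⟨γ u, u, u.2, rfl⟩) (q := fun u => ((f u : ℝ) : UnitAddCircle))
      (h.cont.domRestrict.subtype_mk _)
      ((AddCircle.continuous_mk' 1).comp (hfcont.comp continuous_subtype_val)) ?_ ?_ ?_
    · rintro ⟨_, u, hu, rfl⟩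
      exact ⟨⟨u, hu⟩, rfl⟩
    · intro z
      obtain ⟨x, hx, rfl⟩ := exists_coe_unitAddCircle_eq z
      obtain ⟨u, hu, hux⟩ := intermediate_value_Icc zero_le_one hfcont.continuousOn
        (show x ∈ Set.Icc (f 0) (f 1) by rw [hf0, hf1]; exact ⟨hx.1, hx.2.le⟩)
      exact ⟨⟨u, hu⟩, congrArg _ hux⟩
    · intro s t
      exact Subtype.ext_iff.trans (hker s s.2 t t.2)
  exact ⟨φ.trans (AddCircle.homeomorphCircle one_ne_zero)⟩

/-- A map of the circle that meets every point of an edge of `o` once, and no points of other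
edges, can be written as a loop. -/
theorem exists_isLoop {o : Set G.edgeSet} {ψ : Circle → GraphLikeQuotient G Ψ} (hψ : Continuous ψ)
    (hbase : ∃ z, ψ z ∈ vertexCls G Ψ) (hmem : ∀ z, ψ z ∈ edgeCls G Ψ o ∪ vertexCls G Ψ)
    (hsurj : edgeCls G Ψ o ⊆ Set.range ψ)
    (hinj : ∀ z z', ψ z ∉ vertexCls G Ψ → ψ z = ψ z' → z = z') :
    ∃ γ : ℝ → GraphLikeQuotient G Ψ, IsLoop γ 0 1 o := by
  obtain ⟨z0, hz0⟩ := hbase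
  have : Fact ((0 : ℝ) < 1) := ⟨one_pos⟩
  let φ : UnitAddCircle ≃ₜ Circle := AddCircle.homeomorphCircle one_ne_zero
  let γ : ℝ → GraphLikeQuotient G Ψ := fun t => ψ (φ ((t : UnitAddCircle) + φ.symm z0))
  have hγ0 : γ 0 = ψ z0 := by simp [γ]
  have hγ1 : γ 0 = γ 1 := by
    simp only [γ, AddCircle.coe_period]
    rfl
  refine ⟨γ, one_pos, ?_, hγ1, by rwa [hγ0], fun u _ => hmem _, fun p hp => ?_,
    fun u hu v hv h h' => ?_⟩
  · exact (hψ.comp (φ.continuous.comp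
      ((AddCircle.continuous_mk' 1).add continuous_const))).continuousOn
  · obtain ⟨z, rfl⟩ := hsurj hp
    obtain ⟨x, hx, hxz⟩ := exists_coe_unitAddCircle_eq (φ.symm z - φ.symm z0)
    exact ⟨x, ⟨hx.1, hx.2.le⟩, by simp [γ, hxz]⟩
  · have h1 := add_right_cancel (φ.injective (hinj _ _ h h'))
    rcases (coe_unitAddCircle_eq_iff hu hv).1 h1 with h2 | ⟨rfl, -⟩ | ⟨rfl, -⟩
    · exact h2
    · exact absurd (hγ0 ▸ hz0) h
    · exact absurd (hγ1 ▸ hγ0 ▸ hz0) h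

end Loop

/-! ### The tree of a normal forest with one root -/

namespace NormalForest

variable {V : Type u} {G : SimpleGraph V} (F : NormalForest G)

/-- The graph whose edges join the vertices to their parents. -/
def tree : SimpleGraph V where
  Adj x y := F.par y = some x ∨ F.par x = some y
  symm := ⟨fun _ _ h => h.symm⟩
  loopless := ⟨fun x h => F.wf.irrefl.irrefl x (h.elim id id)⟩

variable {F}

theorem eq_of_tree_adj {x y v : V} (h : F.tree.Adj x y) (hx : x ∈ F.up v) (hy : y ∉ F.up v) :
    x = v ∧ F.par v = some y := by
  rcases h with h | h
  · exact absurd (le_trans hx (le_of_par h)) hy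
  · rcases le_iff.1 (show F.le v x from hx) with rfl | ⟨p, hp, hvp⟩
    · exact ⟨rfl, h⟩
    · rw [h] at hp
      obtain rfl := Option.some_injective _ hp
      exact absurd hvp hy

theorem mem_support_of_le {r x y : V} (hr : F.le r x) (hxy : F.le x y) (p : F.tree.Walk r y) :
    x ∈ p.support := by
  by_cases hrx : r ∈ F.up x
  · rw [le_antisymm (show F.le x r from hrx) hr]
    exact p.start_mem_support
  clear hr
  induction p with
  | nil => exact absurd hxy hrx
  | @cons a b c hab q ih =>
    rw [SimpleGraph.Walk.support_cons]
    refine List.mem_cons_of_mem _ ?_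
    by_cases hb : b ∈ F.up x
    · rw [← (eq_of_tree_adj hab.symm hb hrx).1]
      exact q.start_mem_support
    · exact ih hxy hb

theorem isAcyclic_tree : F.tree.IsAcyclic := by
  rw [SimpleGraph.isAcyclic_iff_forall_adj_isBridge]
  have key : ∀ c p, F.par c = some p → F.tree.IsBridge s(c, p) := by
    intro c p hc
    rw [SimpleGraph.isBridge_iff]
    rintro ⟨w⟩
    have hp : p ∉ F.up c := fun h => by
      have h1 := F.adj hc
      rw [le_antisymm (le_of_par hc) h] at h1
      exact h1.ne rfl
    have hw : ∀ {x y}, (F.tree.deleteEdges {s(c, p)}).Walk x y → x ∈ F.up c → y ∈ F.up c := by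
      intro x y w hx
      induction w with
      | nil => exact hx
      | @cons a b d hab q ih =>
        refine ih ?_
        by_contra hb
        rw [SimpleGraph.deleteEdges_adj] at hab
        obtain ⟨rfl, h2⟩ := eq_of_tree_adj hab.1 hx hb
        rw [hc] at h2
        obtain rfl := Option.some_injective _ h2
        exact hab.2 rfl
    exact hp (hw w (mem_up_self c))
  rintro x y (h | h)
  · rw [Sym2.eq_swap]
    exact key y x h
  · exact key x y h

theorem isNormalSpanningTree {r : V} (hr : ∀ v, F.le r v) : IsNormalSpanningTree G F.tree r := by
  refine ⟨?_, ⟨?_, isAcyclic_tree⟩, fun x y h => ?_⟩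
  · rintro x y (h | h)
    · exact F.adj h
    · exact (F.adj h).symm
  · have hreach : ∀ v, F.tree.Reachable r v := by
      intro v
      induction (show Relation.ReflTransGen (fun p c => F.par c = some p) r v from hr v) with
      | refl => exact .refl _
      | @tail p c _ hc ih => exact ih.trans (SimpleGraph.Adj.reachable (Or.inl hc))
    have : Nonempty V := ⟨r⟩
    exact ⟨fun x y => (hreach x).symm.trans (hreach y)⟩
  · exact (F.comp h).imp (fun h p _ => mem_support_of_le (hr x) h p)
      (fun h p _ => mem_support_of_le (hr y) h p)

theorem exists_root (v : V) : ∃ r, F.par r = none ∧ F.le r v := by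
  refine par_induction (F := F) (P := fun v => ∃ r, F.par r = none ∧ F.le r v) (fun c ih => ?_) v
  rcases hc : F.par c with _ | p
  · exact ⟨c, hc, le_refl c⟩
  · obtain ⟨r, hr, hrp⟩ := ih p hc
    exact ⟨r, hr, le_trans hrp (le_of_par hc)⟩

theorem eq_of_le_root {r x : V} (hr : F.par r = none) (h : F.le x r) : x = r := by
  rcases le_iff.1 h with rfl | ⟨p, hp, -⟩
  · rfl
  · rw [hr] at hp; exact absurd hp (by simp)

/-- Comparable vertices lie in the same tree of the forest. -/
theorem root_unique_of_le {r r' x y : V} (hr : F.par r = none) (hr' : F.par r' = none)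
    (hrx : F.le r x) (hry : F.le r' y) (hxy : F.le x y) : r = r' := by
  rcases le_total_of_le (le_trans hrx hxy) hry with h | h
  · exact eq_of_le_root hr' h
  · exact (eq_of_le_root hr h).symm

theorem root_unique_of_reachable {r r' x y : V} (hr : F.par r = none) (hr' : F.par r' = none)
    (hrx : F.le r x) (hry : F.le r' y) (hxy : G.Reachable x y) : r = r' := by
  obtain ⟨p⟩ := hxy
  induction p generalizing r with
  | nil => exact root_unique_of_le hr hr' hrx hry (le_refl _)
  | @cons a b c hab q ih =>
    obtain ⟨s, hs, hsb⟩ := exists_root (F := F) b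
    rw [← ih hs hsb hry]
    rcases F.comp hab with h | h
    · exact root_unique_of_le hr hs hrx hsb h
    · exact (root_unique_of_le hs hr hsb hrx h).symm

end NormalForest

/-! ### Expanding the vertices into rays -/

section Expansion

variable {V : Type u} {G : SimpleGraph V} (F : NormalForest G) (ι : V ↪ ℕ)

/-- The parent function of the expanded tree on `Option V × ℕ`. Every vertex `v` becomes the ray
`(v, 0), (v, 1), …`, and the ray of a child `c` of `v` is attached to it at `(v, ι c)`. The extra
ray at `none` joins the trees of the forest. -/
def expPar : Option V × ℕ → Option (Option V × ℕ)
  | (x, n + 1) => some (x, n)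
  | (none, 0) => none
  | (some v, 0) => some (F.par v, ι v)

/-- An edge of `G` between `u` and a descendant `w` becomes the edge between `(w, 0)` and that
vertex on the ray of `u` to which the child of `u` below `w` is attached. -/
def expCross (a b : Option V × ℕ) : Prop :=
  ∃ u c w, F.par c = some u ∧ F.le c w ∧ G.Adj u w ∧ a = (some u, ι c) ∧ b = (some w, 0)

theorem exp_wf : WellFounded fun p c => expPar F ι c = some p := by
  have hstep : ∀ x, Acc (fun p c => expPar F ι c = some p) (x, 0) →
      ∀ n, Acc (fun p c => expPar F ι c = some p) (x, n) := by
    intro x h0 n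
    induction n with
    | zero => exact h0
    | succ n ih =>
      refine ⟨_, fun p hp => ?_⟩
      obtain rfl : (x, n) = p := Option.some_injective _ hp
      exact ih
  have hnone := hstep none ⟨_, fun p (hp : none = some p) => by cases hp⟩
  refine ⟨?_⟩
  rintro ⟨_ | v, n⟩
  · exact hnone n
  · refine NormalForest.par_induction (F := F)
      (P := fun v => ∀ n, Acc (fun p c => expPar F ι c = some p) (some v, n)) (fun c ih => ?_) v n
    refine hstep (some c) ⟨_, fun p hp => ?_⟩
    obtain rfl : (F.par c, ι c) = p := Option.some_injective _ hp
    rcases hc : F.par c with _ | q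
    · exact hnone _
    · exact ih q hc _

/-- The order of the expanded tree, before its graph is defined. -/
abbrev expLE (a b : Option V × ℕ) : Prop :=
  Relation.ReflTransGen (fun p c => expPar F ι c = some p) a b

variable {F ι}

theorem expLE_ray (x : Option V) {m n : ℕ} (h : m ≤ n) : expLE F ι (x, m) (x, n) := by
  induction n, h using Nat.le_induction with
  | base => exact .refl
  | succ n hn ih => exact ih.tail rfl

theorem expLE_of_par {p c : V} (h : F.par c = some p) :
    expLE F ι (some p, ι c) (some c, 0) := .single (by simp [expPar, h])

theorem expLE_of_le {v w : V} (h : F.le v w) : expLE F ι (some v, 0) (some w, 0) := by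
  induction (show Relation.ReflTransGen (fun p c => F.par c = some p) v w from h) with
  | refl => exact .refl
  | @tail p c _ hc ih =>
    exact (ih ‹_›).trans ((expLE_ray _ (Nat.zero_le _)).trans (expLE_of_par hc))

theorem le_of_expLE {v : V} {b : Option V × ℕ} (h : expLE F ι (some v, 0) b) :
    ∃ w, b.1 = some w ∧ F.le v w := by
  induction h with
  | refl => exact ⟨v, rfl, NormalForest.le_refl v⟩
  | @tail p c _ hc ih =>
    obtain ⟨w, hw, hvw⟩ := ih
    rcases c with ⟨_ | c, _ | n⟩
    · cases hc
    · obtain rfl : (none, n) = p := Option.some_injective _ hc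
      cases hw
    · obtain rfl : (F.par c, ι c) = p := Option.some_injective _ hc
      exact ⟨c, rfl, NormalForest.le_trans hvw (NormalForest.le_of_par hw)⟩
    · obtain rfl : (some c, n) = p := Option.some_injective _ hc
      exact ⟨w, hw, hvw⟩

theorem expLE_iff {v w : V} {n : ℕ} : expLE F ι (some v, 0) (some w, n) ↔ F.le v w := by
  constructor
  · intro h
    obtain ⟨w', hw', h'⟩ := le_of_expLE h
    obtain rfl := Option.some_injective _ hw'
    exact h'
  · exact fun h => (expLE_of_le h).trans (expLE_ray _ (Nat.zero_le _))

theorem expCross.expLE {a b : Option V × ℕ} (h : expCross F ι a b) : expLE F ι a b := by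
  obtain ⟨u, c, w, hc, hcw, -, rfl, rfl⟩ := h
  exact (expLE_of_par hc).trans (expLE_of_le hcw)

theorem expCross.ne {a b : Option V × ℕ} (h : expCross F ι a b) : a ≠ b := by
  obtain ⟨u, c, w, -, -, h, rfl, rfl⟩ := h
  intro h'
  rw [Prod.mk.injEq, Option.some.injEq] at h'
  exact h.ne h'.1

variable (F ι)

/-- The expanded graph. -/
def expGraph : SimpleGraph (Option V × ℕ) where
  Adj a b := (expPar F ι b = some a ∨ expCross F ι a b) ∨ (expPar F ι a = some b ∨ expCross F ι b a)
  symm := ⟨fun _ _ h => h.symm⟩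
  loopless := ⟨fun a h => by
    have h1 : ¬ expPar F ι a = some a := (exp_wf F ι).irrefl.irrefl a
    have h2 : ¬ expCross F ι a a := fun h => h.ne rfl
    tauto⟩

/-- The normal spanning tree of the expanded graph. -/
def expForest : NormalForest (expGraph F ι) where
  par := expPar F ι
  wf := exp_wf F ι
  adj h := Or.inl (Or.inl h)
  comp h := h.imp (fun h => h.elim (fun h => .single h) expCross.expLE)
    (fun h => h.elim (fun h => .single h) expCross.expLE)

theorem forest_le_iff {v w : V} {n : ℕ} :
    (expForest F ι).le (some v, 0) (some w, n) ↔ F.le v w := expLE_iff (ι := ι)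

theorem forest_le_of_le {v w : V} (h : F.le v w) :
    (expForest F ι).le (some v, 0) (some w, 0) := expLE_of_le (ι := ι) h

theorem exists_of_mem_up {v : V} {a : Option V × ℕ} (h : a ∈ (expForest F ι).up (some v, 0)) :
    ∃ w, a.1 = some w ∧ F.le v w := le_of_expLE (ι := ι) h

theorem expForest_le_root (a : Option V × ℕ) : (expForest F ι).le (none, 0) a := by
  obtain ⟨r, hr, h⟩ := (expForest F ι).exists_root a
  replace hr : expPar F ι r = none := hr
  rcases r with ⟨_ | v, _ | n⟩
  · exact h
  all_goals cases hr

theorem expTree_locallyFinite (a : Option V × ℕ) :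
    ((expForest F ι).tree.neighborSet a).Finite := by
  have h1 : {b | expPar F ι a = some b}.Finite := by
    refine Set.Subsingleton.finite fun b hb b' hb' => ?_
    exact Option.some_injective _ (Eq.trans (Eq.symm hb) hb')
  have h2 : {b | expPar F ι b = some a}.Finite := by
    have h3 : {v : V | ι v = a.2}.Finite := Set.Subsingleton.finite fun v hv w hw =>
      ι.injective (Eq.trans hv (Eq.symm hw))
    refine (((h3.image fun v => ((some v, 0) : Option V × ℕ)).insert (a.1, a.2 + 1))).subset ?_
    rintro ⟨_ | v, _ | n⟩ hb
    · cases hb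
    · obtain rfl : (none, n) = a := Option.some_injective _ hb
      exact Or.inl rfl
    · obtain rfl : (F.par v, ι v) = a := Option.some_injective _ hb
      exact Or.inr ⟨v, rfl, rfl⟩
    · obtain rfl : (some v, n) = a := Option.some_injective _ hb
      exact Or.inl rfl
  exact (h1.union h2).subset fun b hb =>
    (Or.symm hb : expPar F ι a = some b ∨ expPar F ι b = some a)

/-! #### Edges of the expansion -/

variable {F}

theorem exists_child_of_lt {u w : V} (h : F.le u w) (hne : u ≠ w) :
    ∃ c, F.par c = some u ∧ F.le c w := by
  rcases Relation.ReflTransGen.cases_head h with h | ⟨c, hc, hcw⟩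
  · exact absurd h hne
  · exact ⟨c, hc, hcw⟩

theorem exists_expCross (e : G.edgeSet) : ∃ u c w, F.par c = some u ∧ F.le c w ∧ G.Adj u w ∧
    (e : Sym2 V) = s(u, w) := by
  have h := adj_edge e
  rcases F.comp h with h' | h'
  · obtain ⟨c, h1, h2⟩ := exists_child_of_lt h' h.ne
    exact ⟨_, c, _, h1, h2, h, edge_eq e⟩
  · obtain ⟨c, h1, h2⟩ := exists_child_of_lt h' h.ne'
    exact ⟨_, c, _, h1, h2, h.symm, by rw [edge_eq e, Sym2.eq_swap]⟩

variable (F)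

/-- The edge of the expanded graph corresponding to an edge of `G`. -/
noncomputable def expEdge (e : G.edgeSet) : (expGraph F ι).edgeSet :=
  ⟨s((some (exists_expCross (F := F) e).choose, ι (exists_expCross (F := F) e).choose_spec.choose),
    (some (exists_expCross (F := F) e).choose_spec.choose_spec.choose, 0)),
    Or.inl (Or.inr ⟨_, _, _, (exists_expCross (F := F) e).choose_spec.choose_spec.choose_spec.1,
      (exists_expCross (F := F) e).choose_spec.choose_spec.choose_spec.2.1,
      (exists_expCross (F := F) e).choose_spec.choose_spec.choose_spec.2.2.1, rfl, rfl⟩)⟩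

theorem expEdge_spec (e : G.edgeSet) : ∃ u c w, F.par c = some u ∧ F.le c w ∧ G.Adj u w ∧
    (e : Sym2 V) = s(u, w) ∧
    (expEdge F ι e : Sym2 (Option V × ℕ)) = s((some u, ι c), (some w, 0)) :=
  ⟨_, _, _, (exists_expCross (F := F) e).choose_spec.choose_spec.choose_spec.1,
      (exists_expCross (F := F) e).choose_spec.choose_spec.choose_spec.2.1,
      (exists_expCross (F := F) e).choose_spec.choose_spec.choose_spec.2.2.1,
      (exists_expCross (F := F) e).choose_spec.choose_spec.choose_spec.2.2.2, rfl⟩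

theorem map_expEdge (e : G.edgeSet) :
    Sym2.map Prod.fst (expEdge F ι e : Sym2 (Option V × ℕ)) = Sym2.map some (e : Sym2 V) := by
  obtain ⟨u, c, w, -, -, -, h1, h2⟩ := expEdge_spec F ι e
  rw [h1, h2, Sym2.map_mk, Sym2.map_mk]

theorem expEdge_injective : Function.Injective (expEdge F ι) := by
  intro e e' h
  have h1 := map_expEdge F ι e
  rw [h, map_expEdge] at h1
  exact Subtype.ext (Sym2.map.injective (Option.some_injective _) h1.symm)

theorem fst_of_mem_expEdge {e : G.edgeSet} {a : Option V × ℕ}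
    (h : a ∈ (expEdge F ι e : Sym2 (Option V × ℕ))) : ∃ x ∈ (e : Sym2 V), a.1 = some x := by
  have : a.1 ∈ Sym2.map Prod.fst (expEdge F ι e : Sym2 (Option V × ℕ)) :=
    Sym2.mem_map.2 ⟨a, h, rfl⟩
  rw [map_expEdge] at this
  obtain ⟨x, hx, h⟩ := Sym2.mem_map.1 this
  exact ⟨x, hx, h.symm⟩

theorem exists_mem_expEdge {e : G.edgeSet} {x : V} (h : x ∈ (e : Sym2 V)) :
    ∃ n, (some x, n) ∈ (expEdge F ι e : Sym2 (Option V × ℕ)) := by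
  have : some x ∈ Sym2.map some (e : Sym2 V) := Sym2.mem_map.2 ⟨x, h, rfl⟩
  rw [← map_expEdge F ι] at this
  obtain ⟨⟨y, n⟩, ha, h⟩ := Sym2.mem_map.1 this
  obtain rfl : y = some x := h
  exact ⟨n, ha⟩

theorem mem_range_of_expCross {e : (expGraph F ι).edgeSet} {a b : Option V × ℕ}
    (h : expCross F ι a b) (he : (e : Sym2 (Option V × ℕ)) = s(a, b)) :
    e ∈ Set.range (expEdge F ι) := by
  obtain ⟨u, c, w, hc, hcw, huw, rfl, rfl⟩ := h
  refine ⟨⟨s(u, w), huw⟩, Subtype.ext ?_⟩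
  obtain ⟨u', c', w', hc', hcw', huw', h1, h2⟩ := expEdge_spec F ι ⟨s(u, w), huw⟩
  rw [h2, he]
  have huw_le := NormalForest.le_trans (NormalForest.le_of_par hc) hcw
  have huw_le' := NormalForest.le_trans (NormalForest.le_of_par hc') hcw'
  rcases Sym2.eq_iff.1 h1 with ⟨rfl, rfl⟩ | ⟨rfl, rfl⟩
  · suffices h : c = c' by rw [h]
    have hlt : ∀ {c c'}, F.par c = some u → F.par c' = some u → F.le c c' → c = c' := by
      intro c c' h h' hle
      rcases NormalForest.le_iff.1 hle with h1 | ⟨p, hp, h1⟩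
      · exact h1
      · rw [h'] at hp
        obtain rfl := Option.some_injective _ hp
        have h2 := F.adj h
        rw [NormalForest.le_antisymm h1 (NormalForest.le_of_par h)] at h2
        exact absurd rfl h2.ne
    rcases NormalForest.le_total_of_le hcw hcw' with h | h
    · exact hlt hc hc' h
    · exact (hlt hc' hc h).symm
  · exact absurd (NormalForest.le_antisymm huw_le huw_le') huw.ne

/-- The edges of the expanded graph that do not come from `G` lie on the rays replacing the
vertices, or attach the root of a tree to the extra ray. -/
theorem contracted_cases {e : (expGraph F ι).edgeSet} (he : e ∉ Set.range (expEdge F ι)) :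
    (∃ x n, (e : Sym2 (Option V × ℕ)) = s((x, n), (x, n + 1))) ∨
      ∃ v, F.par v = none ∧ (e : Sym2 (Option V × ℕ)) = s((none, ι v), (some v, 0)) := by
  have key : ∀ a b, expPar F ι b = some a → (e : Sym2 (Option V × ℕ)) = s(a, b) →
      (∃ x n, (e : Sym2 (Option V × ℕ)) = s((x, n), (x, n + 1))) ∨
      ∃ v, F.par v = none ∧ (e : Sym2 (Option V × ℕ)) = s((none, ι v), (some v, 0)) := by
    rintro a ⟨_ | v, _ | n⟩ hab h
    · cases hab
    · obtain rfl : (none, n) = a := Option.some_injective _ hab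
      exact Or.inl ⟨_, _, h⟩
    · obtain rfl : (F.par v, ι v) = a := Option.some_injective _ hab
      rcases hv : F.par v with _ | u
      · rw [hv] at h
        exact Or.inr ⟨v, hv, h⟩
      · refine absurd (mem_range_of_expCross F ι ⟨u, v, v, hv, NormalForest.le_refl v, F.adj hv,
          ?_, rfl⟩ h) he
        rw [hv]
    · obtain rfl : (some v, n) = a := Option.some_injective _ hab
      exact Or.inl ⟨_, _, h⟩
  rcases adj_edge e with (h | h) | (h | h)
  · exact key _ _ h (edge_eq e)
  · exact absurd (mem_range_of_expCross F ι h (edge_eq e)) he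
  · exact key _ _ h (by rw [edge_eq e, Sym2.eq_swap])
  · exact absurd (mem_range_of_expCross F ι h (by rw [edge_eq e, Sym2.eq_swap])) he

/-- Edges within a ray and edges at the extra ray do not come from `G`. -/
theorem notMem_range_of_fst {e : (expGraph F ι).edgeSet} {a b : Option V × ℕ}
    (h : (e : Sym2 (Option V × ℕ)) = s(a, b)) (hab : a.1 = b.1 ∨ a.1 = none) :
    e ∉ Set.range (expEdge F ι) := by
  rintro ⟨e', rfl⟩
  obtain ⟨u, c, w, -, -, huw, -, h2⟩ := expEdge_spec F ι e'
  rw [h2] at h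
  rcases Sym2.eq_iff.1 h with ⟨rfl, rfl⟩ | ⟨rfl, rfl⟩
  · rcases hab with hab | hab
    · exact huw.ne (Option.some_injective _ hab)
    · cases hab
  · rcases hab with hab | hab
    · exact huw.ne (Option.some_injective _ hab.symm)
    · cases hab

/-! #### Ends and bounded cuts of the expansion -/

/-- The down-closure, in the expanded tree, of the chain of an end of `G` is the chain of an end. -/
theorem exists_endMap (ω : GraphEnd G) : ∃ η : GraphEnd (expGraph F ι), ∀ a,
    (expForest F ι).EndIn a η ↔ ∃ v, F.EndIn v ω ∧ (expForest F ι).le a (some v, 0) := by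
  obtain ⟨v0, hv0, -⟩ := F.exists_endIn_disjoint ∅ ω
  refine NormalForest.exists_end_of_chain
    (D := {a | ∃ v, F.EndIn v ω ∧ (expForest F ι).le a (some v, 0)})
    ⟨(some v0, 0), v0, hv0, NormalForest.le_refl _⟩ ?_ ?_ ?_
  · rintro x y hxy ⟨v, hv, hyv⟩
    exact ⟨v, hv, NormalForest.le_trans hxy hyv⟩
  · rintro x ⟨v, hv, hxv⟩ y ⟨w, hw, hyw⟩
    rcases hv.total hw with h | h
    · exact NormalForest.le_total_of_le (NormalForest.le_trans hxv (forest_le_of_le F ι h)) hyw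
    · exact NormalForest.le_total_of_le hxv (NormalForest.le_trans hyw (forest_le_of_le F ι h))
  · rintro x ⟨v, hv, hxv⟩
    obtain ⟨w, hw, -, hvw, hne⟩ := hv.exists_lt ∅
    refine ⟨(some w, 0), ⟨w, hw, NormalForest.le_refl _⟩,
      NormalForest.le_trans hxv (forest_le_of_le F ι hvw), ?_⟩
    rintro rfl
    exact hne (NormalForest.le_antisymm ((forest_le_iff F ι).1 hxv) hvw)

/-- The end of the expanded graph corresponding to an end of `G`. -/
noncomputable def endMap (ω : GraphEnd G) : GraphEnd (expGraph F ι) :=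
  (exists_endMap F ι ω).choose

theorem endIn_endMap {ω : GraphEnd G} {a : Option V × ℕ} : (expForest F ι).EndIn a (endMap F ι ω) ↔
    ∃ v, F.EndIn v ω ∧ (expForest F ι).le a (some v, 0) :=
  (exists_endMap F ι ω).choose_spec a

theorem endIn_endMap_some {ω : GraphEnd G} {v : V} :
    (expForest F ι).EndIn (some v, 0) (endMap F ι ω) ↔ F.EndIn v ω := by
  rw [endIn_endMap]
  constructor
  · rintro ⟨w, hw, h⟩
    exact hw.mono ((forest_le_iff F ι).1 h)
  · exact fun h => ⟨v, h, NormalForest.le_refl _⟩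

theorem endMap_injective : Function.Injective (endMap F ι) := fun ω ω' h =>
  NormalForest.end_ext (F := F) fun v hv => by
    rwa [← endIn_endMap_some F ι, ← h, endIn_endMap_some]

variable {Ψ : Set (GraphEnd G)}

theorem isPsiBounded_expEdge_iff {b : Set G.edgeSet} :
    IsPsiBounded (expGraph F ι) (endMap F ι '' Ψ) (expEdge F ι '' b) ↔ IsPsiBounded G Ψ b := by
  rw [isPsiBounded_iff F, isPsiBounded_iff (expForest F ι)]
  constructor
  · intro h ω hω
    obtain ⟨a, ha, hb⟩ := h _ ⟨ω, hω, rfl⟩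
    obtain ⟨v, hv, hav⟩ := (endIn_endMap F ι).1 ha
    refine ⟨v, hv, fun e he x hx hxv => ?_⟩
    obtain ⟨n, hn⟩ := exists_mem_expEdge F ι hx
    exact hb _ ⟨e, he, rfl⟩ _ hn (NormalForest.le_trans hav ((forest_le_iff F ι).2 hxv))
  · rintro h _ ⟨ω, hω, rfl⟩
    obtain ⟨v, hv, hb⟩ := h ω hω
    refine ⟨(some v, 0), (endIn_endMap_some F ι).2 hv, ?_⟩
    rintro _ ⟨e, he, rfl⟩ a ha hav
    obtain ⟨w, hw, hvw⟩ := exists_of_mem_up F ι hav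
    obtain ⟨x, hx, hax⟩ := fst_of_mem_expEdge F ι ha
    obtain rfl : w = x := Option.some_injective _ (hw.symm.trans hax)
    exact hb e he _ hx hvw

/-- Some map sends every root to itself and is constant on components: it maps a vertex to the
root of its tree. -/
theorem exists_rootOf : ∃ ρ : V → V, (∀ v, F.par v = none → ρ v = v) ∧
    ∀ x y, G.Adj x y → ρ x = ρ y := by
  choose ρ h1 h2 using F.exists_root
  refine ⟨ρ, fun v hv => ?_, fun x y hxy => ?_⟩
  · exact NormalForest.eq_of_le_root hv (h2 v)
  · exact NormalForest.root_unique_of_reachable (h1 x) (h1 y) (h2 x) (h2 y) hxy.reachable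

/-- The cuts of `G` are the cuts of the expanded graph without contracted edges. -/
theorem isCut_expEdge_iff {b : Set G.edgeSet} :
    IsCut (expGraph F ι) (expEdge F ι '' b) ↔ IsCut G b := by
  constructor
  · rintro ⟨A, hA⟩
    -- the cut contains no edge of the rays, so each ray lies on one side
    have hray : ∀ v n, (some v, n) ∈ A ↔ (some v, 0) ∈ A := by
      intro v n
      induction n with
      | zero => rfl
      | succ n ih =>
        rw [← ih]
        by_contra hne
        have hadj : (expGraph F ι).Adj (some v, n) (some v, n + 1) := Or.inl (Or.inl rfl)
        have hmem : (⟨s((some v, n), (some v, n + 1)), hadj⟩ : (expGraph F ι).edgeSet) ∈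
            expEdge F ι '' b := by
          rw [hA]
          by_cases h : (some v, n) ∈ A
          · exact ⟨_, h, _, fun h' => hne ⟨fun _ => h, fun _ => h'⟩, rfl⟩
          · exact ⟨_, by tauto, _, h, Sym2.eq_swap⟩
        exact notMem_range_of_fst F ι (e := ⟨s((some v, n), (some v, n + 1)), hadj⟩) rfl
          (Or.inl rfl) (Set.image_subset_range _ _ hmem)
    refine ⟨{v | (some v, 0) ∈ A}, ?_⟩
    ext e
    rw [← (expEdge_injective F ι).mem_set_image, hA]
    obtain ⟨u, c, w, -, -, -, h1, h2⟩ := expEdge_spec F ι e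
    constructor
    · rintro ⟨a, ha, a', ha', h⟩
      rw [h2, Sym2.eq_iff] at h
      rcases h with ⟨rfl, rfl⟩ | ⟨rfl, rfl⟩
      · exact ⟨u, (hray _ _).1 ha, w, ha', h1⟩
      · exact ⟨w, ha, u, fun h => ha' ((hray _ _).2 h), h1.trans Sym2.eq_swap⟩
    · rintro ⟨x, hx, y, hy, h⟩
      rw [h1, Sym2.eq_iff] at h
      rcases h with ⟨rfl, rfl⟩ | ⟨rfl, rfl⟩
      · exact ⟨_, (hray _ _).2 hx, _, hy, h2⟩
      · exact ⟨_, hx, _, fun h => hy ((hray _ _).1 h), h2.trans Sym2.eq_swap⟩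
  · rintro ⟨A, rfl⟩
    obtain ⟨ρ, hρ, hρ'⟩ := exists_rootOf F
    -- within each tree the sides are swapped if necessary, so that no root lies in `A'`
    let A' : Set V := {v | ¬ (v ∈ A ↔ ρ v ∈ A)}
    have hA' : ∀ x y, G.Adj x y → (¬ (x ∈ A ↔ y ∈ A) ↔ ¬ (x ∈ A' ↔ y ∈ A')) := by
      intro x y hxy
      have := hρ' x y hxy
      change _ ↔ ¬ (¬ (x ∈ A ↔ ρ x ∈ A) ↔ ¬ (y ∈ A ↔ ρ y ∈ A))
      rw [this]
      tauto
    refine ⟨{a | ∃ v ∈ A', a.1 = some v}, ?_⟩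
    have hfst : ∀ v n, ((some v, n) : Option V × ℕ) ∈ {a : Option V × ℕ | ∃ v ∈ A', a.1 = some v} ↔
        v ∈ A' := fun v n =>
      ⟨fun ⟨w, hw, h⟩ => Option.some_injective _ h ▸ hw, fun h => ⟨v, h, rfl⟩⟩
    have hcut : ∀ e : G.edgeSet, (∃ x ∈ A, ∃ y ∉ A, (e : Sym2 V) = s(x, y)) ↔
        ∃ x ∈ {a : Option V × ℕ | ∃ v ∈ A', a.1 = some v},
          ∃ y ∉ {a : Option V × ℕ | ∃ v ∈ A', a.1 = some v},
          (expEdge F ι e : Sym2 (Option V × ℕ)) = s(x, y) := by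
      intro e
      rw [mem_cut_iff, hA' _ _ (adj_edge e), ← mem_cut_iff]
      obtain ⟨u, c, w, -, -, -, h1, h2⟩ := expEdge_spec F ι e
      rw [h1, h2]
      constructor
      · rintro ⟨x, hx, y, hy, h⟩
        rcases Sym2.eq_iff.1 h with ⟨rfl, rfl⟩ | ⟨rfl, rfl⟩
        · exact ⟨_, (hfst _ _).2 hx, _, fun h => hy ((hfst _ _).1 h), rfl⟩
        · exact ⟨_, (hfst _ _).2 hx, _, fun h => hy ((hfst _ _).1 h), Sym2.eq_swap⟩
      · rintro ⟨x, hx, y, hy, h⟩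
        rcases Sym2.eq_iff.1 h with ⟨rfl, rfl⟩ | ⟨rfl, rfl⟩
        · exact ⟨_, (hfst _ _).1 hx, _, fun h => hy ((hfst _ _).2 h), rfl⟩
        · exact ⟨_, (hfst _ _).1 hx, _, fun h => hy ((hfst _ _).2 h), Sym2.eq_swap⟩
    ext e'
    by_cases he' : e' ∈ Set.range (expEdge F ι)
    · obtain ⟨e, rfl⟩ := he'
      rw [(expEdge_injective F ι).mem_set_image]
      exact hcut e
    · refine iff_of_false (fun h => he' (Set.image_subset_range _ _ h)) ?_
      rintro ⟨x, ⟨v, hv, hxv⟩, y, hy, hxy⟩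
      rcases contracted_cases F ι he' with ⟨z, n, h⟩ | ⟨r, hr, h⟩
      · rw [h, Sym2.eq_iff] at hxy
        rcases hxy with ⟨rfl, rfl⟩ | ⟨rfl, rfl⟩ <;> exact hy ⟨v, hv, hxv⟩
      · rw [h, Sym2.eq_iff] at hxy
        rcases hxy with ⟨rfl, rfl⟩ | ⟨rfl, rfl⟩
        · cases hxv
        · obtain rfl := Option.some_injective _ hxv
          exact hv (by rw [hρ _ hr])

theorem minimal_image_iff {α β : Type*} {f : α → β} (hf : Function.Injective f) {P : Set β → Prop}
    {Q : Set α → Prop} (h : ∀ X, P (f '' X) ↔ Q X) {X : Set α} :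
    Minimal P (f '' X) ↔ Minimal Q X := by
  rw [minimal_subset_iff, minimal_subset_iff, h]
  refine and_congr_right fun _ => ⟨fun hm Y hY hsub => ?_, fun hm Y hY hsub => ?_⟩
  · exact hf.image_injective (hm ((h Y).2 hY) (Set.image_mono hsub))
  · obtain ⟨Z, hZ, rfl⟩ := Set.subset_image_iff.1 hsub
    rw [hm ((h Z).1 hY) hZ]

theorem isPsiBond_expEdge_iff {b : Set G.edgeSet} :
    IsPsiBond (expGraph F ι) (endMap F ι '' Ψ) (expEdge F ι '' b) ↔ IsPsiBond G Ψ b := by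
  refine minimal_image_iff (expEdge_injective F ι) fun b => ?_
  rw [Set.image_nonempty, isCut_expEdge_iff, isPsiBounded_expEdge_iff]

/-- The edges joining the roots of the trees to the extra ray. -/
def rootEdges : Set (expGraph F ι).edgeSet :=
  {e | ∃ v, F.par v = none ∧ (e : Sym2 (Option V × ℕ)) = s((none, ι v), (some v, 0))}

/-- The edges at the extra ray to which the roots are attached are bridges, hence bonds. -/
theorem isPsiBond_rootEdge {e : (expGraph F ι).edgeSet} (he : e ∈ rootEdges F ι)
    (Ψ' : Set (GraphEnd (expGraph F ι))) : IsPsiBond (expGraph F ι) Ψ' {e} := by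
  obtain ⟨v, hv, he⟩ := he
  refine ⟨⟨Set.singleton_nonempty e, ⟨(expForest F ι).up (some v, 0), ?_⟩, ?_⟩, ?_⟩
  · have hnone : ∀ n, ((none, n) : Option V × ℕ) ∉ (expForest F ι).up (some v, 0) := fun n h => by
      obtain ⟨w, hw, -⟩ := exists_of_mem_up F ι h
      cases hw
    ext e'
    constructor
    · rintro rfl
      exact ⟨_, NormalForest.mem_up_self _, _, hnone _, he.trans Sym2.eq_swap⟩
    · rintro ⟨x, hx, y, hy, hxy⟩
      obtain ⟨w, hw, hvw⟩ := exists_of_mem_up F ι hx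
      obtain ⟨x, n⟩ := x
      obtain rfl : x = some w := hw
      by_cases he' : e' ∈ Set.range (expEdge F ι)
      · obtain ⟨e', rfl⟩ := he'
        obtain ⟨u, c, w', hc, hcw, -, h1, h2⟩ := expEdge_spec F ι e'
        have huw := NormalForest.le_trans (NormalForest.le_of_par hc) hcw
        rw [h2, Sym2.eq_iff] at hxy
        rcases hxy with ⟨h3, rfl⟩ | ⟨rfl, h3⟩
        · rw [Prod.mk.injEq, Option.some.injEq] at h3
          obtain ⟨rfl, -⟩ := h3
          exact absurd ((forest_le_iff F ι).2 (NormalForest.le_trans hvw huw)) hy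
        · rw [Prod.mk.injEq, Option.some.injEq] at h3
          obtain ⟨rfl, -⟩ := h3
          refine absurd ((forest_le_iff F ι).2 ?_) hy
          rcases NormalForest.le_total_of_le huw hvw with h | h
          · rw [NormalForest.eq_of_le_root hv h]; exact NormalForest.le_refl _
          · exact h
      · rcases contracted_cases F ι he' with ⟨z, m, h⟩ | ⟨r, hr, h⟩
        · rw [h, Sym2.eq_iff] at hxy
          rcases hxy with ⟨h3, rfl⟩ | ⟨rfl, h3⟩ <;>
          · rw [Prod.mk.injEq] at h3
            obtain ⟨rfl, -⟩ := h3
            exact absurd ((forest_le_iff F ι).2 hvw) hy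
        · rw [h, Sym2.eq_iff] at hxy
          rcases hxy with ⟨h3, rfl⟩ | ⟨rfl, h3⟩
          · cases h3
          · rw [Prod.mk.injEq, Option.some.injEq] at h3
            obtain ⟨rfl, -⟩ := h3
            obtain rfl := NormalForest.eq_of_le_root hr hvw
            exact Subtype.ext (h.trans he.symm)
  · classical
    refine (isPsiBounded_iff (expForest F ι)).2 fun η _ => ?_
    obtain ⟨a, ha, hd⟩ := (expForest F ι).exists_endIn_disjoint
      {edgeStart e, edgeFinish e} η
    refine ⟨a, ha, fun e' he' x hx hxa => Set.disjoint_left.1 hd hxa ?_⟩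
    rw [Set.mem_singleton_iff.1 he', mem_edge_iff] at hx
    simpa using hx
  · rintro b' ⟨⟨e', he'⟩, -⟩ hb'
    have := hb' he'
    rw [Set.mem_singleton_iff] at this
    rw [← this]
    exact Set.singleton_subset_iff.2 he'

end Expansion

/-! ### The projection of the expanded space -/

section Projection

variable {V : Type u} {G : SimpleGraph V} (F : NormalForest G) (ι : V ↪ ℕ)

open Classical in
/-- The position on an edge `e` of `G` corresponding to the position `t` on its copy in the
expanded graph: the two edges may be oriented differently. -/
noncomputable def expOrient (e : G.edgeSet) (t : Set.Ioo (0 : ℝ) 1) : Set.Ioo (0 : ℝ) 1 :=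
  if (edgeStart (expEdge F ι e)).1 = some (edgeStart e) then t
  else ⟨1 - t, by linarith [t.2.2], by linarith [t.2.1]⟩

theorem expOrient_cases (e : G.edgeSet) :
    ((∀ t, expOrient F ι e t = t) ∧ (edgeStart (expEdge F ι e)).1 = some (edgeStart e) ∧
      (edgeFinish (expEdge F ι e)).1 = some (edgeFinish e)) ∨
    ((∀ t, (expOrient F ι e t : ℝ) = 1 - t) ∧
      (edgeStart (expEdge F ι e)).1 = some (edgeFinish e) ∧
      (edgeFinish (expEdge F ι e)).1 = some (edgeStart e)) := by
  have h := map_expEdge F ι e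
  rw [edge_eq e, edge_eq (expEdge F ι e), Sym2.map_mk, Sym2.map_mk, Sym2.eq_iff] at h
  rcases h with h | h
  · exact Or.inl ⟨fun t => if_pos h.1, h⟩
  · refine Or.inr ⟨fun t => ?_, h⟩
    rw [expOrient, if_neg]
    rw [h.1]
    exact fun h' => (adj_edge e).ne (Option.some_injective _ h').symm

theorem expOrient_dist (e : G.edgeSet) (s t : Set.Ioo (0 : ℝ) 1) :
    |(expOrient F ι e s : ℝ) - expOrient F ι e t| = |(s : ℝ) - t| := by
  rcases expOrient_cases F ι e with ⟨h, -⟩ | ⟨h, -⟩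
  · rw [h, h]
  · rw [h, h, abs_sub_comm]
    congr 1
    ring

theorem expOrient_bijective (e : G.edgeSet) : Function.Bijective (expOrient F ι e) := by
  constructor
  · intro s t h
    have := expOrient_dist F ι e s t
    rw [h, sub_self, abs_zero] at this
    exact Subtype.ext (sub_eq_zero.1 (abs_eq_zero.1 this.symm))
  · intro t
    rcases expOrient_cases F ι e with ⟨h, -⟩ | ⟨h, -⟩
    · exact ⟨t, h t⟩
    · exact ⟨⟨1 - t, by linarith [t.2.2], by linarith [t.2.1]⟩, Subtype.ext (by rw [h]; simp)⟩

variable (v0 : V) (Ψ : Set (GraphEnd G))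

open Classical in
/-- The projection of the expanded space to `|G|_Ψ`. It contracts the ray replacing a vertex `v`
to `v`, and the vertices of the extra ray go to an arbitrary vertex `v0`. The inner points of a
contracted edge follow its endvertex with parameter `0`, so the projection need not be continuous
on the edges joining the roots to the extra ray. -/
noncomputable def expProj : PsiSpace (expGraph F ι) (endMap F ι '' Ψ) → PsiSpace G Ψ
  | ⟨.vertex a, _⟩ => vertexPt Ψ (a.1.getD v0)
  | ⟨.atEnd η, h⟩ => endPt (h η rfl).choose_spec.1
  | ⟨.inner e' t, _⟩ =>
      if h : ∃ e, expEdge F ι e = e' then edgePt Ψ h.choose (expOrient F ι h.choose t)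
      else vertexPt Ψ ((edgeStart e').1.getD v0)

variable {Ψ}

theorem expProj_endPt {ω : GraphEnd G} (h : ω ∈ Ψ) :
    expProj F ι v0 Ψ (endPt ⟨ω, h, rfl⟩) = endPt h := by
  have h' : ∃ ω', ω' ∈ Ψ ∧ endMap F ι ω' = endMap F ι ω := ⟨ω, h, rfl⟩
  have h'' : h'.choose = ω := endMap_injective F ι h'.choose_spec.2
  exact Subtype.ext (congrArg Point.atEnd h'')

theorem expProj_edgePt (e : G.edgeSet) (t : Set.Ioo (0 : ℝ) 1) :
    expProj F ι v0 Ψ (edgePt _ (expEdge F ι e) t) = edgePt Ψ e (expOrient F ι e t) := by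
  have h : ∃ e', expEdge F ι e' = expEdge F ι e := ⟨e, rfl⟩
  have h' : h.choose = e := expEdge_injective F ι h.choose_spec
  exact (dif_pos h).trans (by rw [h'])

theorem expProj_of_notMem_range {e' : (expGraph F ι).edgeSet}
    (he : e' ∉ Set.range (expEdge F ι)) (t : Set.Ioo (0 : ℝ) 1) :
    expProj F ι v0 Ψ (edgePt _ e' t) = vertexPt Ψ ((edgeStart e').1.getD v0) :=
  dif_neg he

variable (Ψ) in
/-- The set of points of the expanded space over a set `U` of points of `|G|_Ψ`, where the inner
points of contracted edges follow the nearest endvertex. It is open if `U` is. -/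
def expLift (U : Set (PsiSpace G Ψ)) : Set (PsiSpace (expGraph F ι) (endMap F ι '' Ψ)) :=
  pointSet (fun a => vertexPt Ψ (a.1.getD v0) ∈ U)
    (fun η => ∃ ω, ∃ h : ω ∈ Ψ, endMap F ι ω = η ∧ endPt h ∈ U)
    fun e' t => (∃ e, expEdge F ι e = e' ∧ edgePt Ψ e (expOrient F ι e t) ∈ U) ∨
      (e' ∉ Set.range (expEdge F ι) ∧ HalfEdge (vertexPt Ψ ((edgeStart e').1.getD v0) ∈ U)
        (vertexPt Ψ ((edgeFinish e').1.getD v0) ∈ U) t)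

theorem vertexPt_mem_expLift {U : Set (PsiSpace G Ψ)} {a : Option V × ℕ} :
    vertexPt _ a ∈ expLift F ι v0 Ψ U ↔ vertexPt Ψ (a.1.getD v0) ∈ U := Iff.rfl

theorem endPt_mem_expLift {U : Set (PsiSpace G Ψ)} {ω : GraphEnd G} (h : ω ∈ Ψ) :
    (endPt ⟨ω, h, rfl⟩ : PsiSpace (expGraph F ι) (endMap F ι '' Ψ)) ∈ expLift F ι v0 Ψ U ↔
      endPt h ∈ U := by
  constructor
  · rintro ⟨ω', h', heq, hU⟩
    obtain rfl := endMap_injective F ι heq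
    exact hU
  · exact fun hU => ⟨ω, h, rfl, hU⟩

theorem edgePt_mem_expLift {U : Set (PsiSpace G Ψ)} {e : G.edgeSet} {t : Set.Ioo (0 : ℝ) 1} :
    edgePt _ (expEdge F ι e) t ∈ expLift F ι v0 Ψ U ↔ edgePt Ψ e (expOrient F ι e t) ∈ U := by
  constructor
  · rintro (⟨e', h, h'⟩ | ⟨h, -⟩)
    · rwa [expEdge_injective F ι h] at h'
    · exact absurd ⟨e, rfl⟩ h
  · exact fun h => Or.inl ⟨e, rfl, h⟩

theorem edgePt_mem_expLift_of_notMem {U : Set (PsiSpace G Ψ)} {e' : (expGraph F ι).edgeSet}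
    (he : e' ∉ Set.range (expEdge F ι)) {t : Set.Ioo (0 : ℝ) 1} :
    edgePt _ e' t ∈ expLift F ι v0 Ψ U ↔ HalfEdge (vertexPt Ψ ((edgeStart e').1.getD v0) ∈ U)
        (vertexPt Ψ ((edgeFinish e').1.getD v0) ∈ U) t := by
  constructor
  · rintro (⟨e, rfl, -⟩ | ⟨-, h⟩)
    · exact absurd ⟨e, rfl⟩ he
    · exact h
  · exact fun h => Or.inr ⟨he, h⟩

theorem isOpen_expLift {U : Set (PsiSpace G Ψ)} (hU : IsOpen U) :
    IsOpen (expLift F ι v0 Ψ U) := by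
  obtain ⟨hv, he, hend⟩ := (isOpen_iff_forest F).1 hU
  refine (isOpen_iff_forest (expForest F ι)).2 ⟨fun a ha => ?_, fun e' t ht => ?_, ?_⟩
  · obtain ⟨ε, hε, h⟩ := hv _ ((vertexPt_mem_expLift F ι v0).1 ha)
    refine ⟨min ε (1 / 2), lt_min hε (by norm_num), fun e' t het => ?_⟩
    by_cases her : e' ∈ Set.range (expEdge F ι)
    · obtain ⟨e, rfl⟩ := her
      rw [edgePt_mem_expLift]
      refine h e _ ?_
      rcases expOrient_cases F ι e with ⟨h1, h2, h3⟩ | ⟨h1, h2, h3⟩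
      · rw [h1]
        rcases het with ⟨rfl, ht⟩ | ⟨rfl, ht⟩
        · exact Or.inl ⟨by rw [h2]; rfl, ht.trans_le (min_le_left _ _)⟩
        · exact Or.inr ⟨by rw [h3]; rfl, ht.trans_le (min_le_left _ _)⟩
      · rw [h1]
        rcases het with ⟨rfl, ht⟩ | ⟨rfl, ht⟩
        · exact Or.inr ⟨by rw [h2]; rfl, by linarith [ht.trans_le (min_le_left _ _)]⟩
        · exact Or.inl ⟨by rw [h3]; rfl, ht.trans_le (min_le_left _ _)⟩
    · rw [edgePt_mem_expLift_of_notMem F ι v0 her]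
      rcases het with ⟨rfl, ht⟩ | ⟨rfl, ht⟩
      · exact Or.inl ⟨ha, ht.trans_le (min_le_right _ _)⟩
      · exact Or.inr (Or.inl ⟨ha, by linarith [ht.trans_le (min_le_right _ _)]⟩)
  · by_cases her : e' ∈ Set.range (expEdge F ι)
    · obtain ⟨e, rfl⟩ := her
      obtain ⟨ε, hε, h⟩ := he _ _ ((edgePt_mem_expLift F ι v0).1 ht)
      refine ⟨ε, hε, fun s hs => (edgePt_mem_expLift F ι v0).2 (h _ ?_)⟩
      rwa [expOrient_dist]
    · obtain ⟨ε, hε, h⟩ := ((edgePt_mem_expLift_of_notMem F ι v0 her).1 ht).exists_ball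
      exact ⟨ε, hε, fun s hs => (edgePt_mem_expLift_of_notMem F ι v0 her).2 (h s hs)⟩
  · rintro _ ⟨ω, hω, rfl⟩ hωU
    obtain ⟨v, hvω, h1, h2, h3⟩ := hend ω hω ((endPt_mem_expLift F ι v0 hω).1 hωU)
    -- going up one step avoids the edges at the extra ray
    obtain ⟨w, hw, -, hvw, hne⟩ := hvω.exists_lt ∅
    refine ⟨(some w, 0), (endIn_endMap_some F ι).2 hw, fun a ha => ?_, ?_, fun e' t het => ?_⟩
    · obtain ⟨x, hx, hwx⟩ := exists_of_mem_up F ι ha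
      rw [vertexPt_mem_expLift, hx]
      exact h1 x (NormalForest.le_trans hvw hwx)
    · rintro _ ⟨ω', hω', rfl⟩ hη
      refine (endPt_mem_expLift F ι v0 hω').2 (h2 ω' hω' ?_)
      exact NormalForest.EndIn.mono hvw ((endIn_endMap_some F ι).1 hη)
    · obtain ⟨a, ha, haw⟩ : ∃ a ∈ (e' : Sym2 (Option V × ℕ)),
          a ∈ (expForest F ι).up (some w, 0) := by
        rcases het with h | h
        · exact ⟨_, mem_edge_iff.2 (Or.inl rfl), h⟩
        · exact ⟨_, mem_edge_iff.2 (Or.inr rfl), h⟩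
      obtain ⟨x, hx, hwx⟩ := exists_of_mem_up F ι haw
      have hvx := NormalForest.le_trans hvw hwx
      by_cases her : e' ∈ Set.range (expEdge F ι)
      · obtain ⟨e, rfl⟩ := her
        rw [edgePt_mem_expLift]
        obtain ⟨y, hy, hay⟩ := fst_of_mem_expEdge F ι ha
        obtain rfl : x = y := Option.some_injective _ (hx.symm.trans hay)
        refine h3 e _ ?_
        rcases mem_edge_iff.1 hy with rfl | rfl
        · exact Or.inl hvx
        · exact Or.inr hvx
      · rw [edgePt_mem_expLift_of_notMem F ι v0 her]
        rcases contracted_cases F ι her with ⟨z, n, h⟩ | ⟨r, hr, h⟩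
        · have hz : ∀ b ∈ (e' : Sym2 (Option V × ℕ)), b.1 = z := by
            intro b hb
            rw [h, Sym2.mem_iff] at hb
            rcases hb with rfl | rfl <;> rfl
          rw [hz _ (mem_edge_iff.2 (Or.inl rfl)), hz _ (mem_edge_iff.2 (Or.inr rfl)),
            ← hz a ha, hx]
          exact Or.inr (Or.inr ⟨h1 x hvx, h1 x hvx⟩)
        · exfalso
          rw [h, Sym2.mem_iff] at ha
          rcases ha with rfl | rfl
          · cases hx
          · obtain rfl := Option.some_injective _ hx
            have hwr := NormalForest.eq_of_le_root hr hwx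
            have hvr := NormalForest.eq_of_le_root hr hvx
            exact hne (hwr.trans hvr.symm)

theorem disjoint_expLift {U U' : Set (PsiSpace G Ψ)} (h : Disjoint U U') :
    Disjoint (expLift F ι v0 Ψ U) (expLift F ι v0 Ψ U') := by
  have hd : ∀ x, x ∈ U → x ∉ U' := fun x hx => Set.disjoint_left.1 h hx
  refine Set.disjoint_left.2 fun x hx hx' => ?_
  rcases psiSpace_cases x with ⟨a, rfl⟩ | ⟨_, ⟨ω, hω, rfl⟩, rfl⟩ | ⟨e', t, rfl⟩
  · exact hd _ hx hx'
  · rw [endPt_mem_expLift F ι v0 hω] at hx hx'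
    exact hd _ hx hx'
  · by_cases her : e' ∈ Set.range (expEdge F ι)
    · obtain ⟨e, rfl⟩ := her
      rw [edgePt_mem_expLift] at hx hx'
      exact hd _ hx hx'
    · rw [edgePt_mem_expLift_of_notMem F ι v0 her] at hx hx'
      exact hx.not_both hx' (fun h => hd _ h.1 h.2) (fun h => hd _ h.1 h.2)

theorem vertexSet_subset_expLift {U U' : Set (PsiSpace G Ψ)} (h : vertexSet G Ψ ⊆ U ∪ U') :
    vertexSet (expGraph F ι) (endMap F ι '' Ψ) ⊆ expLift F ι v0 Ψ U ∪ expLift F ι v0 Ψ U' := by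
  intro x hx
  rcases psiSpace_cases x with ⟨a, rfl⟩ | ⟨_, ⟨ω, hω, rfl⟩, rfl⟩ | ⟨e', t, rfl⟩
  · exact h (vertexPt_mem_vertexSet _)
  · rw [Set.mem_union, endPt_mem_expLift F ι v0 hω, endPt_mem_expLift F ι v0 hω]
    exact h (endPt_mem_vertexSet hω)
  · exact absurd hx (edgePt_notMem_vertexSet e' t)

theorem expProj_mem_vertexSet {x : PsiSpace (expGraph F ι) (endMap F ι '' Ψ)}
    (hx : x ∈ vertexSet (expGraph F ι) (endMap F ι '' Ψ)) :
    expProj F ι v0 Ψ x ∈ vertexSet G Ψ := by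
  rcases psiSpace_cases x with ⟨a, rfl⟩ | ⟨_, ⟨ω, hω, rfl⟩, rfl⟩ | ⟨e', t, rfl⟩
  · exact vertexPt_mem_vertexSet _
  · rw [expProj_endPt]
    exact endPt_mem_vertexSet hω
  · exact absurd hx (edgePt_notMem_vertexSet e' t)

/-- Off the edges joining the roots to the extra ray, the lift is the preimage under the
projection. -/
theorem mem_expLift_iff {U : Set (PsiSpace G Ψ)}
    {x : PsiSpace (expGraph F ι) (endMap F ι '' Ψ)}
    (hx : x ∉ edgePoints (expGraph F ι) (endMap F ι '' Ψ) (rootEdges F ι)) :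
    x ∈ expLift F ι v0 Ψ U ↔ expProj F ι v0 Ψ x ∈ U := by
  rcases psiSpace_cases x with ⟨a, rfl⟩ | ⟨_, ⟨ω, hω, rfl⟩, rfl⟩ | ⟨e', t, rfl⟩
  · rfl
  · rw [endPt_mem_expLift F ι v0 hω, expProj_endPt]
  · by_cases her : e' ∈ Set.range (expEdge F ι)
    · obtain ⟨e, rfl⟩ := her
      rw [edgePt_mem_expLift, expProj_edgePt]
    · rw [edgePt_mem_expLift_of_notMem F ι v0 her, expProj_of_notMem_range F ι v0 her]
      rcases contracted_cases F ι her with ⟨z, n, h⟩ | h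
      · have hz : ∀ b ∈ (e' : Sym2 (Option V × ℕ)), b.1 = z := by
          intro b hb
          rw [h, Sym2.mem_iff] at hb
          rcases hb with rfl | rfl <;> rfl
        rw [hz _ (mem_edge_iff.2 (Or.inl rfl)), hz _ (mem_edge_iff.2 (Or.inr rfl))]
        exact ⟨fun h => h.elim And.left fun h => h.elim And.left And.left,
          fun h => Or.inr (Or.inr ⟨h, h⟩)⟩
      · exact absurd (edgePt_mem_edgePoints.2 h) hx

theorem vertex_notMem_edgePoints {x : PsiSpace G Ψ} (hx : x ∈ vertexSet G Ψ)
    (o : Set G.edgeSet) : x ∉ edgePoints G Ψ o := fun h => by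
  obtain ⟨e, -, t, rfl⟩ := mem_edgePoints.1 h
  exact edgePt_notMem_vertexSet e t hx

/-- The projection is compatible with the identifications of the graph-like quotients. -/
theorem cls_expProj_eq {x y : PsiSpace (expGraph F ι) (endMap F ι '' Ψ)}
    (h : cls _ _ x = cls _ _ y) : cls G Ψ (expProj F ι v0 Ψ x) = cls G Ψ (expProj F ι v0 Ψ y) := by
  rcases cls_eq_iff.1 h with rfl | ⟨hx, hy, h⟩
  · rfl
  · refine cls_eq_iff.2 (Or.inr ⟨expProj_mem_vertexSet F ι v0 hx, expProj_mem_vertexSet F ι v0 hy,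
      fun U U' hU hU' hd hc => ?_⟩)
    rw [← mem_expLift_iff F ι v0 (vertex_notMem_edgePoints hx _),
      ← mem_expLift_iff F ι v0 (vertex_notMem_edgePoints hy _)]
    exact h _ _ (isOpen_expLift F ι v0 hU) (isOpen_expLift F ι v0 hU') (disjoint_expLift F ι v0 hd)
      (vertexSet_subset_expLift F ι v0 hc)

variable (Ψ) in
/-- The projection on the graph-like quotients. -/
noncomputable def quotProj :
    GraphLikeQuotient (expGraph F ι) (endMap F ι '' Ψ) → GraphLikeQuotient G Ψ :=
  Quotient.lift (fun x => cls G Ψ (expProj F ι v0 Ψ x)) fun _ _ h =>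
    cls_expProj_eq F ι v0 (Quotient.sound h)

theorem quotProj_cls (x : PsiSpace (expGraph F ι) (endMap F ι '' Ψ)) :
    quotProj F ι v0 Ψ (cls _ _ x) = cls G Ψ (expProj F ι v0 Ψ x) := rfl

theorem isSaturated_expLift {U : Set (PsiSpace G Ψ)} (hU : IsSaturated U) :
    IsSaturated (expLift F ι v0 Ψ U) := by
  intro x y h hx
  rcases cls_eq_iff.1 h with rfl | ⟨hxv, hyv, -⟩
  · exact hx
  · rw [mem_expLift_iff F ι v0 (vertex_notMem_edgePoints hxv _)] at hx
    rw [mem_expLift_iff F ι v0 (vertex_notMem_edgePoints hyv _)]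
    exact hU _ _ (cls_expProj_eq F ι v0 h) hx

theorem continuousOn_quotProj : ContinuousOn (quotProj F ι v0 Ψ)
    (edgeCls (expGraph F ι) (endMap F ι '' Ψ) (rootEdges F ι))ᶜ := by
  rw [continuousOn_iff']
  intro O hO
  have hU : IsOpen (cls G Ψ ⁻¹' O) := hO.preimage continuous_cls
  have hsat := isSaturated_expLift F ι v0 (isSaturated_preimage O)
  refine ⟨cls _ _ '' expLift F ι v0 Ψ (cls G Ψ ⁻¹' O),
    hsat.isOpen_image (isOpen_expLift F ι v0 hU), ?_⟩
  ext p
  obtain ⟨x, rfl⟩ := cls_surjective p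
  refine and_congr_left fun hx => ?_
  have hx' : x ∉ edgePoints (expGraph F ι) (endMap F ι '' Ψ) (rootEdges F ι) :=
    fun h => hx ⟨x, h, rfl⟩
  rw [hsat.cls_mem_image, mem_expLift_iff F ι v0 hx']
  rfl

end Projection

/-! ### Matroids -/

section Matroid

variable {α β : Type*}

theorem isCircuit_comap_iff {N : Matroid β} {f : α → β} (hf : Function.Injective f)
    {X : Set α} : (N.comap f).IsCircuit X ↔ N.IsCircuit (f '' X) := by
  rw [Matroid.isCircuit_def, Matroid.isCircuit_def]
  refine (minimal_image_iff hf fun Y => ?_).symm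
  rw [Matroid.comap_dep_iff]
  exact ⟨Or.inl, fun h => h.elim id fun h => absurd hf.injOn h.2⟩

theorem isCocircuit_comap_iff {N : Matroid β} {f : α → β} (hf : Function.Injective f)
    (hN : N.E = Set.range f) {X : Set α} : (N.comap f).IsCocircuit X ↔ N.IsCocircuit (f '' X) := by
  have hbase : ∀ B, (N.comap f).IsBase B ↔ N.IsBase (f '' B) := by
    intro B
    rw [Matroid.comap_isBase_iff, hN, Set.preimage_range, Set.image_univ, ← hN,
      Matroid.isBasis_ground_iff]
    simp [hf.injOn]
  rw [Matroid.isCocircuit_iff_minimal, Matroid.isCocircuit_iff_minimal]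
  refine (minimal_image_iff hf fun Y => ?_).symm
  constructor
  · intro h B hB
    obtain ⟨_, ⟨x, hx, rfl⟩, y, hy, hxy⟩ := h _ ((hbase B).1 hB)
    exact ⟨x, hx, hf hxy ▸ hy⟩
  · intro h B hB
    obtain ⟨B, rfl⟩ := Set.subset_range_iff_exists_image_eq.1 (hN ▸ hB.subset_ground)
    obtain ⟨x, hx, hx'⟩ := h B ((hbase B).2 hB)
    exact ⟨f x, ⟨x, hx, rfl⟩, x, hx', rfl⟩

/-- A nonempty set that meets no cocircuit in exactly one element contains a circuit. -/
theorem exists_isCircuit_subset_of_cocircuits {N : Matroid α} {X : Set α} (hX : X ⊆ N.E)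
    (hne : X.Nonempty) (h : ∀ K, N.IsCocircuit K → ∀ e, X ∩ K ≠ {e}) :
    ∃ K ⊆ X, N.IsCircuit K := by
  have hdep : N.Dep X := by
    by_contra hnd
    obtain ⟨B, hB, hXB⟩ := ((Matroid.not_dep_iff hX).1 hnd).exists_isBase_superset
    obtain ⟨e, he⟩ := hne
    refine h _ (Matroid.fundCocircuit_isCocircuit (hXB he) hB) e ?_
    ext x
    refine ⟨fun ⟨hx, hxK⟩ => ?_, ?_⟩
    · exact (N.fundCocircuit_subset_insert_compl e B hxK).resolve_right fun h => h.2 (hXB hx)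
    · rintro rfl
      exact ⟨he, N.mem_fundCocircuit _ B⟩
  obtain ⟨K, hK, hK'⟩ := hdep.exists_isCircuit_subset
  exact ⟨K, hK, hK'⟩

end Matroid

/-! ### Circuits of the contraction -/

section Circuits

variable {V : Type u} {G : SimpleGraph V} {Ψ : Set (GraphEnd G)}

theorem isPsiCircuit_iff {o : Set G.edgeSet} :
    IsPsiCircuit G Ψ o ↔ Nonempty (closure (edgeCls G Ψ o) ≃ₜ Circle) := Iff.rfl

theorem IsLoop.inter_bond_ne_singleton (F : NormalForest G) {γ : ℝ → GraphLikeQuotient G Ψ}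
    {s t : ℝ} {o b : Set G.edgeSet} (h : IsLoop γ s t o) (hb : IsPsiBond G Ψ b) (e : G.edgeSet) :
    o ∩ b ≠ {e} :=
  h.inter_ne_singleton F hb.prop.2.1 hb.prop.2.2 e

variable {N : Matroid G.edgeSet} (hE : N.E = Set.univ)
  (hN : ∀ b, N.IsCocircuit b ↔ IsPsiBond G Ψ b)

include hE hN in
theorem IsLoop.exists_isCircuit_subset (F : NormalForest G) {γ : ℝ → GraphLikeQuotient G Ψ}
    {s t : ℝ} {o : Set G.edgeSet} (h : IsLoop γ s t o) (hne : o.Nonempty) :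
    ∃ o' ⊆ o, N.IsCircuit o' :=
  exists_isCircuit_subset_of_cocircuits (hE ▸ Set.subset_univ o) hne
    fun K hK e => h.inter_bond_ne_singleton F ((hN K).1 hK) e

include hE hN in
/-- A loop traversing the edges of a circuit has no proper subloops, so its image is a circle. -/
theorem IsLoop.isPsiCircuit (F : NormalForest G) {γ : ℝ → GraphLikeQuotient G Ψ}
    {o : Set G.edgeSet} (h : IsLoop γ 0 1 o) (ho : N.IsCircuit o) : IsPsiCircuit G Ψ o := by
  refine isPsiCircuit_iff.2 (h.nonempty_homeomorph F ho.nonempty fun s t hs hst ht hγ hv => ?_)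
  have h1 := h.subloop F hs hst ht hγ hv
  set o1 := {e ∈ o | ∃ u ∈ Set.Icc s t, γ u ∈ edgeCls G Ψ {e}} with ho1
  rcases o1.eq_empty_or_nonempty with hempty | hne
  · left
    intro u hu huo
    obtain ⟨e, he, τ, hτ⟩ := mem_edgeCls.1 huo
    have : e ∈ o1 := ⟨he, u, hu, mem_edgeCls.2 ⟨e, rfl, τ, hτ⟩⟩
    rw [hempty] at this
    exact this
  · right
    obtain ⟨o2, h2, hc⟩ := h1.exists_isCircuit_subset hE hN F hne
    have h3 : o2 = o := hc.eq_of_subset_isCircuit ho (h2.trans (Set.sep_subset _ _))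
    intro u hu huo
    have h4 : o ⊆ o1 := h3 ▸ h2
    obtain ⟨u', hu', hγu⟩ := h1.surj (Set.image_mono (fun x hx => by
      obtain ⟨e, he, hx⟩ := hx
      exact ⟨e, h4 he, hx⟩) huo)
    rw [← h.inj u' ⟨hs.trans hu'.1, hu'.2.trans ht⟩ u hu
      (hγu ▸ notMem_vertexCls_of_mem_edgeCls huo) hγu]
    exact hu'

include hE hN in
/-- If all circuits are `Ψ`-circuits, then conversely all `Ψ`-circuits are circuits, as no circle
properly contains another one. -/
theorem isCircuit_of_isPsiCircuit (F : NormalForest G)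
    (hcirc : ∀ o, N.IsCircuit o → IsPsiCircuit G Ψ o) {o : Set G.edgeSet}
    (ho : IsPsiCircuit G Ψ o) : N.IsCircuit o := by
  obtain ⟨φ⟩ := isPsiCircuit_iff.1 ho
  have hne : o.Nonempty := by
    by_contra hempty
    rw [Set.not_nonempty_iff_eq_empty] at hempty
    have h1 := (φ.symm 1).2
    obtain ⟨p, -, hp⟩ := mem_closure_iff.1 h1 Set.univ isOpen_univ trivial
    obtain ⟨e, he, -⟩ := mem_edgeCls.1 hp
    rw [hempty] at he
    exact he
  obtain ⟨e0, he0⟩ := hne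
  obtain ⟨γ, hγ⟩ := exists_isLoop (o := o) (ψ := fun z => (φ.symm z : GraphLikeQuotient G Ψ))
    (continuous_subtype_val.comp φ.symm.continuous)
    ⟨φ ⟨_, edgeStart_mem_closure F he0⟩, by
      rw [φ.symm_apply_apply]; exact ⟨_, vertexPt_mem_vertexSet _, rfl⟩⟩
    (fun z => closure_edgeCls_subset o (φ.symm z).2)
    (fun p hp => ⟨φ ⟨p, subset_closure hp⟩, congrArg Subtype.val (φ.symm_apply_apply _)⟩)
    (fun z z' _ h => φ.symm.injective (Subtype.ext h))
  obtain ⟨o2, h2, hc⟩ := hγ.exists_isCircuit_subset hE hN F ⟨e0, he0⟩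
  obtain ⟨φ2⟩ := isPsiCircuit_iff.1 (hcirc o2 hc)
  have hsub : closure (edgeCls G Ψ o2) ⊆ closure (edgeCls G Ψ o) :=
    closure_mono (Set.image_mono fun x ⟨e, he, hx⟩ => ⟨e, h2 he, hx⟩)
  have hsurj := surjective_of_continuous_injective
    (f := fun z => φ (Set.inclusion hsub (φ2.symm z)))
    (φ.continuous.comp ((continuous_inclusion hsub).comp φ2.symm.continuous))
    (φ.injective.comp ((Set.inclusion_injective hsub).comp φ2.symm.injective))
  suffices h : o ⊆ o2 by rwa [h.antisymm h2]
  intro e he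
  have hpe : cls G Ψ (edgePt Ψ e ⟨1 / 2, by norm_num, by norm_num⟩) ∈ edgeCls G Ψ o :=
    cls_edgePt_mem_edgeCls.2 he
  obtain ⟨z, hz⟩ := hsurj (φ ⟨_, subset_closure hpe⟩)
  have h3 := congrArg Subtype.val (φ.injective hz)
  have h4 := closure_edgeCls_subset o2 (φ2.symm z).2
  rw [show ((φ2.symm z : GraphLikeQuotient G Ψ)) = _ from h3] at h4
  exact cls_edgePt_mem_edgeCls.1 (h4.resolve_right edgePt_notMem_vertexCls)

end Circuits

section Contraction

variable {V : Type u} {G : SimpleGraph V} (F : NormalForest G) (ι : V ↪ ℕ)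
  {Ψ : Set (GraphEnd G)}

/-- Projecting a circle in the expanded space gives a loop. -/
theorem exists_isLoop_of_isPsiCircuit {o : Set G.edgeSet} (hne : o.Nonempty)
    {o' : Set (expGraph F ι).edgeSet} (ho' : IsPsiCircuit (expGraph F ι) (endMap F ι '' Ψ) o')
    (hroot : Disjoint o' (rootEdges F ι)) (hsub : expEdge F ι '' o ⊆ o')
    (hsub' : o' ⊆ expEdge F ι '' o ∪ (Set.range (expEdge F ι))ᶜ) :
    ∃ γ : ℝ → GraphLikeQuotient G Ψ, IsLoop γ 0 1 o := by
  obtain ⟨φ⟩ := isPsiCircuit_iff.1 ho'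
  obtain ⟨e0, he0⟩ := hne
  let v0 := edgeStart e0
  have hclos := closure_edgeCls_subset (Ψ := endMap F ι '' Ψ) o'
  have hroot' : closure (edgeCls (expGraph F ι) (endMap F ι '' Ψ) o') ⊆
      (edgeCls (expGraph F ι) (endMap F ι '' Ψ) (rootEdges F ι))ᶜ := by
    intro p hp hp'
    obtain ⟨e, he, t, rfl⟩ := mem_edgeCls.1 hp'
    exact Set.disjoint_left.1 hroot
      (cls_edgePt_mem_edgeCls.1 ((hclos hp).resolve_right edgePt_notMem_vertexCls)) he
  -- a point of the circle goes to a vertex, or lies on the copy of an edge of `o`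
  have hcases : ∀ p ∈ closure (edgeCls (expGraph F ι) (endMap F ι '' Ψ) o'),
      quotProj F ι v0 Ψ p ∈ vertexCls G Ψ ∨ ∃ e ∈ o, ∃ t,
        p = cls _ _ (edgePt _ (expEdge F ι e) t) ∧
        quotProj F ι v0 Ψ p = cls G Ψ (edgePt Ψ e (expOrient F ι e t)) := by
    intro p hp
    rcases hclos hp with h | ⟨x, hx, rfl⟩
    · obtain ⟨e', he', t, rfl⟩ := mem_edgeCls.1 h
      rw [quotProj_cls]
      by_cases her : e' ∈ Set.range (expEdge F ι)
      · obtain ⟨e, he, rfl⟩ := (hsub' he').resolve_right fun h => h her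
        exact Or.inr ⟨e, he, t, rfl, by rw [expProj_edgePt]⟩
      · rw [expProj_of_notMem_range F ι v0 her]
        exact Or.inl ⟨_, vertexPt_mem_vertexSet _, rfl⟩
    · exact Or.inl ⟨_, expProj_mem_vertexSet F ι v0 hx, rfl⟩
  refine exists_isLoop (ψ := fun z => quotProj F ι v0 Ψ (φ.symm z)) ?_ ?_ ?_ ?_ ?_
  · exact (continuousOn_quotProj F ι v0).comp_continuous
      (continuous_subtype_val.comp φ.symm.continuous) fun z => hroot' (φ.symm z).2
  · refine ⟨φ ⟨_, edgeStart_mem_closure (expForest F ι) (hsub ⟨e0, he0, rfl⟩)⟩, ?_⟩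
    rw [φ.symm_apply_apply]
    exact ⟨_, vertexPt_mem_vertexSet _, rfl⟩
  · intro z
    rcases hcases _ (φ.symm z).2 with h | ⟨e, he, t, -, h⟩
    · exact Or.inr h
    · exact Or.inl (h ▸ cls_edgePt_mem_edgeCls.2 he)
  · intro p hp
    obtain ⟨e, he, t, rfl⟩ := mem_edgeCls.1 hp
    obtain ⟨t', rfl⟩ := (expOrient_bijective F ι e).2 t
    refine ⟨φ ⟨cls _ _ (edgePt _ (expEdge F ι e) t'),
      subset_closure (cls_edgePt_mem_edgeCls.2 (hsub ⟨e, he, rfl⟩))⟩, ?_⟩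
    simp only [φ.symm_apply_apply]
    rw [quotProj_cls, expProj_edgePt]
  · intro z z' hz hzz
    obtain ⟨e, -, t, h1, h2⟩ := (hcases _ (φ.symm z).2).resolve_left hz
    obtain ⟨e', -, t', h1', h2'⟩ := (hcases _ (φ.symm z').2).resolve_left (hzz ▸ hz)
    have h3 := h2.symm.trans (hzz.trans h2')
    obtain ⟨rfl, h4⟩ := edgePt_injective (cls_eq_cls_edgePt.1 h3)
    obtain rfl := (expOrient_bijective F ι e).1 h4
    exact φ.symm.injective (Subtype.ext (h1.trans h1'.symm))

/-- If the expanded graph induces `M`, then `G` induces the contraction of `M` onto the edges that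
come from `G`. -/
theorem inducesMatroid_contract {M : Matroid (expGraph F ι).edgeSet}
    (hM : InducesMatroid (expGraph F ι) (endMap F ι '' Ψ) M) :
    InducesMatroid G Ψ ((M.contract (Set.range (expEdge F ι))ᶜ).comap (expEdge F ι)) := by
  obtain ⟨hE, hcirc, hcocirc⟩ := hM
  have hinj := expEdge_injective F ι
  set N := M.contract (Set.range (expEdge F ι))ᶜ with hNdef
  have hNE : N.E = Set.range (expEdge F ι) := by
    rw [hNdef, Matroid.contract_ground, hE, ← Set.compl_eq_univ_sdiff, compl_compl]
  have hE' : (N.comap (expEdge F ι)).E = Set.univ := by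
    rw [Matroid.comap_ground_eq, hNE, Set.preimage_range]
  have hN : ∀ b, (N.comap (expEdge F ι)).IsCocircuit b ↔ IsPsiBond G Ψ b := by
    intro b
    rw [isCocircuit_comap_iff hinj hNE, hNdef, Matroid.contract_isCocircuit_iff, hcocirc,
      isPsiBond_expEdge_iff]
    exact and_iff_left (Set.disjoint_compl_right_iff_subset.2 (Set.image_subset_range _ _))
  have hA : ∀ o, (N.comap (expEdge F ι)).IsCircuit o → IsPsiCircuit G Ψ o := by
    intro o ho
    obtain ⟨o', ho', hsub, hsub'⟩ :=
      ((isCircuit_comap_iff hinj).1 ho).exists_subset_isCircuit_of_contract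
    have hroot : Disjoint o' (rootEdges F ι) := by
      refine Set.disjoint_left.2 fun e he her => ?_
      refine ho'.inter_isCocircuit_ne_singleton
        ((hcocirc {e}).2 (isPsiBond_rootEdge F ι her _)) (e := e) ?_
      exact Set.inter_eq_right.2 (Set.singleton_subset_iff.2 he)
    obtain ⟨γ, hγ⟩ := exists_isLoop_of_isPsiCircuit F ι ho.nonempty ((hcirc o').1 ho') hroot
      hsub hsub'
    exact hγ.isPsiCircuit hE' hN F ho
  exact ⟨hE', fun o => ⟨hA o, isCircuit_of_isPsiCircuit hE' hN F hA⟩, hN⟩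

/-- If `G` is connected, it arises from the expanded graph by contracting the edges that do not
come from `G`. -/
theorem exists_isContraction (hG : G.Connected) : ∃ π : Option V × ℕ → V,
    IsContraction G (expGraph F ι) (Set.range (expEdge F ι))ᶜ π (expEdge F ι) := by
  obtain ⟨v⟩ := hG.nonempty
  obtain ⟨r, hr, -⟩ := F.exists_root v
  have hroot : ∀ s, F.par s = none → s = r := fun s hs =>
    NormalForest.root_unique_of_reachable hs hr (NormalForest.le_refl s) (NormalForest.le_refl r)
      (hG.preconnected s r)
  set K := SimpleGraph.fromEdgeSet ((fun e : (expGraph F ι).edgeSet => (e : Sym2 (Option V × ℕ))) ''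
    (Set.range (expEdge F ι))ᶜ) with hK
  have hadj : ∀ a b, (expGraph F ι).Adj a b → (a.1 = b.1 ∨ a.1 = none) → K.Adj a b := by
    intro a b hab h
    rw [hK, SimpleGraph.fromEdgeSet_adj]
    exact ⟨⟨⟨s(a, b), hab⟩, notMem_range_of_fst F ι rfl h, rfl⟩, hab.ne⟩
  have hray : ∀ x n, K.Reachable (x, n) (x, 0) := by
    intro x n
    induction n with
    | zero => exact .refl _
    | succ n ih =>
      refine SimpleGraph.Reachable.trans (SimpleGraph.Adj.reachable ?_) ih
      exact (hadj (x, n) (x, n + 1) (Or.inl (Or.inl rfl)) (Or.inl rfl)).symm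
  have hbase : ∀ a : Option V × ℕ, K.Reachable a (some (a.1.getD r), 0) := by
    rintro ⟨_ | x, n⟩
    · refine (hray none n).trans ((hray none (ι r)).symm.trans (SimpleGraph.Adj.reachable ?_))
      exact hadj (none, ι r) (some r, 0) (Or.inl (Or.inl (by simp [expPar, hr]))) (Or.inr rfl)
    · exact hray (some x) n
  refine ⟨fun a => a.1.getD r, fun v => ⟨(some v, 0), rfl⟩, fun x y => ⟨fun h => ?_, ?_⟩,
    expEdge_injective F ι, (compl_compl _).symm, fun e => ?_⟩
  · refine (hbase x).trans ?_
    rw [show x.1.getD r = y.1.getD r from h]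
    exact (hbase y).symm
  · rintro ⟨p⟩
    induction p with
    | nil => rfl
    | @cons a b c hab q ih =>
      rw [← ih]
      rw [SimpleGraph.fromEdgeSet_adj] at hab
      obtain ⟨⟨e, he, hes⟩, -⟩ := hab
      rcases contracted_cases F ι he with ⟨z, n, h⟩ | ⟨s, hs, h⟩
      · rw [show (e : Sym2 (Option V × ℕ)) = s(a, b) from hes, Sym2.eq_iff] at h
        rcases h with ⟨rfl, rfl⟩ | ⟨rfl, rfl⟩ <;> rfl
      · obtain rfl := hroot s hs
        rw [show (e : Sym2 (Option V × ℕ)) = s(a, b) from hes, Sym2.eq_iff] at h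
        rcases h with ⟨rfl, rfl⟩ | ⟨rfl, rfl⟩ <;> rfl
  · have h := congrArg (Sym2.map fun x : Option V => x.getD r) (map_expEdge F ι e)
    rw [Sym2.map_map, Sym2.map_map] at h
    exact h.trans (congrFun Sym2.map_id _)

end Contraction
end EndMatroid

theorem proposition9p14 {V : Type u} [Countable V] (G : SimpleGraph V) :
    ∃ (W : Type u) (H T : SimpleGraph W) (r : W) (C : Set H.edgeSet)
      (g : G.edgeSet → H.edgeSet)
      (h : EndMatroid.GraphEnd G → EndMatroid.GraphEnd H),
      EndMatroid.IsNormalSpanningTree H T r ∧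
      (∀ w, (T.neighborSet w).Finite) ∧
      Function.Injective g ∧ Set.range g = Cᶜ ∧
      (G.Connected → ∃ π : W → V, EndMatroid.IsContraction G H C π g) ∧
      Function.Injective h ∧
      ∀ (Ψ : Set (EndMatroid.GraphEnd G)) (M : Matroid H.edgeSet),
        EndMatroid.InducesMatroid H (h '' Ψ) M →
          EndMatroid.InducesMatroid G Ψ ((M.contract C).comap g) := by
  obtain ⟨F⟩ := EndMatroid.exists_normalForest G
  obtain ⟨i, hi⟩ := exists_injective_nat V
  let ι : V ↪ ℕ := ⟨i, hi⟩
  exact ⟨Option V × ℕ, EndMatroid.expGraph F ι, (EndMatroid.expForest F ι).tree, (none, 0),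
    (Set.range (EndMatroid.expEdge F ι))ᶜ, EndMatroid.expEdge F ι, EndMatroid.endMap F ι,
    EndMatroid.NormalForest.isNormalSpanningTree (EndMatroid.expForest_le_root F ι),
    EndMatroid.expTree_locallyFinite F ι, EndMatroid.expEdge_injective F ι, (compl_compl _).symm,
    EndMatroid.exists_isContraction F ι, EndMatroid.endMap_injective F ι,
    fun _ _ hM => EndMatroid.inducesMatroid_contract F ι hM⟩
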